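/- Let $\mathbb F$ be $\mathbb R$ or $\mathbb C$, let $0<p<\infty$, and let $w=(w_j)_{j\ge1}$ be a non-increasing sequence of positive reals with $w_1=1$, $\lim_j w_j=0$ and $\sum_j w_j=\infty$. The Garling sequence space $g(w,p)$ is the space of all scalar sequences $x=(a_j)_{j\ge 1}$ in $\mathbb F$ with $$\|x\|_{g}=\sup_{\phi}\Big(\sum_{j=1}^\infty |a_{\phi(j)}|^p\,w_j\Big)^{1/p}<\infty,$$ the supremum being over all strictly increasing maps $\phi:\mathbb N\to\mathbb N$; it is equipped with the quasi-norm $\|\cdot\|_g$. A sequence $(x_j)$ in a quasi-normed space is a basis of that space if every vector $s$ of the space has a unique expansion $s=\sum_{j=1}^\infty a_jx_j$, and it is a basic sequence if every vector of its closed linear span has a unique such expansion. Basic sequences $(x_j)$ and $(y_j)$, possibly in different spaces, are equivalent if, for all scalars $(a_j)$, the series $\sum_j a_jx_j$ converges if and only if $\sum_j a_jy_j$ converges. A basic sequence $(x_j)$ is symmetric if $(x_{\pi(j)})$ is equivalent to $(x_j)$ for every permutation $\pi$ of $\mathbb N$. Theorem. Every symmetric basic sequence of $g(w,p)$ is equivalent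 to the unit vector basis of $\ell_p$ (taken over $\mathbb F$). Consequently: 1. $g(w,p)$ has a unique symmetric basic sequence up to equivalence, that is, it has a symmetric basic sequence $B_0$ and every symmetric basic sequence of $g(w,p)$ is equivalent to $B_0$; 2. $g(w,p)$ has no symmetric basis, that is, no basis of the whole space $g(w,p)$ is a symmetric basic sequence. -/

import Mathlib

open Filter Topology
open scoped ENNReal

/-! ### Bases and basic sequences in quasi-normed spaces

The notions below refer to the topology given by a quasi-norm, written `‖ ‖`: a sequence `(sₙ)`
converges to `s` when `‖s - sₙ‖ → 0`. They apply to spaces that need not be locally convex.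
Sequences are indexed by `ℕ = {0, 1, 2, …}`. -/

section BasicSequences

variable (𝕜 : Type*) {E : Type*} {F : Type*} [RCLike 𝕜]
  [AddCommGroup E] [Module 𝕜 E] [Norm E] [AddCommGroup F] [Module 𝕜 F] [Norm F]

/-- The norm function of `E` is a quasi-norm. -/
structure IsQuasiNorm (E : Type*) [AddCommGroup E] [Module 𝕜 E] [Norm E] : Prop where
  norm_nonneg : ∀ x : E, 0 ≤ ‖x‖
  norm_eq_zero : ∀ x : E, ‖x‖ = 0 ↔ x = 0
  norm_smul : ∀ (c : 𝕜) (x : E), ‖c • x‖ = ‖c‖ * ‖x‖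
  norm_add_le : ∃ K : ℝ, ∀ x y : E, ‖x + y‖ ≤ K * (‖x‖ + ‖y‖)

variable {𝕜}

/-- `s = ∑ aⱼ xⱼ`, the series converging (as a sequence of partial sums) in the quasi-norm. -/
def SeriesTendsto (a : ℕ → 𝕜) (x : ℕ → E) (s : E) : Prop :=
  Tendsto (fun n : ℕ => ‖s - ∑ j ∈ Finset.range n, a j • x j‖) atTop (𝓝 0)

/-- The series `∑ aⱼ xⱼ` converges in `E`. -/
def SeriesConverges (a : ℕ → 𝕜) (x : ℕ → E) : Prop :=
  ∃ s : E, SeriesTendsto a x s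

variable (𝕜)

/-- The closed linear span of the sequence `x`. -/
def closedSpan (x : ℕ → E) : Set E :=
  {s | ∀ ε : ℝ, 0 < ε → ∃ z ∈ Submodule.span 𝕜 (Set.range x), ‖s - z‖ < ε}

/-- `x` is a (Schauder) basis of `E`. -/
def IsSchauderBasis (x : ℕ → E) : Prop :=
  ∀ s : E, ∃! a : ℕ → 𝕜, SeriesTendsto a x s

/-- `x` is a basic sequence: a (Schauder) basis of its closed linear span. -/
def IsBasicSeq (x : ℕ → E) : Prop :=
  ∀ s ∈ closedSpan 𝕜 x, ∃! a : ℕ → 𝕜, SeriesTendsto a x s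

/-- Equivalence of basic sequences, possibly in different spaces. -/
def BasicSeqEquiv (x : ℕ → E) (y : ℕ → F) : Prop :=
  ∀ a : ℕ → 𝕜, SeriesConverges a x ↔ SeriesConverges a y

/-- `x` is a symmetric basic sequence: a basic sequence that is equivalent to each of its
rearrangements. -/
def IsSymmetricBasicSeq (x : ℕ → E) : Prop :=
  IsBasicSeq 𝕜 x ∧ ∀ π : Equiv.Perm ℕ, BasicSeqEquiv 𝕜 (fun j => x (π j)) x

end BasicSequences

/-! ### Garling sequence spaces -/

/-- The class of weights: non-increasing positive sequences with first term `1` that belong to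
`c₀` but not to `ℓ₁`. -/
structure IsGarlingWeight (w : ℕ → ℝ) : Prop where
  first : w 0 = 1
  antitone : Antitone w
  pos : ∀ j, 0 < w j
  tendsto_zero : Tendsto w atTop (𝓝 0)
  not_summable : ¬ Summable w

section Garling

variable {𝕜 : Type*} [RCLike 𝕜]

/-- The Garling quasi-norm of an arbitrary scalar sequence, with values in `[0, ∞]`:
the supremum over all strictly increasing `φ` of `(∑ⱼ |x_{φ(j)}|^p wⱼ)^{1/p}`. -/
noncomputable def garlingENorm (w : ℕ → ℝ) (p : ℝ) (x : ℕ → 𝕜) : ℝ≥0∞ :=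
  ⨆ φ : {φ : ℕ → ℕ // StrictMono φ},
    (∑' j, ‖x (φ.1 j)‖ₑ ^ p * ENNReal.ofReal (w j)) ^ (1 / p)

theorem garlingENorm_add_le (w : ℕ → ℝ) {p : ℝ} (hp : 0 < p) (x y : ℕ → 𝕜) :
    garlingENorm w p (x + y) ≤
      (2 * 2 ^ (1 / p)) * (garlingENorm w p x + garlingENorm w p y) := by
  have hp' : 0 < 1 / p := by positivity
  refine iSup_le fun φ => ?_
  set A := ∑' j, ‖x (φ.1 j)‖ₑ ^ p * ENNReal.ofReal (w j) with hA
  set B := ∑' j, ‖y (φ.1 j)‖ₑ ^ p * ENNReal.ofReal (w j) with hB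
  have h1 : ∑' j, ‖(x + y) (φ.1 j)‖ₑ ^ p * ENNReal.ofReal (w j) ≤ 2 ^ p * (A + B) := by
    rw [hA, hB, ← ENNReal.tsum_add, ← ENNReal.tsum_mul_left]
    refine ENNReal.tsum_le_tsum fun j => ?_
    rw [← add_mul, ← mul_assoc]
    refine mul_le_mul_left ?_ _
    have h2 : ‖(x + y) (φ.1 j)‖ₑ ≤ 2 * max ‖x (φ.1 j)‖ₑ ‖y (φ.1 j)‖ₑ := by
      refine (enorm_add_le _ _).trans ?_
      rw [two_mul]
      exact add_le_add (le_max_left _ _) (le_max_right _ _)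
    refine (ENNReal.rpow_le_rpow h2 hp.le).trans ?_
    rw [ENNReal.mul_rpow_of_nonneg _ _ hp.le]
    refine mul_le_mul_right ?_ _
    rcases le_total ‖x (φ.1 j)‖ₑ ‖y (φ.1 j)‖ₑ with h | h
    · rw [max_eq_right h]; exact le_add_self
    · rw [max_eq_left h]; exact le_self_add
  have hx : A ^ (1 / p) ≤ garlingENorm w p x :=
    le_iSup (fun φ : {φ : ℕ → ℕ // StrictMono φ} =>
      (∑' j, ‖x (φ.1 j)‖ₑ ^ p * ENNReal.ofReal (w j)) ^ (1 / p)) φ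
  have hy : B ^ (1 / p) ≤ garlingENorm w p y :=
    le_iSup (fun φ : {φ : ℕ → ℕ // StrictMono φ} =>
      (∑' j, ‖y (φ.1 j)‖ₑ ^ p * ENNReal.ofReal (w j)) ^ (1 / p)) φ
  have h3 : (A + B) ^ (1 / p) ≤ 2 ^ (1 / p) * (A ^ (1 / p) + B ^ (1 / p)) := by
    have h4 : A + B ≤ 2 * max A B := by
      rw [two_mul]; exact add_le_add (le_max_left _ _) (le_max_right _ _)
    refine (ENNReal.rpow_le_rpow h4 hp'.le).trans ?_
    rw [ENNReal.mul_rpow_of_nonneg _ _ hp'.le]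
    refine mul_le_mul_right ?_ _
    rcases le_total A B with h | h
    · rw [max_eq_right h]; exact le_add_self
    · rw [max_eq_left h]; exact le_self_add
  refine (ENNReal.rpow_le_rpow h1 hp'.le).trans ?_
  rw [ENNReal.mul_rpow_of_nonneg _ _ hp'.le, ← ENNReal.rpow_mul,
    mul_one_div_cancel hp.ne', ENNReal.rpow_one, mul_assoc]
  refine mul_le_mul_right (h3.trans ?_) _
  exact mul_le_mul_right (add_le_add hx hy) _

theorem garlingENorm_smul (w : ℕ → ℝ) {p : ℝ} (hp : 0 < p) (c : 𝕜) (x : ℕ → 𝕜) :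
    garlingENorm w p (c • x) = ‖c‖ₑ * garlingENorm w p x := by
  have hp' : 0 < 1 / p := by positivity
  unfold garlingENorm
  rw [ENNReal.mul_iSup]
  refine iSup_congr fun φ => ?_
  have h1 : ∑' j, ‖(c • x) (φ.1 j)‖ₑ ^ p * ENNReal.ofReal (w j) =
      ‖c‖ₑ ^ p * ∑' j, ‖x (φ.1 j)‖ₑ ^ p * ENNReal.ofReal (w j) := by
    rw [← ENNReal.tsum_mul_left]
    refine tsum_congr fun j => ?_
    rw [Pi.smul_apply, smul_eq_mul, enorm_mul, ENNReal.mul_rpow_of_nonneg _ _ hp.le, mul_assoc]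
  rw [h1, ENNReal.mul_rpow_of_nonneg _ _ hp'.le, ← ENNReal.rpow_mul,
    mul_one_div_cancel hp.ne', ENNReal.rpow_one]

theorem garlingENorm_zero (w : ℕ → ℝ) {p : ℝ} (hp : 0 < p) :
    garlingENorm w p (0 : ℕ → 𝕜) = 0 := by
  have h := garlingENorm_smul w hp (0 : 𝕜) (0 : ℕ → 𝕜)
  rwa [zero_smul, enorm_zero, zero_mul] at h

variable (𝕜)

/-- The sequences with finite Garling quasi-norm, as a subspace of all scalar sequences. -/
noncomputable def garlingSubmodule (w : ℕ → ℝ) (p : ℝ) (hp : 0 < p) : Submodule 𝕜 (ℕ → 𝕜) where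
  carrier := {x | garlingENorm w p x < ∞}
  zero_mem' := by
    rw [Set.mem_ofPred_eq, garlingENorm_zero w hp]; exact ENNReal.zero_lt_top
  add_mem' := by
    intro x y hx hy
    refine (garlingENorm_add_le w hp x y).trans_lt ?_
    refine ENNReal.mul_lt_top (ENNReal.mul_lt_top (by simp) ?_) (ENNReal.add_lt_top.2 ⟨hx, hy⟩)
    exact ENNReal.rpow_lt_top_of_nonneg (by positivity) (by simp)
  smul_mem' := by
    intro c x hx
    rw [Set.mem_ofPred_eq, garlingENorm_smul w hp]
    exact ENNReal.mul_lt_top enorm_lt_top hx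

/-- The Garling sequence space `g(w, p)` over the real or complex field `𝕜`. It is a separate type
so that it carries only its quasi-norm, and not the product topology. -/
def GarlingSpace (w : ℕ → ℝ) (p : ℝ) (hp : 0 < p) : Type _ :=
  ↥(garlingSubmodule 𝕜 w p hp)

noncomputable instance GarlingSpace.instAddCommGroup (w : ℕ → ℝ) (p : ℝ) (hp : 0 < p) :
    AddCommGroup (GarlingSpace 𝕜 w p hp) :=
  inferInstanceAs (AddCommGroup ↥(garlingSubmodule 𝕜 w p hp))

noncomputable instance GarlingSpace.instModule (w : ℕ → ℝ) (p : ℝ) (hp : 0 < p) :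
    Module 𝕜 (GarlingSpace 𝕜 w p hp) :=
  inferInstanceAs (Module 𝕜 ↥(garlingSubmodule 𝕜 w p hp))

/-- The quasi-norm of `g(w, p)`. -/
noncomputable instance GarlingSpace.instNorm (w : ℕ → ℝ) (p : ℝ) (hp : 0 < p) :
    Norm (GarlingSpace 𝕜 w p hp) where
  norm x := (garlingENorm w p x.1).toReal

theorem GarlingSpace.isQuasiNorm {w : ℕ → ℝ} (hw : IsGarlingWeight w) {p : ℝ} (hp : 0 < p) :
    IsQuasiNorm 𝕜 (GarlingSpace 𝕜 w p hp) where
  norm_nonneg x := ENNReal.toReal_nonneg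
  norm_eq_zero x := by
    constructor
    · intro h
      have h0 : garlingENorm w p x.1 = 0 := by
        rcases (ENNReal.toReal_eq_zero_iff _).1 h with h | h
        · exact h
        · exact absurd h (ne_of_lt x.2)
      refine Subtype.ext (funext fun i => ?_)
      have h1 := (iSup_eq_bot.1 h0) ⟨fun j => j + i, fun a b hab => Nat.add_lt_add_right hab i⟩
      rw [bot_eq_zero, ENNReal.rpow_eq_zero_iff_of_pos (by positivity), ENNReal.tsum_eq_zero] at h1
      have h2 := h1 0
      simp only [zero_add, hw.first, ENNReal.ofReal_one, mul_one] at h2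
      rw [ENNReal.rpow_eq_zero_iff_of_pos hp, enorm_eq_zero] at h2
      exact h2
    · rintro rfl
      change (garlingENorm w p (0 : ℕ → 𝕜)).toReal = 0
      rw [garlingENorm_zero w hp, ENNReal.toReal_zero]
  norm_smul c x := by
    change (garlingENorm w p (c • x.1)).toReal = ‖c‖ * (garlingENorm w p x.1).toReal
    rw [garlingENorm_smul w hp, ENNReal.toReal_mul, toReal_enorm]
  norm_add_le := by
    refine ⟨((2 : ℝ≥0∞) * 2 ^ (1 / p)).toReal, fun x y => ?_⟩
    change (garlingENorm w p (x.1 + y.1)).toReal ≤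
      _ * ((garlingENorm w p x.1).toReal + (garlingENorm w p y.1).toReal)
    rw [← ENNReal.toReal_add (ne_of_lt x.2) (ne_of_lt y.2), ← ENNReal.toReal_mul]
    refine ENNReal.toReal_mono (ne_of_lt ?_) (garlingENorm_add_le w hp x.1 y.1)
    refine ENNReal.mul_lt_top (ENNReal.mul_lt_top (by simp) ?_) (ENNReal.add_lt_top.2 ⟨x.2, y.2⟩)
    exact ENNReal.rpow_lt_top_of_nonneg (by positivity) (by simp)

/-- The unit vector basis of `ℓ_p`, `0 < p < ∞`, as a sequence in Mathlib's space `lp`, whose norm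
function is `‖f‖ = (∑ᵢ |fᵢ|^p)^{1/p}` (a quasi-norm when `p < 1`). -/
noncomputable def lpUnitVectorBasis (p : ℝ) : ℕ → lp (fun _ : ℕ => 𝕜) (ENNReal.ofReal p) :=
  fun j => lp.single (ENNReal.ofReal p) j (1 : 𝕜)

end Garling

/-! The power `min p 1` of the quasi-norm is a complete group norm with the same convergent series
(`RGarling`). The power `max p 1` of that norm is the supremum over finite sets `A` of `garlingSum w
p A`, in which the elements of `A` receive the weights in increasing order. For fixed `A` this
quantity is additive over disjoint supports, so bounded block sequences always have an upper
`p`-estimate; the work lies in the lower one.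

A symmetric basic sequence is symmetric with uniform constants: Baire category bounds the partial
sum projections (`exists_basis_constant`) and a gliding hump bounds all relabellings
(`exists_isUniformlySymmetric`). Differences along a coordinatewise convergent subsequence are
coordinatewise null, and symmetry makes them equivalent to the original sequence; a second gliding
hump replaces them by blocks (`exists_equivalent_blocks`).

For symmetric blocks there is a dichotomy (`hasLpEstimate_of_blocks`). Suppose first that, however
many initial weights are discarded, blocks arbitrarily far out keep a fixed size. Such blocks can be
strung together without loss, since earlier indices only shift the weights; a subsequence dominates
`ℓ_p`, and by symmetry so does the whole sequence. Otherwise shifting the weights destroys the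
blocks uniformly. Sums of many blocks are unbounded because `w` is not summable, so normalized sums
of many blocks are flat: their coordinates are tiny. When flatter and flatter groups are placed in
order, each loses little by being preceded by the others, and their sizes add up. In reversed order
the flat group stands on the left: few indices chosen in it contribute nothing, and many of them
shift the weights so far that the rest is lost. The norm stays bounded, which contradicts symmetry
(`not_isUniformlySymmetric_of_shift_decay`).

Normalized blocks with constant coefficients provide an `ℓ_p` sequence
(`exists_isBasicSeq_hasLpEstimate`). If a sequence equivalent to the basis of `ℓ_p` expanded every
vector, differences of unit vectors would be close to blocks of it, and sums of `n` of them would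
have size of order `n`. But sums of `n` distinct unit vectors have size `o(n)`, since `w` tends to
zero (`HasLpEstimate.exists_not_seriesTendsto`). -/

/-! ### Complete spaces with a homogeneous group norm -/

/-- The group norm of `E` is homogeneous of degree `r > 0`. -/
structure IsHomogeneousNorm (𝕜 E : Type*) [RCLike 𝕜] [NormedAddCommGroup E] [Module 𝕜 E]
    (r : ℝ) : Prop where
  pos : 0 < r
  norm_smul : ∀ (c : 𝕜) (x : E), ‖c • x‖ = ‖c‖ ^ r * ‖x‖

section Abstract

variable {𝕜 E : Type*} [RCLike 𝕜] [NormedAddCommGroup E] [Module 𝕜 E] {r : ℝ}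

theorem seriesTendsto_iff {a : ℕ → 𝕜} {x : ℕ → E} {s : E} :
    SeriesTendsto a x s ↔
      Tendsto (fun n => ∑ j ∈ Finset.range n, a j • x j) atTop (𝓝 s) := by
  rw [tendsto_iff_norm_sub_tendsto_zero (b := s)]
  simp_rw [norm_sub_rev _ s]
  rfl

theorem closedSpan_eq_closure (x : ℕ → E) :
    closedSpan 𝕜 x = closure (Submodule.span 𝕜 (Set.range x) : Set E) := by
  ext s
  simp [closedSpan, Metric.mem_closure_iff, dist_eq_norm]

theorem IsHomogeneousNorm.continuous_smul_left (h : IsHomogeneousNorm 𝕜 E r) (x : E) :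
    Continuous fun c : 𝕜 => c • x := by
  rw [continuous_iff_continuousAt]
  intro c
  rw [ContinuousAt, tendsto_iff_norm_sub_tendsto_zero]
  have h1 : Tendsto (fun b : 𝕜 => ‖b - c‖ ^ r * ‖x‖) (𝓝 c) (𝓝 (‖c - c‖ ^ r * ‖x‖)) := by
    refine Tendsto.mul_const _ ?_
    refine ((continuous_id.sub continuous_const).norm.tendsto c).rpow_const (Or.inr h.pos.le)
  rw [sub_self, norm_zero, Real.zero_rpow h.pos.ne', zero_mul] at h1
  simpa only [← sub_smul, h.norm_smul] using h1

theorem IsHomogeneousNorm.hasSum_smul (h : IsHomogeneousNorm 𝕜 E r) {a : ℕ → 𝕜} {b : 𝕜}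
    (ha : HasSum a b) (x : E) : HasSum (fun k => a k • x) (b • x) :=
  ha.map (AddMonoidHom.mk' (fun c : 𝕜 => c • x) fun c d => add_smul c d x)
    (h.continuous_smul_left x)

theorem sub_mem_closedSpan {x : ℕ → E} {s t : E}
    (hs : s ∈ closedSpan 𝕜 x) (ht : t ∈ closedSpan 𝕜 x) : s - t ∈ closedSpan 𝕜 x := by
  rw [closedSpan_eq_closure] at *
  exact (Submodule.span 𝕜 (Set.range x)).toAddSubgroup.topologicalClosure.sub_mem hs ht

theorem IsHomogeneousNorm.smul_mem_closedSpan (h : IsHomogeneousNorm 𝕜 E r) {x : ℕ → E} {s : E}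
    (c : 𝕜) (hs : s ∈ closedSpan 𝕜 x) : c • s ∈ closedSpan 𝕜 x := by
  intro ε hε
  have hc : 0 < ‖c‖ ^ r + 1 := by positivity
  obtain ⟨z, hz, hsz⟩ := hs (ε / (‖c‖ ^ r + 1)) (by positivity)
  refine ⟨c • z, Submodule.smul_mem _ c hz, ?_⟩
  rw [← smul_sub, h.norm_smul]
  rw [lt_div_iff₀ hc] at hsz
  nlinarith [norm_nonneg (s - z)]

theorem sum_mem_closedSpan (x : ℕ → E) (s : Finset ℕ) (a : ℕ → 𝕜) :
    ∑ j ∈ s, a j • x j ∈ closedSpan 𝕜 x := by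
  rw [closedSpan_eq_closure]
  exact subset_closure (Submodule.sum_mem _ fun j _ =>
    Submodule.smul_mem _ _ (Submodule.subset_span ⟨j, rfl⟩))

/-- Superposition of countably many dominated convergent series along the same sequence. -/
theorem IsHomogeneousNorm.tendsto_superposition [CompleteSpace E] (h : IsHomogeneousNorm 𝕜 E r)
    {x : ℕ → E} {A : ℕ → ℕ → 𝕜} {a : ℕ → 𝕜} {v : ℕ → E} {β : ℕ → ℝ} (hβ : Summable β)
    (hb : ∀ k n, ‖∑ j ∈ Finset.range n, A k j • x j‖ ≤ β k)
    (hv : ∀ k, Tendsto (fun n => ∑ j ∈ Finset.range n, A k j • x j) atTop (𝓝 (v k)))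
    (ha : ∀ j, HasSum (fun k => A k j) (a j)) :
    Tendsto (fun n => ∑ j ∈ Finset.range n, a j • x j) atTop (𝓝 (∑' k, v k)) ∧
      ∀ n, ‖∑ j ∈ Finset.range n, a j • x j‖ ≤ ∑' k, β k := by
  have hs : ∀ n, ∑' k, ∑ j ∈ Finset.range n, A k j • x j = ∑ j ∈ Finset.range n, a j • x j :=
    fun n => (hasSum_sum fun j _ => h.hasSum_smul (ha j) (x j)).tsum_eq
  constructor
  · simp_rw [← hs]
    exact tendsto_tsum_of_dominated_convergence hβ hv (Eventually.of_forall fun n k => hb k n)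
  · intro n
    rw [← hs]
    exact tsum_of_norm_bounded hβ.hasSum fun k => hb k n

theorem IsBasicSeq.ne_zero {x : ℕ → E} (hx : IsBasicSeq 𝕜 x) (j : ℕ) : x j ≠ 0 := by
  intro hj
  have h0 : (0 : E) ∈ closedSpan 𝕜 x := by
    simpa using sum_mem_closedSpan (𝕜 := 𝕜) x ∅ 0
  obtain ⟨a, -, ha⟩ := hx 0 h0
  have h1 := ha 0 (by simp [SeriesTendsto])
  have h2 := ha (Pi.single j 1) (by
    have : ∀ n, ∑ i ∈ Finset.range n, (Pi.single j (1 : 𝕜) : ℕ → 𝕜) i • x i = 0 := by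
      intro n
      refine Finset.sum_eq_zero fun i _ => ?_
      rcases eq_or_ne i j with rfl | hi
      · rw [hj, smul_zero]
      · rw [Pi.single_eq_of_ne hi, zero_smul]
    simp [SeriesTendsto, this])
  have h3 := congrFun (h1.trans h2.symm) j
  simp at h3

/-- The vectors with an expansion along `x` all of whose partial sums have norm at most `R`. -/
def boundedExpansions (𝕜 : Type*) {E : Type*} [RCLike 𝕜] [NormedAddCommGroup E] [Module 𝕜 E]
    (x : ℕ → E) (R : ℝ) : Set E :=
  {s | ∃ a : ℕ → 𝕜, Tendsto (fun n => ∑ j ∈ Finset.range n, a j • x j) atTop (𝓝 s) ∧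
    ∀ n, ‖∑ j ∈ Finset.range n, a j • x j‖ ≤ R}

theorem boundedExpansions_subset (x : ℕ → E) (R : ℝ) :
    boundedExpansions 𝕜 x R ⊆ closedSpan 𝕜 x := by
  rintro s ⟨a, ha, -⟩
  have : IsClosed (closedSpan 𝕜 x) := by rw [closedSpan_eq_closure]; exact isClosed_closure
  exact this.mem_of_tendsto ha (Eventually.of_forall fun n => sum_mem_closedSpan x _ a)

theorem sub_mem_boundedExpansions {x : ℕ → E} {R R' : ℝ} {s t : E}
    (hs : s ∈ boundedExpansions 𝕜 x R) (ht : t ∈ boundedExpansions 𝕜 x R') :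
    s - t ∈ boundedExpansions 𝕜 x (R + R') := by
  obtain ⟨a, ha, ha'⟩ := hs
  obtain ⟨b, hb, hb'⟩ := ht
  refine ⟨fun j => a j - b j, ?_, fun n => ?_⟩
  · simpa only [sub_smul, Finset.sum_sub_distrib] using ha.sub hb
  · simp only [sub_smul, Finset.sum_sub_distrib]
    exact (norm_sub_le _ _).trans (add_le_add (ha' n) (hb' n))

theorem IsHomogeneousNorm.continuous_const_smul (h : IsHomogeneousNorm 𝕜 E r) (c : 𝕜) :
    Continuous fun x : E => c • x := by
  rw [continuous_iff_continuousAt]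
  intro y
  rw [ContinuousAt, tendsto_iff_norm_sub_tendsto_zero]
  have h1 : Tendsto (fun x : E => ‖c‖ ^ r * ‖x - y‖) (𝓝 y) (𝓝 (‖c‖ ^ r * ‖y - y‖)) :=
    Tendsto.const_mul _ ((continuous_id.sub continuous_const).norm.tendsto y)
  rw [sub_self, norm_zero, mul_zero] at h1
  simpa only [← smul_sub, h.norm_smul] using h1

theorem IsHomogeneousNorm.smul_mem_boundedExpansions (h : IsHomogeneousNorm 𝕜 E r) {x : ℕ → E}
    {R : ℝ} {s : E} (c : 𝕜) (hs : s ∈ boundedExpansions 𝕜 x R) :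
    c • s ∈ boundedExpansions 𝕜 x (‖c‖ ^ r * R) := by
  obtain ⟨a, ha, ha'⟩ := hs
  have he : ∀ n, ∑ j ∈ Finset.range n, (c * a j) • x j =
      c • ∑ j ∈ Finset.range n, a j • x j := fun n => by
    rw [Finset.smul_sum]; simp_rw [mul_smul]
  refine ⟨fun j => c * a j, ?_, fun n => ?_⟩
  · simp_rw [he]
    exact ((h.continuous_const_smul c).tendsto s).comp ha
  · rw [he, h.norm_smul]
    exact mul_le_mul_of_nonneg_left (ha' n) (by positivity)

/-- Baire category: the closures of the sets of `m`-bounded expansions cover the closed span, so one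
of them contains a ball. Subtracting its centre moves the ball to the origin and doubles the bound.
-/
theorem exists_dense_boundedExpansions [CompleteSpace E] {x : ℕ → E} (hx : IsBasicSeq 𝕜 x) :
    ∃ δ > 0, ∃ R > 0, ∀ u ∈ closedSpan 𝕜 x, ‖u‖ < δ →
      u ∈ closure (boundedExpansions 𝕜 x R) := by
  have hcl : IsClosed (closedSpan 𝕜 x) := by rw [closedSpan_eq_closure]; exact isClosed_closure
  have : CompleteSpace (closedSpan 𝕜 x) := hcl.completeSpace_coe
  have h0 : (0 : E) ∈ closedSpan 𝕜 x := by
    simpa using sum_mem_closedSpan (𝕜 := 𝕜) x ∅ 0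
  have : Nonempty (closedSpan 𝕜 x) := ⟨⟨0, h0⟩⟩
  let f : ℕ → Set (closedSpan 𝕜 x) := fun m => Subtype.val ⁻¹' closure (boundedExpansions 𝕜 x m)
  obtain ⟨m, ⟨s₀, hs₀⟩⟩ := nonempty_interior_of_iUnion_of_closed (f := f)
    (fun m => isClosed_closure.preimage continuous_subtype_val) (by
      refine Set.eq_univ_of_forall fun s => Set.mem_iUnion.2 ?_
      obtain ⟨a, ha, -⟩ := hx s.1 s.2
      have ha' := seriesTendsto_iff.1 ha
      obtain ⟨C, hC⟩ := (Metric.isBounded_range_of_tendsto _ ha').exists_norm_le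
      obtain ⟨m, hm⟩ := exists_nat_ge C
      exact ⟨m, subset_closure ⟨a, ha', fun n => (hC _ ⟨n, rfl⟩).trans hm⟩⟩)
  rw [mem_interior_iff_mem_nhds, Metric.mem_nhds_iff] at hs₀
  obtain ⟨δ, hδ, hball⟩ := hs₀
  refine ⟨δ, hδ, (m : ℝ) + m + 1, by positivity, fun u hu hun => ?_⟩
  have hadd : (s₀ : E) + u ∈ closedSpan 𝕜 x := by
    have := sub_mem_closedSpan s₀.2
      (sub_mem_closedSpan h0 hu)
    simpa using this
  have h1 : (s₀ : E) + u ∈ closure (boundedExpansions 𝕜 x m) :=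
    hball (a := ⟨s₀ + u, hadd⟩) (by
      rw [Metric.mem_ball, Subtype.dist_eq, dist_eq_norm]; simpa using hun)
  have h2 : (s₀ : E) ∈ closure (boundedExpansions 𝕜 x m) :=
    hball (Metric.mem_ball_self hδ)
  rw [Metric.mem_closure_iff] at *
  intro ε hε
  obtain ⟨b, hb, hb'⟩ := h1 (ε / 2) (by positivity)
  obtain ⟨c, hc, hc'⟩ := h2 (ε / 2) (by positivity)
  obtain ⟨e, he, he'⟩ := sub_mem_boundedExpansions hb hc
  refine ⟨b - c, ⟨e, he, fun n => (he' n).trans (by linarith)⟩, ?_⟩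
  rw [dist_eq_norm] at *
  calc ‖u - (b - c)‖ = ‖(s₀ + u - b) - (s₀ - c)‖ := by congr 1; abel
    _ ≤ _ := norm_sub_le _ _
    _ < ε := by linarith

/-- The closure is removed as in the open mapping theorem: approximate, rescale the remainder,
repeat, and superpose the resulting expansions. -/
theorem IsHomogeneousNorm.exists_ball_subset_boundedExpansions [CompleteSpace E]
    (h : IsHomogeneousNorm 𝕜 E r) {x : ℕ → E} (hx : IsBasicSeq 𝕜 x) :
    ∃ δ > 0, ∃ R > 0, ∀ u ∈ closedSpan 𝕜 x, ‖u‖ < δ → u ∈ boundedExpansions 𝕜 x R := by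
  obtain ⟨δ, hδ, R, hR, hd⟩ := exists_dense_boundedExpansions hx
  -- Halving a vector multiplies its norm by `θ`.
  set θ : ℝ := (1 / 2) ^ r with hθ
  have hθ0 : 0 < θ := by positivity
  have hθ1 : θ < 1 := Real.rpow_lt_one (by norm_num) (by norm_num) h.pos
  have hsum : Summable fun k => R * θ ^ k :=
    (summable_geometric_of_lt_one hθ0.le hθ1).mul_left R
  have hpow : ∀ k : ℕ, ‖((1 / 2 : ℝ) : 𝕜) ^ k‖ ^ r = θ ^ k := fun k => by
    rw [norm_pow, RCLike.norm_ofReal, abs_of_pos (by norm_num), ← Real.rpow_natCast,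
      ← Real.rpow_mul (by norm_num), mul_comm, Real.rpow_mul (by norm_num), Real.rpow_natCast]
  -- The hypothesis on `u` stands inside the existential so that `choose` yields a total function;
  -- outside the relevant ball its value is irrelevant.
  have step : ∀ (k : ℕ) (u : E), ∃ v, (u ∈ closedSpan 𝕜 x ∧ ‖u‖ < δ * θ ^ k) →
      v ∈ boundedExpansions 𝕜 x (R * θ ^ k) ∧ u - v ∈ closedSpan 𝕜 x ∧
        ‖u - v‖ < δ * θ ^ (k + 1) := by
    intro k u
    by_cases hu : u ∈ closedSpan 𝕜 x ∧ ‖u‖ < δ * θ ^ k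
    swap
    · exact ⟨0, fun hu' => absurd hu' hu⟩
    have hc : ((1 / 2 : ℝ) : 𝕜) ^ k ≠ 0 := by
      refine pow_ne_zero _ ?_
      rw [Ne, RCLike.ofReal_eq_zero]; norm_num
    set c : 𝕜 := ((1 / 2 : ℝ) : 𝕜) ^ k with hcdef
    have h1 : c⁻¹ • u ∈ closure (boundedExpansions 𝕜 x R) := by
      refine hd _ (h.smul_mem_closedSpan _ hu.1) ?_
      rw [h.norm_smul, norm_inv, Real.inv_rpow (norm_nonneg _), hpow, inv_mul_lt_iff₀ (by positivity)]
      linarith [hu.2]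
    rw [Metric.mem_closure_iff] at h1
    obtain ⟨v, hv, hv'⟩ := h1 (δ * θ) (by positivity)
    have h2 := h.smul_mem_boundedExpansions c hv
    rw [hpow, mul_comm] at h2
    refine ⟨c • v, fun _ => ⟨h2, sub_mem_closedSpan hu.1
      (boundedExpansions_subset _ _ h2), ?_⟩⟩
    have h3 : u - c • v = c • (c⁻¹ • u - v) := by rw [smul_sub, smul_inv_smul₀ hc]
    rw [h3, h.norm_smul, hpow, ← dist_eq_norm, pow_succ]
    calc θ ^ k * dist (c⁻¹ • u) v < θ ^ k * (δ * θ) := by gcongr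
      _ = _ := by ring
  choose f hf using step
  refine ⟨δ, hδ, ∑' k, R * θ ^ k, ?_, fun u hu hun => ?_⟩
  · exact hsum.tsum_pos (fun k => by positivity) 0 (by positivity)
  let U : ℕ → E := fun k => Nat.rec u (fun k uk => uk - f k uk) k
  have hU : ∀ k, U k ∈ closedSpan 𝕜 x ∧ ‖U k‖ < δ * θ ^ k := by
    intro k
    induction k with
    | zero => exact ⟨hu, by simpa [U] using hun⟩
    | succ k ih => exact (hf k (U k) ih).2
  have hUs : ∀ k, U (k + 1) = U k - f k (U k) := fun k => rfl
  choose A hA hAb using fun k => (hf k (U k) (hU k)).1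
  have hAj : ∀ j, Summable fun k => A k j := by
    intro j
    have hxj : 0 < ‖x j‖ := norm_pos_iff.2 (hx.ne_zero j)
    -- Each term `A k j • x j` is a difference of two partial sums bounded by `R * θ ^ k`; taking
    -- `r`-th roots turns `θ ^ k` into `(1 / 2) ^ k`.
    refine Summable.of_norm_bounded (g := fun k => (2 * R / ‖x j‖) ^ (1 / r) * (1 / 2) ^ k)
      ((summable_geometric_of_lt_one (by norm_num) (by norm_num)).mul_left _) fun k => ?_
    have h1 : ‖A k j‖ ^ r * ‖x j‖ ≤ 2 * (R * θ ^ k) := by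
      rw [← h.norm_smul]
      have : A k j • x j = ∑ i ∈ Finset.range (j + 1), A k i • x i -
          ∑ i ∈ Finset.range j, A k i • x i := by
        rw [Finset.sum_range_succ]; abel
      rw [this]
      linarith [norm_sub_le (∑ i ∈ Finset.range (j + 1), A k i • x i)
        (∑ i ∈ Finset.range j, A k i • x i), hAb k (j + 1), hAb k j]
    have h2 : ‖A k j‖ ^ r ≤ 2 * R / ‖x j‖ * θ ^ k := by
      rw [div_mul_eq_mul_div, le_div_iff₀ hxj]; linarith
    calc ‖A k j‖ = (‖A k j‖ ^ r) ^ (1 / r) := by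
          rw [← Real.rpow_mul (norm_nonneg _), mul_one_div_cancel h.pos.ne', Real.rpow_one]
      _ ≤ (2 * R / ‖x j‖ * θ ^ k) ^ (1 / r) :=
          Real.rpow_le_rpow (by positivity) h2 (by have := h.pos; positivity)
      _ = _ := by
          rw [Real.mul_rpow (by positivity) (by positivity), ← hpow k, norm_pow,
            RCLike.norm_ofReal, abs_of_pos (by norm_num), ← Real.rpow_mul (by positivity),
            mul_one_div_cancel h.pos.ne', Real.rpow_one]
  obtain ⟨h1, h2⟩ := h.tendsto_superposition hsum hAb hA fun j => (hAj j).hasSum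
  refine ⟨fun j => ∑' k, A k j, ?_, h2⟩
  have hfb : ∀ k, ‖f k (U k)‖ ≤ R * θ ^ k := fun k =>
    le_of_tendsto (hA k).norm (Eventually.of_forall (hAb k))
  have hfs : Summable fun k => f k (U k) := Summable.of_norm_bounded hsum hfb
  have hpart : ∀ n, ∑ k ∈ Finset.range n, f k (U k) = u - U n := by
    intro n
    induction n with
    | zero => simp [U]
    | succ n ih => rw [Finset.sum_range_succ, ih, hUs]; abel
  have hU0 : Tendsto U atTop (𝓝 0) := by
    refine squeeze_zero_norm (fun k => (hU k).2.le) ?_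
    simpa using (tendsto_pow_atTop_nhds_zero_of_lt_one hθ0.le hθ1).const_mul δ
  have h3 : Tendsto (fun n => ∑ k ∈ Finset.range n, f k (U k)) atTop (𝓝 u) := by
    simp_rw [hpart]
    simpa using (tendsto_const_nhds (x := u)).sub hU0
  rwa [tendsto_nhds_unique hfs.hasSum.tendsto_sum_nat h3] at h1

theorem tendsto_sum_range_of_support {a : ℕ → 𝕜} {m : ℕ} (ha : ∀ j, m ≤ j → a j = 0) (x : ℕ → E) :
    Tendsto (fun n => ∑ j ∈ Finset.range n, a j • x j) atTop
      (𝓝 (∑ j ∈ Finset.range m, a j • x j)) := by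
  refine tendsto_atTop_of_eventually_const (i₀ := m) fun n hn => ?_
  refine (Finset.sum_subset (Finset.range_mono hn) fun j _ hj => ?_).symm
  rw [ha j (by simpa using hj), zero_smul]

/-- The partial sum projections of a basic sequence are uniformly bounded. -/
theorem IsHomogeneousNorm.exists_basis_constant [CompleteSpace E]
    (h : IsHomogeneousNorm 𝕜 E r) {x : ℕ → E} (hx : IsBasicSeq 𝕜 x) :
    ∃ K > 0, ∀ (a : ℕ → 𝕜) (m n : ℕ), m ≤ n →
      ‖∑ j ∈ Finset.range m, a j • x j‖ ≤ K * ‖∑ j ∈ Finset.range n, a j • x j‖ := by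
  obtain ⟨δ, hδ, R, hR, hd⟩ := h.exists_ball_subset_boundedExpansions hx
  refine ⟨2 * R / δ, by positivity, fun a m n hmn => ?_⟩
  let b : ℕ → 𝕜 := fun j => if j < n then a j else 0
  have hb : ∀ i ≤ n, ∑ j ∈ Finset.range i, b j • x j = ∑ j ∈ Finset.range i, a j • x j := by
    intro i hi
    refine Finset.sum_congr rfl fun j hj => ?_
    simp only [b]
    rw [if_pos ((Finset.mem_range.1 hj).trans_le hi)]
  rw [← hb m hmn, ← hb n le_rfl]
  set u := ∑ j ∈ Finset.range n, b j • x j with hu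
  have huZ : u ∈ closedSpan 𝕜 x := sum_mem_closedSpan x _ b
  have hbu : SeriesTendsto b x u := seriesTendsto_iff.2
    (tendsto_sum_range_of_support (fun j hj => if_neg (by lia)) x)
  -- Uniqueness of expansions identifies the bounded expansion of `t • u` with `t` times the finite
  -- one, so the bound applies to the partial sums of `u`.
  have key : ∀ t : ℝ, 0 < t → t ^ r * ‖u‖ < δ →
      t ^ r * ‖∑ j ∈ Finset.range m, b j • x j‖ ≤ R := by
    intro t ht htu
    have hn : ‖(t : 𝕜)‖ ^ r = t ^ r := by rw [RCLike.norm_ofReal, abs_of_pos ht]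
    obtain ⟨e, he, heR⟩ := hd ((t : 𝕜) • u) (h.smul_mem_closedSpan _ huZ) (by
      rw [h.norm_smul, hn]; exact htu)
    have ht0 : (t : 𝕜) ≠ 0 := by rw [Ne, RCLike.ofReal_eq_zero]; exact ht.ne'
    have h1 := ((h.continuous_const_smul (t : 𝕜)⁻¹).tendsto _).comp he
    have h2 : SeriesTendsto (fun j => (t : 𝕜)⁻¹ * e j) x u := by
      rw [seriesTendsto_iff]
      simpa [Function.comp_def, Finset.smul_sum, mul_smul, inv_smul_smul₀ ht0] using h1
    obtain ⟨a', -, ha'⟩ := hx u huZ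
    have h3 : (fun j => (t : 𝕜)⁻¹ * e j) = b := (ha' _ h2).trans (ha' _ hbu).symm
    have h4 : ∀ j, e j = (t : 𝕜) * b j := fun j => by
      rw [← congrFun h3 j, mul_inv_cancel_left₀ ht0]
    have h5 := heR m
    simp_rw [h4, mul_smul, ← Finset.smul_sum] at h5
    rwa [h.norm_smul, hn] at h5
  -- When `u = 0`, uniqueness makes all coefficients zero. Otherwise `t` is chosen so that `t ^ r *
  -- ‖u‖ = δ / 2`.
  rcases (norm_nonneg u).eq_or_lt with h0 | hpos
  · rw [← h0, mul_zero]
    have hu0 : u = 0 := norm_eq_zero.1 h0.symm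
    obtain ⟨a', -, ha'⟩ := hx u huZ
    have h3 : (fun _ => 0) = b := (ha' _ (by simp [SeriesTendsto, hu0])).trans (ha' _ hbu).symm
    rw [← h3]; simp
  · have h1 := key ((δ / 2 / ‖u‖) ^ (1 / r)) (by positivity)
    rw [← Real.rpow_mul (by positivity), one_div_mul_cancel h.pos.ne', Real.rpow_one,
      div_mul_cancel₀ _ hpos.ne'] at h1
    have h2 := h1 (by linarith)
    rw [div_div, div_mul_eq_mul_div, div_le_iff₀ (by positivity)] at h2
    rw [div_mul_eq_mul_div, le_div_iff₀ hδ]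
    linarith

end Abstract

/-! ### Uniform constants for symmetric basic sequences -/

section Symmetric

variable {𝕜 E : Type*} [RCLike 𝕜] [NormedAddCommGroup E] [Module 𝕜 E] {r : ℝ}

/-- A sequence whose finite linear combinations are controlled, up to the factor `C`, under
relabelling of the vectors and under passing to subsums. -/
structure IsUniformlySymmetric (𝕜 : Type*) {E : Type*} [RCLike 𝕜] [NormedAddCommGroup E]
    [Module 𝕜 E] (x : ℕ → E) (C : ℝ) : Prop where
  pos : 0 < C
  ne_zero : ∀ j, x j ≠ 0
  relabel : ∀ (s : Finset ℕ) (a : ℕ → 𝕜) (σ τ : ℕ → ℕ), Set.InjOn σ s → Set.InjOn τ s →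
    ‖∑ j ∈ s, a j • x (σ j)‖ ≤ C * ‖∑ j ∈ s, a j • x (τ j)‖
  subsum : ∀ (s t : Finset ℕ) (a : ℕ → 𝕜), s ⊆ t →
    ‖∑ j ∈ s, a j • x j‖ ≤ C * ‖∑ j ∈ t, a j • x j‖

/-- The partial bijections `π k` of the sets `s k ⊆ [N k, N (k + 1))` into the same intervals, both
missing the last point, extend to a common permutation of `ℕ`. -/
theorem exists_perm_extending {N : ℕ → ℕ} (hN : StrictMono N) (s : ℕ → Finset ℕ)
    (π : ℕ → ℕ → ℕ) (hs : ∀ k, ∀ j ∈ s k, N k ≤ j ∧ j + 1 < N (k + 1))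
    (hπ : ∀ k, ∀ j ∈ s k, N k ≤ π k j ∧ π k j + 1 < N (k + 1))
    (hinj : ∀ k, Set.InjOn (π k) (s k)) :
    ∃ σ : Equiv.Perm ℕ, ∀ k, ∀ j ∈ s k, σ j = π k j := by
  have huniq : ∀ {k l a b : ℕ}, N k ≤ a → a < N (k + 1) → N l ≤ b → b < N (l + 1) → a = b →
      k = l := by
    rintro k l a b h1 h2 h3 h4 rfl
    have h5 := hN.lt_iff_lt.1 (h1.trans_lt h4)
    have h6 := hN.lt_iff_lt.1 (h3.trans_lt h2)
    lia
  let S : Set ℕ := {j | ∃ k, j ∈ s k}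
  choose κ hκ using fun j : S => j.2
  have hf : Function.Injective fun j : S => π (κ j) j := by
    intro i j hij
    have h1 := hπ _ _ (hκ i)
    have h2 := hπ _ _ (hκ j)
    have h3 : κ i = κ j := huniq h1.1 (by lia) h2.1 (by lia) hij
    have hi := hκ i
    rw [h3] at hi
    simp only [h3] at hij
    exact Subtype.ext (hinj _ hi (hκ j) hij)
  -- The spare last points make the complements of both the domain and the range infinite, hence
  -- equinumerous, which is what extending to a bijection requires.
  have hlast : ∀ k, N (k + 1) - 1 ∉ S ∧ N (k + 1) - 1 ∉ Set.range fun j : S => π (κ j) j := by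
    intro k
    have hk := hN (Nat.lt_succ_self k)
    constructor
    · rintro ⟨l, hl⟩
      have h1 := hs l _ hl
      have h2 : k = l := huniq (k := k) (a := N (k + 1) - 1) (b := N (k + 1) - 1)
        (by lia) (by lia) h1.1 (by lia) rfl
      subst h2; lia
    · rintro ⟨j, hj⟩
      have h1 := hπ _ _ (hκ j)
      simp only at hj
      have h2 : k = κ j := huniq (k := k) (a := N (k + 1) - 1) (b := π (κ j) j)
        (by lia) (by lia) h1.1 (by lia) hj.symm
      rw [← h2] at h1 hj; lia
  have hinjlast : Function.Injective fun k => N (k + 1) - 1 := by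
    intro k l hkl
    have h1 := hN (Nat.lt_succ_self k)
    have h2 := hN (Nat.lt_succ_self l)
    have h3 : N (k + 1) = N (l + 1) := by simp only at hkl; lia
    have := hN.injective h3
    lia
  have hA : Infinite ↥(Sᶜ) :=
    (Set.infinite_of_injective_forall_mem hinjlast fun k => (hlast k).1).to_subtype
  have hB : Infinite ↥((Set.range (⟨_, hf⟩ : S ↪ ℕ))ᶜ) :=
    (Set.infinite_of_injective_forall_mem hinjlast fun k => (hlast k).2).to_subtype
  obtain ⟨σ, hσ⟩ := Cardinal.extend_function (⟨_, hf⟩ : S ↪ ℕ) nonempty_equiv_of_countable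
  refine ⟨σ, fun k j hj => ?_⟩
  have h1 := hσ ⟨j, k, hj⟩
  have h2 := hs _ _ (hκ ⟨j, k, hj⟩)
  have h3 := hs _ _ hj
  have h4 : κ ⟨j, k, hj⟩ = k := huniq h2.1 (by lia) h3.1 (by lia) rfl
  rw [h1]
  simp only [Function.Embedding.coeFn_mk, h4]

/-- Rescaling a finite linear combination to have norm one. -/
theorem IsHomogeneousNorm.exists_norm_smul_eq_one (h : IsHomogeneousNorm 𝕜 E r) {y : E}
    (hy : y ≠ 0) : ∃ c : 𝕜, ‖c‖ ^ r = ‖y‖⁻¹ := by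
  have hy' : 0 < ‖y‖ := norm_pos_iff.2 hy
  refine ⟨((‖y‖⁻¹ ^ (1 / r) : ℝ) : 𝕜), ?_⟩
  rw [RCLike.norm_ofReal, abs_of_nonneg (by positivity), ← Real.rpow_mul (by positivity),
    one_div_mul_cancel h.pos.ne', Real.rpow_one]

/-- Gliding hump: when convergence along `x` is invariant under permutations, relabelling far out
cannot increase the norms of finite linear combinations by arbitrarily large factors. -/
theorem IsHomogeneousNorm.not_forall_exists_relabel [CompleteSpace E]
    (h : IsHomogeneousNorm 𝕜 E r) {x : ℕ → E} {K : ℝ} (hK : 0 < K)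
    (hx : ∀ (a : ℕ → 𝕜) (m n : ℕ), m ≤ n →
      ‖∑ j ∈ Finset.range m, a j • x j‖ ≤ K * ‖∑ j ∈ Finset.range n, a j • x j‖)
    (hsym : ∀ π : Equiv.Perm ℕ, BasicSeqEquiv 𝕜 (fun j => x (π j)) x) :
    ¬ ∀ (R : ℝ) (n : ℕ), ∃ (s : Finset ℕ) (a : ℕ → 𝕜) (π : ℕ → ℕ), (∀ j ∈ s, n ≤ j ∧ n ≤ π j) ∧
      Set.InjOn π s ∧ R * ‖∑ j ∈ s, a j • x j‖ ≤ ‖∑ j ∈ s, a j • x (π j)‖ ∧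
      ∑ j ∈ s, a j • x (π j) ≠ 0 := by
  intro H
  -- The factor `2 ^ n` is used, and the combination is rescaled to have norm one after relabelling.
  -- The endpoint `m` exceeds all indices and images by at least two, leaving the last point free.
  have H' : ∀ n : ℕ, ∃ (s : Finset ℕ) (a : ℕ → 𝕜) (π : ℕ → ℕ) (m : ℕ),
      (∀ j ∈ s, n ≤ j ∧ j + 1 < m) ∧ (∀ j ∈ s, n ≤ π j ∧ π j + 1 < m) ∧ n < m ∧
      Set.InjOn π s ∧ ‖∑ j ∈ s, a j • x j‖ ≤ (1 / 2) ^ n ∧ ‖∑ j ∈ s, a j • x (π j)‖ = 1 := by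
    intro n
    obtain ⟨s, a, π, h1, h2, h3, h4⟩ := H (2 ^ n) n
    obtain ⟨c, hc⟩ := h.exists_norm_smul_eq_one (𝕜 := 𝕜) h4
    have h4' : 0 < ‖∑ j ∈ s, a j • x (π j)‖ := norm_pos_iff.2 h4
    refine ⟨s, fun j => c * a j, π, n + s.sup id + s.sup π + 2, fun j hj => ⟨(h1 j hj).1, ?_⟩,
      fun j hj => ⟨(h1 j hj).2, ?_⟩, by lia, h2, ?_, ?_⟩
    · have := Finset.le_sup (f := id) hj
      simp only [id] at this; lia
    · have := Finset.le_sup (f := π) hj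
      lia
    · simp_rw [mul_smul, ← Finset.smul_sum]
      rw [h.norm_smul, hc, inv_mul_le_iff₀ h4', one_div, inv_pow]
      rw [← le_div_iff₀' (by positivity)] at h3
      rwa [← div_eq_mul_inv]
    · simp_rw [mul_smul, ← Finset.smul_sum]
      rw [h.norm_smul, hc, inv_mul_cancel₀ h4'.ne']
  choose s a π g hs hπ hg hinj hle heq using H'
  let N : ℕ → ℕ := fun k => g^[k] 0
  have hNs : ∀ k, N (k + 1) = g (N k) := fun k => Function.iterate_succ_apply' g k 0
  have hN : StrictMono N := strictMono_nat_of_lt_succ fun k => by rw [hNs]; exact hg _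
  obtain ⟨σ, hσ⟩ := exists_perm_extending hN (fun k => s (N k)) (fun k => π (N k))
    (fun k j hj => by rw [hNs]; exact hs _ j hj) (fun k j hj => by rw [hNs]; exact hπ _ j hj)
    (fun k => hinj _)
  -- The `k`-th hump extended by zero. The superposition `b` converges along `x` because the humps
  -- have geometrically small norms there.
  let A : ℕ → ℕ → 𝕜 := fun k j => if j ∈ s (N k) then a (N k) j else 0
  have hA0 : ∀ k l j, N l ≤ j → j < N (l + 1) → k ≠ l → A k j = 0 := by
    intro k l j h1 h2 hkl
    refine if_neg fun hj => hkl ?_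
    have h3 := hs _ _ hj
    rw [← hNs] at h3
    have h5 := hN.lt_iff_lt.1 (h1.trans_lt (by lia : j < N (k + 1)))
    have h6 := hN.lt_iff_lt.1 (h3.1.trans_lt h2)
    lia
  have hAsum : ∀ j, Summable fun k => A k j := fun j =>
    summable_of_ne_finset_zero (s := Finset.range (j + 1)) fun k hk => if_neg fun hj => by
      have h1 := (hs _ _ hj).1
      have h2 := hN.le_apply (x := k)
      simp at hk; lia
  let b : ℕ → 𝕜 := fun j => ∑' k, A k j
  have hb : ∀ k j, N k ≤ j → j < N (k + 1) → b j = A k j := fun k j h1 h2 =>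
    tsum_eq_single k fun l hl => hA0 l k j h1 h2 hl
  have hAs : ∀ (k : ℕ) (F : ℕ → E) (m n : ℕ), m ≤ N k → N (k + 1) ≤ n →
      ∑ j ∈ Finset.Ico m n, A k j • F j = ∑ j ∈ s (N k), a (N k) j • F j := by
    intro k F m n hm hn
    rw [← Finset.sum_subset (s₁ := s (N k))]
    · exact Finset.sum_congr rfl fun j hj => by simp only [A, if_pos hj]
    · intro j hj
      have := hs _ _ hj
      rw [← hNs] at this
      rw [Finset.mem_Ico]; lia
    · intro j _ hj
      simp only [A, if_neg hj, zero_smul]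
  have hAr : ∀ (k n : ℕ), N (k + 1) ≤ n →
      ∑ j ∈ Finset.range n, A k j • x j = ∑ j ∈ s (N k), a (N k) j • x j := fun k n hn => by
    rw [Finset.range_eq_Ico]; exact hAs k x 0 n (Nat.zero_le _) hn
  have hconv : SeriesConverges b x := by
    refine ⟨_, seriesTendsto_iff.2 (h.tendsto_superposition (A := A)
      (β := fun k => K * (1 / 2) ^ k)
      ((summable_geometric_of_lt_one (by norm_num) (by norm_num)).mul_left K)
      (fun k n => ?_) (fun k => tendsto_atTop_of_eventually_const (hAr k))
      fun j => (hAsum j).hasSum).1⟩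
    refine (hx (A k) n (max n (N (k + 1))) (le_max_left _ _)).trans ?_
    rw [hAr k _ (le_max_right _ _)]
    refine mul_le_mul_of_nonneg_left ((hle _).trans ?_) hK.le
    exact pow_le_pow_of_le_one (by norm_num) (by norm_num) hN.le_apply
  obtain ⟨t, ht⟩ := (hsym σ b).2 hconv
  have ht' := seriesTendsto_iff.1 ht
  -- Along the permuted sequence each hump is a difference of two partial sums and has norm one,
  -- which convergence forbids.
  have h1 : Tendsto (fun k => ∑ j ∈ Finset.range (N (k + 1)), b j • x (σ j) -
      ∑ j ∈ Finset.range (N k), b j • x (σ j)) atTop (𝓝 (t - t)) :=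
    (ht'.comp (hN.tendsto_atTop.comp (tendsto_add_atTop_nat 1))).sub (ht'.comp hN.tendsto_atTop)
  have h2 : ∀ k, ∑ j ∈ Finset.range (N (k + 1)), b j • x (σ j) -
      ∑ j ∈ Finset.range (N k), b j • x (σ j) =
        ∑ j ∈ s (N k), a (N k) j • x (π (N k) j) := by
    intro k
    rw [← Finset.sum_Ico_eq_sub _ (hN (Nat.lt_succ_self k)).le]
    rw [Finset.sum_congr rfl fun j hj => by
      rw [hb k j (Finset.mem_Ico.1 hj).1 (Finset.mem_Ico.1 hj).2],
      hAs k _ _ _ le_rfl le_rfl]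
    exact Finset.sum_congr rfl fun j hj => by rw [hσ k j hj]
  have h3 := h1.norm
  simp_rw [h2, heq, sub_self, norm_zero] at h3
  exact one_ne_zero (tendsto_nhds_unique tendsto_const_nhds h3)

theorem norm_sum_le_card_mul {s : Finset ℕ} {f : ℕ → E} {c : ℝ} (hf : ∀ j ∈ s, ‖f j‖ ≤ c) :
    ‖∑ j ∈ s, f j‖ ≤ s.card * c :=
  (norm_sum_le_of_le _ hf).trans (by rw [Finset.sum_const, nsmul_eq_mul])

/-- The gliding hump applied to singletons compares the norms beyond some index; the finitely many
remaining vectors are nonzero and only affect the constant. -/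
theorem IsHomogeneousNorm.exists_norm_le_mul [CompleteSpace E]
    (h : IsHomogeneousNorm 𝕜 E r) {x : ℕ → E} (hx : IsSymmetricBasicSeq 𝕜 x) :
    ∃ Q > 0, ∀ i j, ‖x i‖ ≤ Q * ‖x j‖ := by
  obtain ⟨K, hK, hxK⟩ := h.exists_basis_constant hx.1
  have hpos : ∀ j, 0 < ‖x j‖ := fun j => norm_pos_iff.2 (hx.1.ne_zero j)
  have H := h.not_forall_exists_relabel hK hxK hx.2
  push Not at H
  obtain ⟨R, n, H⟩ := H
  have H1 : ∀ i j, n ≤ i → n ≤ j → ‖x i‖ ≤ R * ‖x j‖ := by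
    intro i j hi hj
    by_contra! hc
    refine hx.1.ne_zero i ?_
    simpa using H {j} 1 (fun _ => i) (by simp [hi, hj]) (by simp) (by simpa using hc.le)
  have H2 : ∃ B, ∀ i, ‖x i‖ ≤ B := by
    refine ⟨∑ i ∈ Finset.range n, ‖x i‖ + R * ‖x n‖, fun i => ?_⟩
    have h0 : 0 ≤ R * ‖x n‖ := (norm_nonneg _).trans (H1 n n le_rfl le_rfl)
    rcases lt_or_ge i n with hi | hi
    · have := Finset.single_le_sum (f := fun i => ‖x i‖) (fun i _ => norm_nonneg _)
        (Finset.mem_range.2 hi)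
      linarith
    · have := H1 i n hi le_rfl
      have h4 : 0 ≤ ∑ i ∈ Finset.range n, ‖x i‖ := Finset.sum_nonneg fun i _ => norm_nonneg _
      linarith
  have H3 : ∃ D > 0, ∀ j, 1 ≤ D * ‖x j‖ := by
    have hR : 0 < R * ‖x n‖ := (hpos n).trans_le (H1 n n le_rfl le_rfl)
    have hR' : 0 < R := pos_of_mul_pos_left hR (hpos n).le
    have h4 : 0 ≤ ∑ i ∈ Finset.range n, ‖x i‖⁻¹ :=
      Finset.sum_nonneg fun i _ => inv_nonneg.2 (norm_nonneg _)
    refine ⟨∑ i ∈ Finset.range n, ‖x i‖⁻¹ + R * ‖x n‖⁻¹,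
      add_pos_of_nonneg_of_pos h4 (mul_pos hR' (inv_pos.2 (hpos n))), fun j => ?_⟩
    rw [add_mul]
    rcases lt_or_ge j n with hj | hj
    · have h5 := Finset.single_le_sum (f := fun i => ‖x i‖⁻¹)
        (fun i _ => inv_nonneg.2 (norm_nonneg _)) (Finset.mem_range.2 hj)
      have h6 := mul_le_mul_of_nonneg_right h5 (hpos j).le
      simp only [inv_mul_cancel₀ (hpos j).ne'] at h6
      have h7 : 0 ≤ R * ‖x n‖⁻¹ * ‖x j‖ := by positivity
      linarith
    · have h5 := H1 n j le_rfl hj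
      have h6 : 1 ≤ R * ‖x n‖⁻¹ * ‖x j‖ := by
        rw [mul_right_comm, ← div_eq_mul_inv, le_div_iff₀ (hpos n)]; linarith
      have h7 := mul_nonneg h4 (hpos j).le
      linarith
  obtain ⟨B, hB⟩ := H2
  obtain ⟨D, hD, hD'⟩ := H3
  have hB0 : 0 < B := (hpos 0).trans_le (hB 0)
  refine ⟨B * D, by positivity, fun i j => (hB i).trans ?_⟩
  have := hD' j
  rw [mul_assoc]
  exact le_mul_of_one_le_right hB0.le this

/-- The gliding hump concerns only indices and images beyond a given `n`. By injectivity at most `2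
* n` indices violate this, and each of their terms is controlled by the norm of the whole sum, so
deleting them preserves a large ratio. -/
theorem IsHomogeneousNorm.exists_relabel_constant [CompleteSpace E]
    (h : IsHomogeneousNorm 𝕜 E r) {x : ℕ → E} (hx : IsSymmetricBasicSeq 𝕜 x) :
    ∃ C > 0, ∀ (s : Finset ℕ) (a : ℕ → 𝕜) (π : ℕ → ℕ), Set.InjOn π s →
      ‖∑ j ∈ s, a j • x (π j)‖ ≤ C * ‖∑ j ∈ s, a j • x j‖ := by
  obtain ⟨K, hK, hxK⟩ := h.exists_basis_constant hx.1
  obtain ⟨Q, hQ, hxQ⟩ := h.exists_norm_le_mul hx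
  have hpos : ∀ j, 0 < ‖x j‖ := fun j => norm_pos_iff.2 (hx.1.ne_zero j)
  by_contra! hcon
  refine h.not_forall_exists_relabel hK hxK hx.2 fun R n => ?_
  -- The first summand pays for `|R|` times the truncated sum, the second for the deleted relabelled
  -- terms, and the final `1` keeps what remains nonzero.
  obtain ⟨s, a, π, hπ, hC⟩ := hcon (|R| * (1 + 2 * n * (2 * K)) + 2 * n * (2 * K * Q) + 1)
    (by positivity)
  set Λ := ‖∑ j ∈ s, a j • x j‖ with hΛ
  have hcoef : ∀ j ∈ s, ‖a j • x j‖ ≤ 2 * K * Λ := by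
    let b : ℕ → 𝕜 := fun j => if j ∈ s then a j else 0
    have hb : ∀ n, s.sup id + 1 ≤ n → ∑ j ∈ Finset.range n, b j • x j = ∑ j ∈ s, a j • x j := by
      intro n hn
      rw [← Finset.sum_subset (s₁ := s)]
      · exact Finset.sum_congr rfl fun j hj => by simp only [b, if_pos hj]
      · intro j hj
        have := Finset.le_sup (f := id) hj
        simp only [id] at this
        rw [Finset.mem_range]; lia
      · intro j _ hj
        simp only [b, if_neg hj, zero_smul]
    have hb' : ∀ m, ‖∑ j ∈ Finset.range m, b j • x j‖ ≤ K * Λ := fun m => by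
      rw [hΛ, ← hb (max m (s.sup id + 1)) (le_max_right _ _)]
      exact hxK b _ _ (le_max_left _ _)
    intro j hj
    have h1 : a j • x j = ∑ i ∈ Finset.range (j + 1), b i • x i -
        ∑ i ∈ Finset.range j, b i • x i := by
      rw [Finset.sum_range_succ, add_sub_cancel_left]; simp only [b, if_pos hj]
    rw [h1]
    linarith [norm_sub_le (∑ i ∈ Finset.range (j + 1), b i • x i)
        (∑ i ∈ Finset.range j, b i • x i), hb' (j + 1), hb' j]
  have hcoef' : ∀ j ∈ s, ‖a j • x (π j)‖ ≤ 2 * K * Q * Λ := by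
    intro j hj
    have h1 := hcoef j hj
    rw [h.norm_smul] at h1 ⊢
    calc ‖a j‖ ^ r * ‖x (π j)‖ ≤ ‖a j‖ ^ r * (Q * ‖x j‖) := by gcongr; exact hxQ _ _
      _ = Q * (‖a j‖ ^ r * ‖x j‖) := by ring
      _ ≤ Q * (2 * K * Λ) := by gcongr
      _ = _ := by ring
  have hΛ0 : 0 ≤ Λ := norm_nonneg _
  have hΛpos : 0 < Λ := by
    refine hΛ0.lt_of_ne' fun h0 => ?_
    have h1 := norm_sum_le_card_mul hcoef'
    rw [h0] at h1 hC
    simp only [mul_zero] at h1 hC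
    linarith
  let f : Finset ℕ := s.filter fun j => j < n ∨ π j < n
  have hf : f.card ≤ 2 * n := by
    have h1 : f ⊆ s.filter (fun j => j < n) ∪ s.filter (fun j => π j < n) := by
      intro j hj
      simp only [f, Finset.mem_filter, Finset.mem_union] at hj ⊢; tauto
    have h2 : (s.filter (fun j => j < n)).card ≤ n := by
      have := Finset.card_le_card (s := s.filter (fun j => j < n)) (t := Finset.range n)
        (fun j hj => Finset.mem_range.2 (Finset.mem_filter.1 hj).2)
      simpa using this
    have h3 : (s.filter (fun j => π j < n)).card ≤ n := by
      have := Finset.card_le_card_of_injOn (s := s.filter (fun j => π j < n))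
        (t := Finset.range n) π (fun j hj => by simpa using (Finset.mem_filter.1 hj).2)
        (hπ.mono fun j hj => (Finset.mem_filter.1 hj).1)
      simpa using this
    have := (Finset.card_le_card h1).trans (Finset.card_union_le _ _)
    lia
  have hfs : f ⊆ s := Finset.filter_subset _ _
  have hfc : (f.card : ℝ) ≤ 2 * n := by exact_mod_cast hf
  have e1 := norm_sum_le_card_mul fun j hj => hcoef j (hfs hj)
  have e2 := norm_sum_le_card_mul fun j hj => hcoef' j (hfs hj)
  have e3 : (f.card : ℝ) * (2 * K * Λ) ≤ 2 * n * (2 * K * Λ) := by gcongr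
  have e4 : (f.card : ℝ) * (2 * K * Q * Λ) ≤ 2 * n * (2 * K * Q * Λ) := by gcongr
  have s1 := Finset.sum_sdiff (f := fun j => a j • x j) hfs
  have s2 := Finset.sum_sdiff (f := fun j => a j • x (π j)) hfs
  have n1 : ‖∑ j ∈ s \ f, a j • x j‖ ≤ (1 + 2 * n * (2 * K)) * Λ := by
    rw [eq_sub_of_add_eq s1]
    refine (norm_sub_le _ _).trans ?_
    linarith
  have n2 : |R| * ((1 + 2 * n * (2 * K)) * Λ) + Λ ≤ ‖∑ j ∈ s \ f, a j • x (π j)‖ := by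
    rw [eq_sub_of_add_eq s2]
    refine le_trans ?_ (norm_sub_norm_le _ _)
    linarith
  refine ⟨s \ f, a, π, fun j hj => ?_, hπ.mono (by simp), ?_, ?_⟩
  · simp only [f, Finset.mem_sdiff, Finset.mem_filter, not_and, not_or, not_lt] at hj
    exact hj.2 hj.1
  · calc R * ‖∑ j ∈ s \ f, a j • x j‖ ≤ |R| * ‖∑ j ∈ s \ f, a j • x j‖ := by
          gcongr; exact le_abs_self R
      _ ≤ |R| * ((1 + 2 * n * (2 * K)) * Λ) := by gcongr
      _ ≤ _ := by linarith
  · rw [← norm_pos_iff]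
    refine lt_of_lt_of_le ?_ n2
    positivity

/-- The quantitative form of symmetry. -/
theorem IsHomogeneousNorm.exists_isUniformlySymmetric [CompleteSpace E]
    (h : IsHomogeneousNorm 𝕜 E r) {x : ℕ → E} (hx : IsSymmetricBasicSeq 𝕜 x) :
    ∃ C, IsUniformlySymmetric 𝕜 x C := by
  obtain ⟨K, hK, hxK⟩ := h.exists_basis_constant hx.1
  obtain ⟨C, hC, hxC⟩ := h.exists_relabel_constant hx
  have hrel : ∀ (s : Finset ℕ) (a : ℕ → 𝕜) (σ τ : ℕ → ℕ), Set.InjOn σ s → Set.InjOn τ s →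
      ‖∑ j ∈ s, a j • x (σ j)‖ ≤ C * ‖∑ j ∈ s, a j • x (τ j)‖ := by
    intro s a σ τ hσ hτ
    -- Reindexing by the inverse of `τ` reduces to the case in which `τ` is the identity.
    let ι := Function.invFunOn τ s
    have hι : ∀ j ∈ s, ι (τ j) = j := fun j hj => hτ.leftInvOn_invFunOn hj
    have h1 := hxC (s.image τ) (fun i => a (ι i)) (fun i => σ (ι i)) (by
      intro i hi j hj hij
      obtain ⟨i, hi', rfl⟩ := Finset.mem_image.1 (Finset.mem_coe.1 hi)
      obtain ⟨j, hj', rfl⟩ := Finset.mem_image.1 (Finset.mem_coe.1 hj)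
      simp only [hι i hi', hι j hj'] at hij
      rw [hσ hi' hj' hij])
    rw [Finset.sum_image hτ, Finset.sum_image hτ] at h1
    rwa [Finset.sum_congr rfl fun j hj => by rw [hι j hj],
      Finset.sum_congr (s₁ := s) (f := fun j => a (ι (τ j)) • x (τ j)) rfl
        fun j hj => by rw [hι j hj]] at h1
  refine ⟨max C (C * (K * C)), by positivity, hx.1.ne_zero, fun s a σ τ hσ hτ =>
    (hrel s a σ τ hσ hτ).trans (by gcongr; exact le_max_left _ _), fun s t a hst => ?_⟩
  -- list the indices in `s` before those in `t \ s`
  let π : ℕ → ℕ := fun j => if j ∈ s then (s.filter (· < j)).card else s.card + j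
  have hlt : ∀ j ∈ s, (s.filter (· < j)).card < s.card := fun j hj =>
    Finset.card_lt_card (Finset.filter_ssubset.2 ⟨j, hj, lt_irrefl j⟩)
  have hmono : ∀ i ∈ s, ∀ j ∈ s, i < j → (s.filter (· < i)).card < (s.filter (· < j)).card := by
    intro i hi j hj hij
    refine Finset.card_lt_card (Finset.ssubset_iff_subset_ne.2 ⟨fun k hk => ?_, fun he => ?_⟩)
    · rw [Finset.mem_filter] at hk ⊢
      exact ⟨hk.1, hk.2.trans hij⟩
    · have : i ∈ s.filter (· < i) := by rw [he]; simp [hi, hij]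
      simp at this
  have hπ : Function.Injective π := by
    intro i j hij
    simp only [π] at hij
    split_ifs at hij with hi hj hj
    · rcases lt_trichotomy i j with h1 | h1 | h1
      · exact absurd hij (hmono i hi j hj h1).ne
      · exact h1
      · exact absurd hij (hmono j hj i hi h1).ne'
    · have := hlt i hi; lia
    · have := hlt j hj; lia
    · lia
  let ι := Function.invFun π
  have hι : ∀ j, ι (π j) = j := Function.leftInverse_invFun hπ
  let b : ℕ → 𝕜 := fun i => if i ∈ t.image π then a (ι i) else 0
  have hb : ∀ (u : Finset ℕ) (m : ℕ), u ⊆ t → (∀ j ∈ t, π j < m ↔ j ∈ u) →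
      ∑ i ∈ Finset.range m, b i • x i = ∑ j ∈ u, a j • x (π j) := by
    intro u m hut hu
    rw [← Finset.sum_subset (s₁ := u.image π), Finset.sum_image hπ.injOn]
    · refine Finset.sum_congr rfl fun j hj => ?_
      simp only [b, if_pos (Finset.mem_image_of_mem π (hut hj)), hι]
    · intro i hi
      obtain ⟨j, hj, rfl⟩ := Finset.mem_image.1 hi
      exact Finset.mem_range.2 ((hu j (hut hj)).2 hj)
    · intro i hi hi'
      have : b i = 0 := if_neg fun hit => by
        obtain ⟨j, hj, rfl⟩ := Finset.mem_image.1 hit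
        exact hi' (Finset.mem_image_of_mem π ((hu j hj).1 (Finset.mem_range.1 hi)))
      rw [this, zero_smul]
  -- After relabelling by `π`, the sum over `s` is a partial sum of the sum over `t`, so the basis
  -- constant compares them.
  have h1 := hxK b s.card (max s.card (t.sup π + 1)) (le_max_left _ _)
  rw [hb s _ hst fun j hj => ?_, hb t _ subset_rfl fun j hj => ?_] at h1
  · have h2 := hrel s a id π Function.injective_id.injOn hπ.injOn
    have h3 := hrel t a π id hπ.injOn Function.injective_id.injOn
    simp only [id] at h2 h3
    calc _ ≤ C * ‖∑ j ∈ s, a j • x (π j)‖ := h2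
      _ ≤ C * (K * ‖∑ j ∈ t, a j • x (π j)‖) := by gcongr
      _ ≤ C * (K * (C * ‖∑ j ∈ t, a j • x j‖)) := by gcongr
      _ = C * (K * C) * ‖∑ j ∈ t, a j • x j‖ := by ring
      _ ≤ _ := by gcongr; exact le_max_right _ _
  · simp only [hj, iff_true]
    exact lt_max_of_lt_right (Nat.lt_succ_of_le (Finset.le_sup (f := π) hj))
  · constructor
    · intro h4
      by_contra hjs
      simp only [π, if_neg hjs] at h4; lia
    · intro hjs
      simp only [π, if_pos hjs]
      exact hlt j hjs

end Symmetric

/-! ### Finite Garling sums -/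

section GarlingSum

variable {𝕜 : Type*} [RCLike 𝕜]

/-- The weighted sum of `‖x i‖ ^ p` over `i ∈ A`, the `j`-th element of `A` having weight `w j`. -/
noncomputable def garlingSum (w : ℕ → ℝ) (p : ℝ) (A : Finset ℕ) (x : ℕ → 𝕜) : ℝ :=
  ∑ i ∈ A, ‖x i‖ ^ p * w (A.filter (· < i)).card

/-- The weight `w` with its first `M` terms removed. -/
def shiftWeight (w : ℕ → ℝ) (M : ℕ) : ℕ → ℝ := fun j => w (j + M)

variable {w : ℕ → ℝ} {p : ℝ}

theorem shiftWeight_zero (w : ℕ → ℝ) : shiftWeight w 0 = w := rfl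

theorem shiftWeight_shiftWeight (w : ℕ → ℝ) (M M' : ℕ) :
    shiftWeight (shiftWeight w M) M' = shiftWeight w (M' + M) := by
  funext j; simp only [shiftWeight]; congr 1; ring

theorem shiftWeight_antitone (hw : Antitone w) (M : ℕ) : Antitone (shiftWeight w M) :=
  fun _ _ h => hw (Nat.add_le_add_right h M)

theorem shiftWeight_nonneg (hw : ∀ j, 0 ≤ w j) (M j : ℕ) : 0 ≤ shiftWeight w M j := hw _

theorem shiftWeight_le_shiftWeight (hw : Antitone w) {M M' : ℕ} (h : M ≤ M') (j : ℕ) :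
    shiftWeight w M' j ≤ shiftWeight w M j :=
  hw (Nat.add_le_add_left h j)

@[simp]
theorem garlingSum_empty (w : ℕ → ℝ) (p : ℝ) (x : ℕ → 𝕜) : garlingSum w p ∅ x = 0 := by
  simp [garlingSum]

theorem garlingSum_nonneg (hw : ∀ j, 0 ≤ w j) (A : Finset ℕ) (x : ℕ → 𝕜) :
    0 ≤ garlingSum w p A x :=
  Finset.sum_nonneg fun _ _ => mul_nonneg (by positivity) (hw _)

theorem garlingSum_congr {A : Finset ℕ} {x y : ℕ → 𝕜} (h : ∀ i ∈ A, x i = y i) :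
    garlingSum w p A x = garlingSum w p A y :=
  Finset.sum_congr rfl fun i hi => by rw [h i hi]

theorem garlingSum_mono (hp : 0 < p) (hw : ∀ j, 0 ≤ w j) {A : Finset ℕ} {x y : ℕ → 𝕜}
    (h : ∀ i ∈ A, ‖x i‖ ≤ ‖y i‖) : garlingSum w p A x ≤ garlingSum w p A y :=
  Finset.sum_le_sum fun i hi => mul_le_mul_of_nonneg_right
    (Real.rpow_le_rpow (norm_nonneg _) (h i hi) hp.le) (hw _)

theorem garlingSum_le_of_weight_le {w' : ℕ → ℝ} (h : ∀ j, w j ≤ w' j) (A : Finset ℕ)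
    (x : ℕ → 𝕜) : garlingSum w p A x ≤ garlingSum w' p A x :=
  Finset.sum_le_sum fun _ _ => mul_le_mul_of_nonneg_left (h _) (by positivity)

/-- Every element of `B` is preceded by all of `A`, so its position moves by the number of elements
of `A`. -/
theorem garlingSum_union {A B : Finset ℕ} (hAB : ∀ a ∈ A, ∀ b ∈ B, a < b) (x : ℕ → 𝕜) :
    garlingSum w p (A ∪ B) x = garlingSum w p A x + garlingSum (shiftWeight w A.card) p B x := by
  have hd : Disjoint A B := Finset.disjoint_left.2 fun a ha hb => lt_irrefl a (hAB a ha a hb)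
  rw [garlingSum, Finset.sum_union hd]
  congr 1
  · refine Finset.sum_congr rfl fun i hi => ?_
    rw [Finset.filter_union, Finset.filter_false_of_mem (s := B), Finset.union_empty]
    exact fun b hb => (hAB i hi b hb).not_gt
  · refine Finset.sum_congr rfl fun i hi => ?_
    rw [Finset.filter_union, Finset.filter_true_of_mem (s := A) fun a ha => hAB a ha i hi,
      Finset.card_union_of_disjoint (hd.mono_right (Finset.filter_subset _ _)), shiftWeight,
      add_comm]

/-- Discarding indices with zero coordinates moves the others to earlier positions, where the
weights are larger. -/
theorem garlingSum_le_of_subset (hp : 0 < p) (hw : Antitone w) {A B : Finset ℕ} (hBA : B ⊆ A)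
    {x : ℕ → 𝕜} (hx : ∀ i ∈ A, i ∉ B → x i = 0) : garlingSum w p A x ≤ garlingSum w p B x := by
  rw [garlingSum, ← Finset.sum_subset hBA fun i hi hi' => by
    rw [hx i hi hi', norm_zero, Real.zero_rpow hp.ne', zero_mul]]
  refine Finset.sum_le_sum fun i _ => mul_le_mul_of_nonneg_left (hw ?_) (by positivity)
  exact Finset.card_le_card (Finset.filter_subset_filter _ hBA)

theorem garlingSum_add_of_disjoint (hp : 0 < p) (A : Finset ℕ) {x y : ℕ → 𝕜}
    (h : ∀ i, x i = 0 ∨ y i = 0) :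
    garlingSum w p A (x + y) = garlingSum w p A x + garlingSum w p A y := by
  rw [garlingSum, garlingSum, garlingSum, ← Finset.sum_add_distrib]
  refine Finset.sum_congr rfl fun i _ => ?_
  rcases h i with h | h <;> simp [h, Real.zero_rpow hp.ne']

theorem garlingSum_smul (A : Finset ℕ) (c : 𝕜) (x : ℕ → 𝕜) :
    garlingSum w p A (c • x) = ‖c‖ ^ p * garlingSum w p A x := by
  rw [garlingSum, garlingSum, Finset.mul_sum]
  refine Finset.sum_congr rfl fun i _ => ?_
  rw [Pi.smul_apply, smul_eq_mul, norm_mul, Real.mul_rpow (norm_nonneg _) (norm_nonneg _),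
    mul_assoc]

@[simp]
theorem garlingSum_singleton (i : ℕ) (x : ℕ → 𝕜) :
    garlingSum w p {i} x = ‖x i‖ ^ p * w 0 := by
  simp [garlingSum, Finset.filter_singleton]

theorem garlingSum_le_card_mul (hw : ∀ j, w j ≤ 1) {A : Finset ℕ} {x : ℕ → 𝕜} {S : ℝ}
    (hS : ∀ i, ‖x i‖ ^ p ≤ S) : garlingSum w p A x ≤ A.card * S := by
  rw [garlingSum, ← nsmul_eq_mul]
  refine Finset.sum_le_card_nsmul _ _ _ fun i _ => ?_
  exact (mul_le_of_le_one_right (by positivity) (hw _)).trans (hS i)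

/-- Dropping the first `M` indices of `A` costs at most `M` times the largest term. -/
theorem exists_garlingSum_le_shiftWeight (hw : ∀ j, w j ≤ 1) {x : ℕ → 𝕜} {S : ℝ}
    (hS : ∀ i, ‖x i‖ ^ p ≤ S) (A : Finset ℕ) (M : ℕ) :
    ∃ B ⊆ A, garlingSum w p A x ≤ M * S + garlingSum (shiftWeight w M) p B x := by
  have hS0 : 0 ≤ S := le_trans (by positivity) (hS 0)
  induction M with
  | zero => exact ⟨A, subset_rfl, by simp [shiftWeight_zero]⟩
  | succ M ih =>
    obtain ⟨B, hB, h⟩ := ih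
    rcases B.eq_empty_or_nonempty with rfl | hne
    · refine ⟨∅, by simp, h.trans ?_⟩
      push_cast
      simp only [garlingSum_empty]; linarith
    · refine ⟨B.erase (B.min' hne), (Finset.erase_subset _ _).trans hB, h.trans ?_⟩
      have h1 : B = {B.min' hne} ∪ B.erase (B.min' hne) := by
        rw [← Finset.insert_eq, Finset.insert_erase (B.min'_mem hne)]
      have h2 := garlingSum_union (w := shiftWeight w M) (p := p) (A := {B.min' hne})
        (B := B.erase (B.min' hne)) (fun a ha b hb => by
          rw [Finset.mem_singleton.1 ha]; exact B.min'_lt_of_mem_erase_min' hne hb) x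
      rw [← h1, garlingSum_singleton, Finset.card_singleton, shiftWeight_shiftWeight,
        add_comm 1 M] at h2
      rw [h2]
      have h3 : ‖x (B.min' hne)‖ ^ p * shiftWeight w M 0 ≤ S :=
        (mul_le_of_le_one_right (by positivity) (hw _)).trans (hS _)
      push_cast
      linarith

/-- For `p ≤ 1` this is the subadditivity of `t ^ p`; for `p ≥ 1` it is Minkowski's inequality with
the weights absorbed as `w ^ (1 / p)`. The exponent `1 / max p 1` serves both ranges. -/
theorem garlingSum_add_rpow_le (hp : 0 < p) (hw : ∀ j, 0 ≤ w j) (A : Finset ℕ) (x y : ℕ → 𝕜) :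
    garlingSum w p A (x + y) ^ (1 / max p 1) ≤
      garlingSum w p A x ^ (1 / max p 1) + garlingSum w p A y ^ (1 / max p 1) := by
  rcases le_total p 1 with h | h
  · rw [max_eq_right h]
    simp only [div_one, Real.rpow_one]
    rw [garlingSum, garlingSum, garlingSum, ← Finset.sum_add_distrib]
    refine Finset.sum_le_sum fun i _ => ?_
    rw [← add_mul]
    refine mul_le_mul_of_nonneg_right ?_ (hw _)
    exact (Real.rpow_le_rpow (norm_nonneg _) (norm_add_le _ _) hp.le).trans
      (Real.rpow_add_le_add_rpow (norm_nonneg _) (norm_nonneg _) hp.le h)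
  · rw [max_eq_left h]
    have key : ∀ z : ℕ → 𝕜, garlingSum w p A z =
        ∑ i ∈ A, |‖z i‖ * w (A.filter (· < i)).card ^ (1 / p)| ^ p := fun z => by
      refine Finset.sum_congr rfl fun i _ => ?_
      have h0 := hw (A.filter (· < i)).card
      rw [abs_of_nonneg (by positivity), Real.mul_rpow (by positivity) (by positivity),
        ← Real.rpow_mul h0, one_div_mul_cancel hp.ne', Real.rpow_one]
    rw [key x, key y]
    refine le_trans ?_ (Real.Lp_add_le A _ _ h)
    refine Real.rpow_le_rpow (garlingSum_nonneg hw _ _) ?_ (by positivity)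
    rw [key]
    refine Finset.sum_le_sum fun i _ => ?_
    have h0 : 0 ≤ w (A.filter (· < i)).card ^ (1 / p) := Real.rpow_nonneg (hw _) _
    rw [← add_mul]
    refine Real.rpow_le_rpow (abs_nonneg _) ?_ hp.le
    rw [abs_of_nonneg (by positivity), abs_of_nonneg (by positivity)]
    exact mul_le_mul_of_nonneg_right (norm_add_le _ _) h0

theorem ofReal_norm_rpow_mul (hp : 0 < p) (a : 𝕜) (c : ℝ) :
    ENNReal.ofReal (‖a‖ ^ p * c) = ‖a‖ₑ ^ p * ENNReal.ofReal c := by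
  rw [ENNReal.ofReal_mul (by positivity), ← ENNReal.ofReal_rpow_of_nonneg (norm_nonneg _) hp.le,
    ofReal_norm]

/-- With `garlingENorm_le_of_garlingSum_le` this replaces increasing maps by finite sets: the `p`-th
power of the quasi-norm is the supremum of the sums `garlingSum w p A`. -/
theorem ofReal_garlingSum_le (hp : 0 < p) (hw : ∀ j, 0 ≤ w j) (A : Finset ℕ) (x : ℕ → 𝕜) :
    ENNReal.ofReal (garlingSum w p A x) ≤ garlingENorm w p x ^ p := by
  -- All points beyond `A` are added so that the enumeration is strictly increasing on all of `ℕ`;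
  -- the positions of the elements of `A` do not change.
  let P : ℕ → Prop := fun i => i ∈ A ∨ A.sup id < i
  have hP : (Set.ofPred P).Infinite :=
    (Set.Ioi_infinite (A.sup id)).mono fun i hi => Or.inr hi
  classical
  have hcount : ∀ i ∈ A, Nat.count P i = (A.filter (· < i)).card := by
    intro i hi
    rw [Nat.count_eq_card_filter_range]
    congr 1
    ext j
    simp only [Finset.mem_filter, Finset.mem_range, P]
    have h1 : i ≤ A.sup id := Finset.le_sup (f := id) hi
    constructor
    · rintro ⟨h2, h3 | h3⟩
      · exact ⟨h3, h2⟩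
      · lia
    · rintro ⟨h2, h3⟩
      exact ⟨h3, Or.inl h2⟩
  have hnth : ∀ i ∈ A, Nat.nth P (A.filter (· < i)).card = i := fun i hi => by
    rw [← hcount i hi]; exact Nat.nth_count (Or.inl hi)
  have h1 : ENNReal.ofReal (garlingSum w p A x) ≤
      ∑' j, ‖x (Nat.nth P j)‖ₑ ^ p * ENNReal.ofReal (w j) := by
    refine le_trans (le_of_eq ?_)
      (ENNReal.sum_le_tsum (A.image fun i => (A.filter (· < i)).card))
    rw [Finset.sum_image fun i hi j hj hij => by
        rw [← hnth i hi, ← hnth j hj]; exact congrArg _ hij, garlingSum,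
      ENNReal.ofReal_sum_of_nonneg fun i _ => mul_nonneg (by positivity) (hw _)]
    exact Finset.sum_congr rfl fun i hi => by rw [hnth i hi, ofReal_norm_rpow_mul hp]
  refine h1.trans ?_
  have h2 := le_iSup (fun φ : {φ : ℕ → ℕ // StrictMono φ} =>
    (∑' j, ‖x (φ.1 j)‖ₑ ^ p * ENNReal.ofReal (w j)) ^ (1 / p))
    ⟨Nat.nth P, Nat.nth_strictMono hP⟩
  have h3 := ENNReal.rpow_le_rpow h2 hp.le
  rwa [← ENNReal.rpow_mul, one_div_mul_cancel hp.ne', ENNReal.rpow_one] at h3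

theorem garlingENorm_le_of_garlingSum_le (hp : 0 < p) (hw : ∀ j, 0 ≤ w j) {x : ℕ → 𝕜} {c : ℝ}
    (h : ∀ A, garlingSum w p A x ≤ c) : garlingENorm w p x ≤ ENNReal.ofReal c ^ (1 / p) := by
  refine iSup_le fun φ => ENNReal.rpow_le_rpow ?_ (by positivity)
  rw [ENNReal.tsum_eq_iSup_nat]
  refine iSup_le fun n => ?_
  refine le_trans (le_of_eq ?_)
    (ENNReal.ofReal_le_ofReal (h ((Finset.range n).image φ.1)))
  rw [garlingSum, ENNReal.ofReal_sum_of_nonneg fun i _ => mul_nonneg (by positivity) (hw _),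
    Finset.sum_image φ.2.injective.injOn]
  refine Finset.sum_congr rfl fun j hj => ?_
  rw [ofReal_norm_rpow_mul hp]
  congr 3
  have : ((Finset.range n).image φ.1).filter (· < φ.1 j) = (Finset.range j).image φ.1 := by
    ext i
    simp only [Finset.mem_filter, Finset.mem_image, Finset.mem_range] at hj ⊢
    constructor
    · rintro ⟨⟨k, -, rfl⟩, h2⟩
      exact ⟨k, φ.2.lt_iff_lt.1 h2, rfl⟩
    · rintro ⟨k, h1, rfl⟩
      exact ⟨⟨k, h1.trans hj, rfl⟩, φ.2 h1⟩
  rw [this, Finset.card_image_of_injective _ φ.2.injective, Finset.card_range]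

end GarlingSum

/-! ### The Garling space with a homogeneous group norm -/

/-- The space `g(w, p)`, to be normed by the power `min p 1` of its quasi-norm. -/
def RGarling (𝕜 : Type*) [RCLike 𝕜] {w : ℕ → ℝ} {p : ℝ} (_ : IsGarlingWeight w) (hp : 0 < p) :
    Type _ :=
  GarlingSpace 𝕜 w p hp

namespace RGarling

variable {𝕜 : Type*} [RCLike 𝕜] {w : ℕ → ℝ} {p : ℝ} {hw : IsGarlingWeight w} {hp : 0 < p}

noncomputable instance : AddCommGroup (RGarling 𝕜 hw hp) :=
  inferInstanceAs (AddCommGroup (GarlingSpace 𝕜 w p hp))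

noncomputable instance : Module 𝕜 (RGarling 𝕜 hw hp) :=
  inferInstanceAs (Module 𝕜 (GarlingSpace 𝕜 w p hp))

/-- The coordinates of a vector. -/
noncomputable def coord : RGarling 𝕜 hw hp →ₗ[𝕜] (ℕ → 𝕜) :=
  (garlingSubmodule 𝕜 w p hp).subtype

theorem coord_injective : Function.Injective (coord : RGarling 𝕜 hw hp → ℕ → 𝕜) :=
  Subtype.val_injective

/-- The identity, as a map to the quasi-normed space. -/
def toGarling : RGarling 𝕜 hw hp → GarlingSpace 𝕜 w p hp := id

theorem garlingSum_le_norm_toGarling (A : Finset ℕ) (x : RGarling 𝕜 hw hp) :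
    garlingSum w p A (coord x) ≤ ‖toGarling x‖ ^ p := by
  have h := ofReal_garlingSum_le hp (fun j => (hw.pos j).le) A (coord x)
  have h2 : garlingENorm w p (coord x) ≠ ∞ := ne_of_lt x.2
  have h3 := ENNReal.toReal_mono (ENNReal.rpow_ne_top_of_nonneg hp.le h2) h
  rwa [ENNReal.toReal_ofReal (garlingSum_nonneg (fun j => (hw.pos j).le) _ _),
    ← ENNReal.toReal_rpow] at h3

theorem norm_toGarling_le (x : RGarling 𝕜 hw hp) {c : ℝ}
    (h : ∀ A, garlingSum w p A (coord x) ≤ c) : ‖toGarling x‖ ^ p ≤ c := by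
  have hc : 0 ≤ c := by simpa using h ∅
  have h1 := garlingENorm_le_of_garlingSum_le hp (fun j => (hw.pos j).le) h
  have h2 : ‖toGarling x‖ ≤ c ^ (1 / p) := by
    have h3 := ENNReal.toReal_mono
      (ENNReal.rpow_ne_top_of_nonneg (by positivity) ENNReal.ofReal_ne_top) h1
    rwa [← ENNReal.toReal_rpow, ENNReal.toReal_ofReal hc] at h3
  have h3 : 0 ≤ ‖toGarling x‖ := (GarlingSpace.isQuasiNorm (𝕜 := 𝕜) hw hp).norm_nonneg _
  calc ‖toGarling x‖ ^ p ≤ (c ^ (1 / p)) ^ p := Real.rpow_le_rpow h3 h2 hp.le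
    _ = c := by rw [← Real.rpow_mul hc, one_div_mul_cancel hp.ne', Real.rpow_one]

theorem norm_toGarling_nonneg (x : RGarling 𝕜 hw hp) : 0 ≤ ‖toGarling x‖ :=
  (GarlingSpace.isQuasiNorm (𝕜 := 𝕜) hw hp).norm_nonneg _

theorem norm_toGarling_smul (c : 𝕜) (x : RGarling 𝕜 hw hp) :
    ‖toGarling (c • x)‖ = ‖c‖ * ‖toGarling x‖ :=
  (GarlingSpace.isQuasiNorm (𝕜 := 𝕜) hw hp).norm_smul c (toGarling x)

/-- This identity lets one argument treat `p ≤ 1` and `p ≥ 1` together: the quasi-norm to the power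
`p` is the group norm to the power `max p 1`. -/
theorem min_mul_max_one (p : ℝ) : min p 1 * max p 1 = p := by
  rw [min_mul_max, mul_one]

theorem rpow_min_rpow_max {t : ℝ} (ht : 0 ≤ t) (p : ℝ) : (t ^ min p 1) ^ max p 1 = t ^ p := by
  rw [← Real.rpow_mul ht, min_mul_max_one]

theorem rpow_min_toGarling_add_le (x y : RGarling 𝕜 hw hp) :
    ‖toGarling (x + y)‖ ^ min p 1 ≤ ‖toGarling x‖ ^ min p 1 + ‖toGarling y‖ ^ min p 1 := by
  have hP : 0 < max p 1 := lt_max_of_lt_right one_pos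
  have hx := norm_toGarling_nonneg x
  have hy := norm_toGarling_nonneg y
  have hxy := norm_toGarling_nonneg (x + y)
  have hw0 : ∀ j, 0 ≤ w j := fun j => (hw.pos j).le
  have key : ∀ (A : Finset ℕ) (z : RGarling 𝕜 hw hp),
      garlingSum w p A (coord z) ^ (1 / max p 1) ≤ ‖toGarling z‖ ^ min p 1 := by
    intro A z
    have hz := norm_toGarling_nonneg z
    have h1 := garlingSum_le_norm_toGarling A z
    rw [← rpow_min_rpow_max hz] at h1
    refine (Real.rpow_le_rpow (garlingSum_nonneg hw0 _ _) h1 (by positivity)).trans (le_of_eq ?_)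
    rw [← Real.rpow_mul (by positivity), mul_one_div_cancel hP.ne', Real.rpow_one]
  have h2 := norm_toGarling_le (x + y)
    (c := (‖toGarling x‖ ^ min p 1 + ‖toGarling y‖ ^ min p 1) ^ max p 1) fun A => by
      rw [map_add]
      have h3 := (garlingSum_add_rpow_le hp hw0 A (coord x) (coord y)).trans
        (add_le_add (key A x) (key A y))
      have h4 := Real.rpow_le_rpow (by have := garlingSum_nonneg (p := p) hw0 A (coord x + coord y)
                                       positivity) h3 hP.le
      rwa [← Real.rpow_mul (garlingSum_nonneg hw0 _ _), one_div_mul_cancel hP.ne',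
        Real.rpow_one] at h4
  rw [← rpow_min_rpow_max hxy] at h2
  exact (Real.rpow_le_rpow_iff (by positivity) (by positivity) hP).1 h2

noncomputable instance : NormedAddCommGroup (RGarling 𝕜 hw hp) :=
  AddGroupNorm.toNormedAddCommGroup
    { toFun := fun x => ‖toGarling x‖ ^ min p 1
      map_zero' := by
        have h := norm_toGarling_smul (0 : 𝕜) (0 : RGarling 𝕜 hw hp)
        rw [smul_zero, norm_zero, zero_mul] at h
        rw [h, Real.zero_rpow (lt_min hp one_pos).ne']
      add_le' := rpow_min_toGarling_add_le
      neg' := fun x => by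
        have h := norm_toGarling_smul (-1 : 𝕜) x
        rw [neg_one_smul, norm_neg, norm_one, one_mul] at h
        rw [h]
      eq_zero_of_map_eq_zero' := fun x hx => by
        rw [Real.rpow_eq_zero (norm_toGarling_nonneg x) (lt_min hp one_pos).ne'] at hx
        exact ((GarlingSpace.isQuasiNorm (𝕜 := 𝕜) hw hp).norm_eq_zero _).1 hx }

theorem norm_def (x : RGarling 𝕜 hw hp) : ‖x‖ = ‖toGarling x‖ ^ min p 1 := rfl

theorem norm_rpow_max (x : RGarling 𝕜 hw hp) : ‖x‖ ^ max p 1 = ‖toGarling x‖ ^ p := by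
  rw [norm_def, rpow_min_rpow_max (norm_toGarling_nonneg x)]

theorem isHomogeneousNorm : IsHomogeneousNorm 𝕜 (RGarling 𝕜 hw hp) (min p 1) where
  pos := lt_min hp one_pos
  norm_smul c x := by
    rw [norm_def, norm_def, norm_toGarling_smul,
      Real.mul_rpow (norm_nonneg _) (norm_toGarling_nonneg x)]

theorem garlingSum_le (A : Finset ℕ) (x : RGarling 𝕜 hw hp) :
    garlingSum w p A (coord x) ≤ ‖x‖ ^ max p 1 := by
  rw [norm_rpow_max]; exact garlingSum_le_norm_toGarling A x

theorem norm_rpow_le {x : RGarling 𝕜 hw hp} {c : ℝ}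
    (h : ∀ A, garlingSum w p A (coord x) ≤ c) : ‖x‖ ^ max p 1 ≤ c := by
  rw [norm_rpow_max]; exact norm_toGarling_le x h

theorem max_pos (p : ℝ) : 0 < max p 1 := lt_max_of_lt_right one_pos

theorem exists_coord_eq {f : ℕ → 𝕜} {c : ℝ} (h : ∀ A, garlingSum w p A f ≤ c) :
    ∃ x : RGarling 𝕜 hw hp, coord x = f :=
  ⟨⟨f, (garlingENorm_le_of_garlingSum_le hp (fun j => (hw.pos j).le) h).trans_lt
    (ENNReal.rpow_lt_top_of_nonneg (by positivity) ENNReal.ofReal_ne_top)⟩, rfl⟩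

theorem norm_coord_rpow_le (x : RGarling 𝕜 hw hp) (i : ℕ) :
    ‖coord x i‖ ^ p ≤ ‖x‖ ^ max p 1 := by
  simpa [hw.first] using garlingSum_le {i} x

theorem norm_coord_rpow_min_le (x : RGarling 𝕜 hw hp) (i : ℕ) :
    ‖coord x i‖ ^ min p 1 ≤ ‖x‖ := by
  have h := norm_coord_rpow_le x i
  rw [← rpow_min_rpow_max (norm_nonneg _)] at h
  exact (Real.rpow_le_rpow_iff (by positivity) (norm_nonneg _) (max_pos p)).1 h

theorem tendsto_coord {u : ℕ → RGarling 𝕜 hw hp} {x : RGarling 𝕜 hw hp}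
    (h : Tendsto u atTop (𝓝 x)) (i : ℕ) :
    Tendsto (fun n => coord (u n) i) atTop (𝓝 (coord x i)) := by
  have hr : 0 < min p 1 := lt_min hp one_pos
  rw [tendsto_iff_norm_sub_tendsto_zero] at h ⊢
  have h1 : Tendsto (fun n => ‖u n - x‖ ^ (1 / min p 1)) atTop (𝓝 0) := by
    have := h.rpow_const (p := 1 / min p 1) (Or.inr (by positivity))
    rwa [Real.zero_rpow (by positivity)] at this
  refine squeeze_zero (fun n => norm_nonneg _) (fun n => ?_) h1
  have h2 := Real.rpow_le_rpow (by positivity) (norm_coord_rpow_min_le (u n - x) i)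
    (by positivity : 0 ≤ 1 / min p 1)
  rwa [← Real.rpow_mul (norm_nonneg _), mul_one_div_cancel hr.ne', Real.rpow_one, map_sub] at h2

theorem tendsto_garlingSum (v : ℕ → ℝ) (hp : 0 < p) (A : Finset ℕ) {u : ℕ → ℕ → 𝕜} {f : ℕ → 𝕜}
    (h : ∀ i, Tendsto (fun n => u n i) atTop (𝓝 (f i))) :
    Tendsto (fun n => garlingSum v p A (u n)) atTop (𝓝 (garlingSum v p A f)) :=
  tendsto_finsetSum _ fun i _ => ((h i).norm.rpow_const (Or.inr hp.le)).mul_const _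

/-- A Cauchy sequence converges coordinatewise, and a bound on a sum over a fixed finite set
survives the limit. -/
instance : CompleteSpace (RGarling 𝕜 hw hp) := by
  refine Metric.complete_of_cauchySeq_tendsto fun u hu => ?_
  have hr : 0 < min p 1 := lt_min hp one_pos
  have hP := max_pos p
  have hcau : ∀ i, CauchySeq fun n => coord (u n) i := by
    intro i
    rw [Metric.cauchySeq_iff] at hu ⊢
    intro ε hε
    obtain ⟨N, hN⟩ := hu (ε ^ min p 1) (by positivity)
    refine ⟨N, fun m hm n hn => ?_⟩
    have h1 := hN m hm n hn
    rw [dist_eq_norm] at h1 ⊢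
    have h2 := (norm_coord_rpow_min_le (u m - u n) i).trans_lt h1
    rw [map_sub] at h2
    exact (Real.rpow_lt_rpow_iff (norm_nonneg _) hε.le hr).1 h2
  choose f hf using fun i => cauchySeq_tendsto_of_complete (hcau i)
  have hlim : ∀ (N : ℕ) (ε : ℝ), (∀ m ≥ N, ‖u N - u m‖ ≤ ε) →
      ∀ A, garlingSum w p A (coord (u N) - f) ≤ ε ^ max p 1 := by
    intro N ε hN A
    refine le_of_tendsto (tendsto_garlingSum w hp A (u := fun m => coord (u N) - coord (u m))
      fun i => ?_) ?_
    · simpa using tendsto_const_nhds.sub (hf i)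
    · filter_upwards [eventually_ge_atTop N] with m hm
      rw [← map_sub]
      exact (garlingSum_le A _).trans (Real.rpow_le_rpow (norm_nonneg _) (hN m hm) hP.le)
  rw [Metric.cauchySeq_iff] at hu
  obtain ⟨N, hN⟩ := hu 1 one_pos
  -- The bound is available for `coord (u N) - f` rather than for `f`, so the limit is recovered as
  -- `u N - y`.
  obtain ⟨y, hy⟩ := exists_coord_eq (hw := hw) (hp := hp) (hlim N 1 fun m hm => by
    rw [← dist_eq_norm]; exact (hN N le_rfl m hm).le)
  refine ⟨u N - y, Metric.tendsto_atTop.2 fun ε hε => ?_⟩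
  obtain ⟨M, hM⟩ := hu (ε / 2) (by positivity)
  refine ⟨M, fun n hn => ?_⟩
  have h1 : ‖u n - (u N - y)‖ ^ max p 1 ≤ (ε / 2) ^ max p 1 := norm_rpow_le fun A => by
    rw [map_sub, map_sub, hy, sub_sub_cancel]
    exact hlim n _ (fun m hm => by
      rw [← dist_eq_norm]; exact (hM n hn m (le_trans hn hm)).le) A
  have h2 := (Real.rpow_le_rpow_iff (norm_nonneg _) (by positivity) hP).1 h1
  rw [dist_eq_norm]
  linarith

/-- A positive power and its inverse power are both continuous and fix zero, so the two norms have
the same null sequences. -/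
theorem seriesTendsto_toGarling_iff {a : ℕ → 𝕜} {x : ℕ → RGarling 𝕜 hw hp}
    {s : RGarling 𝕜 hw hp} :
    SeriesTendsto a (fun j => toGarling (x j)) (toGarling s) ↔ SeriesTendsto a x s := by
  have hr : 0 < min p 1 := lt_min hp one_pos
  have hn : ∀ n, ‖s - ∑ j ∈ Finset.range n, a j • x j‖ =
      ‖toGarling s - ∑ j ∈ Finset.range n, a j • toGarling (x j)‖ ^ min p 1 := fun n => rfl
  have h0 : ∀ n, 0 ≤ ‖toGarling s - ∑ j ∈ Finset.range n, a j • toGarling (x j)‖ :=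
    fun n => (GarlingSpace.isQuasiNorm (𝕜 := 𝕜) hw hp).norm_nonneg _
  constructor
  · intro h
    have := Tendsto.rpow_const (p := min p 1) h (Or.inr hr.le)
    rw [Real.zero_rpow hr.ne'] at this
    simp only [SeriesTendsto, hn]
    exact this
  · intro h
    have := Tendsto.rpow_const (p := 1 / min p 1) h (Or.inr (by positivity))
    rw [Real.zero_rpow (by positivity)] at this
    simp only [hn] at this
    refine this.congr fun n => ?_
    rw [← Real.rpow_mul (h0 n), mul_one_div_cancel hr.ne', Real.rpow_one]

theorem seriesConverges_toGarling_iff {a : ℕ → 𝕜} {x : ℕ → RGarling 𝕜 hw hp} :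
    SeriesConverges a (fun j => toGarling (x j)) ↔ SeriesConverges a x :=
  exists_congr fun _ => seriesTendsto_toGarling_iff

theorem closedSpan_toGarling (x : ℕ → RGarling 𝕜 hw hp) :
    closedSpan 𝕜 (fun j => toGarling (x j)) = closedSpan 𝕜 x := by
  have hr : 0 < min p 1 := lt_min hp one_pos
  have hn : ∀ s z : RGarling 𝕜 hw hp, ‖s - z‖ = ‖toGarling s - toGarling z‖ ^ min p 1 :=
    fun s z => rfl
  have h0 : ∀ s z : RGarling 𝕜 hw hp, 0 ≤ ‖toGarling s - toGarling z‖ :=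
    fun s z => (GarlingSpace.isQuasiNorm (𝕜 := 𝕜) hw hp).norm_nonneg _
  ext s
  constructor
  · intro h ε hε
    obtain ⟨z, hz, hsz⟩ := h (ε ^ (1 / min p 1)) (by positivity)
    refine ⟨z, hz, ?_⟩
    rw [hn s z]
    have := Real.rpow_lt_rpow (h0 s z) hsz hr
    rwa [← Real.rpow_mul hε.le, one_div_mul_cancel hr.ne', Real.rpow_one] at this
  · intro h ε hε
    obtain ⟨z, hz, hsz⟩ := h (ε ^ min p 1) (by positivity)
    refine ⟨z, hz, ?_⟩
    rw [hn s z] at hsz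
    exact (Real.rpow_lt_rpow_iff (h0 s z) hε.le hr).1 hsz

theorem isSymmetricBasicSeq_toGarling_iff {x : ℕ → RGarling 𝕜 hw hp} :
    IsSymmetricBasicSeq 𝕜 (fun j => toGarling (x j)) ↔ IsSymmetricBasicSeq 𝕜 x := by
  unfold IsSymmetricBasicSeq IsBasicSeq BasicSeqEquiv
  rw [closedSpan_toGarling]
  refine and_congr (forall₂_congr fun s _ => ?_) (forall_congr' fun π => forall_congr' fun a => ?_)
  · exact existsUnique_congr fun a => seriesTendsto_toGarling_iff
  · exact iff_congr (seriesConverges_toGarling_iff (x := fun j => x (π j)))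
      seriesConverges_toGarling_iff

end RGarling

/-! ### Block sequences -/

section Blocks

variable {𝕜 : Type*} [RCLike 𝕜]

/-- The `k`-th sequence is supported in the interval `[q k, q (k + 1))`. -/
structure IsBlockSeq (q : ℕ → ℕ) (y : ℕ → ℕ → 𝕜) : Prop where
  zero : q 0 = 0
  strictMono : StrictMono q
  eq_zero_of_lt : ∀ k i, i < q k → y k i = 0
  eq_zero_of_ge : ∀ k i, q (k + 1) ≤ i → y k i = 0

theorem exists_mem_interval {q : ℕ → ℕ} (h0 : q 0 = 0) (hq : StrictMono q) (i : ℕ) :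
    ∃ k, q k ≤ i ∧ i < q (k + 1) := by
  have hex : ∃ k, i < q (k + 1) := ⟨i, (Nat.lt_succ_self i).trans_le hq.le_apply⟩
  classical
  refine ⟨Nat.find hex, ?_, Nat.find_spec hex⟩
  rcases h : Nat.find hex with _ | k
  · rw [h0]; exact Nat.zero_le _
  · exact not_lt.1 (Nat.find_min hex (by rw [h]; exact Nat.lt_succ_self k))

theorem interval_unique {q : ℕ → ℕ} (hq : StrictMono q) {i k l : ℕ} (h1 : q k ≤ i)
    (h2 : i < q (k + 1)) (h3 : q l ≤ i) (h4 : i < q (l + 1)) : k = l := by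
  have h5 := hq.lt_iff_lt.1 (h1.trans_lt h4)
  have h6 := hq.lt_iff_lt.1 (h3.trans_lt h2)
  lia

variable {q : ℕ → ℕ} {y : ℕ → ℕ → 𝕜}

theorem IsBlockSeq.mem_of_ne_zero (h : IsBlockSeq q y) {k i : ℕ} (hi : y k i ≠ 0) :
    q k ≤ i ∧ i < q (k + 1) :=
  ⟨not_lt.1 fun h1 => hi (h.eq_zero_of_lt k i h1), not_le.1 fun h1 => hi (h.eq_zero_of_ge k i h1)⟩

theorem IsBlockSeq.eq_zero_of_ne (h : IsBlockSeq q y) {k l i : ℕ} (h1 : q k ≤ i)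
    (h2 : i < q (k + 1)) (hl : l ≠ k) : y l i = 0 := by
  by_contra hi
  have h3 := h.mem_of_ne_zero hi
  exact hl (interval_unique h.strictMono h3.1 h3.2 h1 h2)

theorem IsBlockSeq.disjoint (h : IsBlockSeq q y) {k l : ℕ} (hkl : k ≠ l) (i : ℕ) :
    y k i = 0 ∨ y l i = 0 := by
  by_contra! hi
  have h1 := h.mem_of_ne_zero hi.1
  exact hi.2 (h.eq_zero_of_ne h1.1 h1.2 hkl.symm)

theorem IsBlockSeq.sum_apply (h : IsBlockSeq q y) (G : Finset ℕ) (a : ℕ → 𝕜) {k i : ℕ}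
    (h1 : q k ≤ i) (h2 : i < q (k + 1)) :
    (∑ l ∈ G, a l • y l) i = if k ∈ G then a k * y k i else 0 := by
  rw [Finset.sum_apply]
  simp only [Pi.smul_apply, smul_eq_mul]
  split_ifs with hk
  · rw [Finset.sum_eq_single_of_mem k hk fun l _ hl => by
      rw [h.eq_zero_of_ne h1 h2 hl, mul_zero]]
  · refine Finset.sum_eq_zero fun l hl => ?_
    rw [h.eq_zero_of_ne h1 h2 (fun e => hk (e ▸ hl)), mul_zero]

theorem IsBlockSeq.norm_sum_apply_le_of_subset (h : IsBlockSeq q y) {G H : Finset ℕ}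
    (hGH : G ⊆ H) (a : ℕ → 𝕜) (i : ℕ) :
    ‖(∑ l ∈ G, a l • y l) i‖ ≤ ‖(∑ l ∈ H, a l • y l) i‖ := by
  obtain ⟨k, h1, h2⟩ := exists_mem_interval h.zero h.strictMono i
  rw [h.sum_apply G a h1 h2, h.sum_apply H a h1 h2]
  split_ifs with hG hH hH
  · exact le_rfl
  · exact absurd (hGH hG) hH
  · rw [norm_zero]; exact norm_nonneg _
  · exact le_rfl

variable {w : ℕ → ℝ} {p : ℝ}

/-- Positions depend on `A` alone, so for fixed `A` disjointly supported vectors contribute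
independently, in whatever order the blocks are used. -/
theorem IsBlockSeq.garlingSum_sum (h : IsBlockSeq q y) (hp : 0 < p) (A G : Finset ℕ)
    (a : ℕ → 𝕜) (σ : ℕ → ℕ) (hσ : Set.InjOn σ G) :
    garlingSum w p A (∑ l ∈ G, a l • y (σ l)) =
      ∑ l ∈ G, ‖a l‖ ^ p * garlingSum w p A (y (σ l)) := by
  induction G using Finset.induction_on with
  | empty => simp [garlingSum, Real.zero_rpow hp.ne']
  | insert k G hk ih =>
    rw [Finset.sum_insert hk, Finset.sum_insert hk, garlingSum_add_of_disjoint hp,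
      garlingSum_smul, ih (hσ.mono (by simp))]
    intro i
    by_cases hi : y (σ k) i = 0
    · left; simp [hi]
    · right
      rw [Finset.sum_apply]
      refine Finset.sum_eq_zero fun l hl => ?_
      have hkl : σ k ≠ σ l := fun e => hk (by
        rwa [hσ (by simp) (by simp [hl]) e])
      have := (h.disjoint hkl i).resolve_left hi
      simp [this]

theorem IsBlockSeq.exists_subset_Ico (h : IsBlockSeq q y) (hp : 0 < p) (hw : Antitone w) (k : ℕ)
    (A : Finset ℕ) : ∃ B ⊆ Finset.Ico (q k) (q (k + 1)),
      garlingSum w p A (y k) ≤ garlingSum w p B (y k) := by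
  refine ⟨A.filter (· ∈ Finset.Ico (q k) (q (k + 1))),
    fun i hi => (Finset.mem_filter.1 hi).2,
    garlingSum_le_of_subset hp hw (Finset.filter_subset _ _) fun i hi hi' => ?_⟩
  by_contra h0
  exact hi' (Finset.mem_filter.2 ⟨hi, Finset.mem_Ico.2 (h.mem_of_ne_zero h0)⟩)

/-- If the blocks keep a fixed part of their size under every shift of the weight, some subsequence
of them has a lower `p`-estimate. -/
theorem IsBlockSeq.exists_lower_estimate (h : IsBlockSeq q y) (hp : 0 < p) (hw : Antitone w)
    {η : ℝ} (hη : ∀ M k₀ : ℕ, ∃ k ≥ k₀, ∃ A, η ≤ garlingSum (shiftWeight w M) p A (y k)) :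
    ∃ s : ℕ → ℕ, StrictMono s ∧ ∀ (a : ℕ → 𝕜) (n : ℕ), ∃ A,
      η * ∑ i ∈ Finset.range n, ‖a i‖ ^ p ≤
        garlingSum w p A (∑ i ∈ Finset.range n, a i • y (s i)) := by
  -- A set lying in the blocks up to index `m` has at most `q (m + 1)` elements. The next block is
  -- chosen large for the weight shifted by that amount, so whatever was selected before cannot
  -- spoil it.
  have H : ∀ m, ∃ k > m, ∃ A ⊆ Finset.Ico (q k) (q (k + 1)),
      η ≤ garlingSum (shiftWeight w (q (m + 1))) p A (y k) := by
    intro m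
    obtain ⟨k, hk, A, hA⟩ := hη (q (m + 1)) (m + 1)
    obtain ⟨B, hB, hAB⟩ := h.exists_subset_Ico hp (shiftWeight_antitone hw (q (m + 1))) k A
    exact ⟨k, hk, B, hB, hA.trans hAB⟩
  choose f hf A hA hAη using H
  let t : ℕ → ℕ := fun n => f^[n] 0
  have ht : ∀ n, t (n + 1) = f (t n) := fun n => Function.iterate_succ_apply' f n 0
  have htm : StrictMono t := strictMono_nat_of_lt_succ fun n => by rw [ht]; exact hf _
  refine ⟨fun n => t (n + 1), fun i j hij => htm (by lia), fun a n => ?_⟩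
  suffices ∃ D ⊆ Finset.range (q (t n + 1)), η * ∑ i ∈ Finset.range n, ‖a i‖ ^ p ≤
      garlingSum w p D (∑ i ∈ Finset.range n, a i • y (t (i + 1))) by
    obtain ⟨D, -, hD⟩ := this
    exact ⟨D, hD⟩
  induction n with
  | zero => exact ⟨∅, by simp, by simp⟩
  | succ n ih =>
    obtain ⟨D, hD, hDη⟩ := ih
    set B := A (t n) with hB
    have hBI : ∀ b ∈ B, q (t (n + 1)) ≤ b ∧ b < q (t (n + 1) + 1) := fun b hb => by
      rw [ht]; exact Finset.mem_Ico.1 (hA _ hb)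
    have hlt : q (t n + 1) ≤ q (t (n + 1)) := h.strictMono.monotone (htm (Nat.lt_succ_self n))
    have hDr : ∀ d ∈ D, d < q (t (n + 1)) := fun d hd =>
      (Finset.mem_range.1 (hD hd)).trans_le hlt
    have hcard : D.card ≤ q (t n + 1) := by simpa using Finset.card_le_card hD
    refine ⟨D ∪ B, ?_, ?_⟩
    · refine Finset.union_subset (fun d hd => ?_) fun b hb => ?_
      · have := hDr d hd
        have := h.strictMono (Nat.lt_succ_self (t (n + 1)))
        rw [Finset.mem_range]; lia
      · exact Finset.mem_range.2 (hBI b hb).2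
    · rw [garlingSum_union fun d hd b hb => (hDr d hd).trans_le (hBI b hb).1,
        Finset.sum_range_succ, mul_add]
      refine add_le_add (hDη.trans (le_of_eq (garlingSum_congr fun i hi => ?_))) ?_
      · rw [Finset.sum_range_succ, Pi.add_apply, Pi.smul_apply, h.eq_zero_of_lt _ _ (hDr i hi),
          smul_zero, add_zero]
      · rw [garlingSum_congr (y := a n • y (t (n + 1))) fun i hi => ?_, garlingSum_smul, mul_comm]
        · refine mul_le_mul_of_nonneg_left ?_ (by positivity)
          refine (hAη (t n)).trans ?_
          rw [← ht]
          exact garlingSum_le_of_weight_le (shiftWeight_le_shiftWeight hw hcard) _ _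
        · rw [Finset.sum_range_succ, Pi.add_apply, Finset.sum_apply,
            Finset.sum_eq_zero fun l hl => ?_, zero_add]
          have h1 : t (l + 1) < t (n + 1) := htm (by simpa using hl)
          rw [Pi.smul_apply, h.eq_zero_of_ge _ _
            ((h.strictMono.monotone h1).trans (hBI i hi).1), smul_zero]

/-- Sums of blocks whose sizes are bounded below are unbounded. -/
theorem IsBlockSeq.exists_le_garlingSum_sum (h : IsBlockSeq q y) (hp : 0 < p)
    (hw : IsGarlingWeight w) {c : ℝ} (hc : 0 < c) (hy : ∀ k, ∃ A, c ≤ garlingSum w p A (y k))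
    (D : ℝ) : ∃ n, ∀ m ≥ n, ∃ A, D ≤ garlingSum w p A (∑ k ∈ Finset.range m, y k) := by
  have hw0 : ∀ j, 0 ≤ w j := fun j => (hw.pos j).le
  have hw1 : ∀ j, w j ≤ 1 := fun j => hw.first ▸ hw.antitone (Nat.zero_le j)
  have hsub : ∀ (G H A : Finset ℕ), G ⊆ H →
      garlingSum w p A (∑ k ∈ G, y k) ≤ garlingSum w p A (∑ k ∈ H, y k) := fun G H A hGH =>
    garlingSum_mono hp hw0 fun i _ => by
      simpa using h.norm_sum_apply_le_of_subset hGH (fun _ => (1 : 𝕜)) i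
  -- Either a subsequence has a lower `p`-estimate, or the blocks lose half of their size under some
  -- shift. In the second case each late block has a large coordinate.
  by_cases H : ∀ M k₀ : ℕ, ∃ k ≥ k₀, ∃ A, c / 2 ≤ garlingSum (shiftWeight w M) p A (y k)
  · obtain ⟨s, hs, hsη⟩ := h.exists_lower_estimate hp hw.antitone H
    obtain ⟨n, hn⟩ := exists_nat_ge (D / (c / 2))
    refine ⟨s n, fun m hm => ?_⟩
    obtain ⟨A, hA⟩ := hsη (fun _ => 1) n
    refine ⟨A, le_trans ?_ (hA.trans ?_)⟩
    · rw [div_le_iff₀ (by positivity)] at hn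
      simpa [mul_comm] using hn
    · simp only [one_smul]
      rw [← Finset.sum_image (s := Finset.range n) (g := s) (f := y) hs.injective.injOn]
      refine hsub _ _ _ fun k hk => ?_
      obtain ⟨i, hi, rfl⟩ := Finset.mem_image.1 hk
      exact Finset.mem_range.2 ((hs (Finset.mem_range.1 hi)).trans_le hm)
  · push Not at H
    obtain ⟨M, k₀, H⟩ := H
    -- If all coordinates had `p`-th power at most `δ`, dropping the first `M` terms would cost at
    -- most `c / 2` and leave less than `c / 2`, contradicting the size of the block.
    set δ := c / 2 / (M + 1) with hδ
    have hδ0 : 0 < δ := by positivity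
    have hbig : ∀ k ≥ k₀, ∃ i, δ < ‖y k i‖ ^ p := by
      intro k hk
      by_contra! hcon
      obtain ⟨A, hA⟩ := hy k
      obtain ⟨B, -, hB⟩ := exists_garlingSum_le_shiftWeight hw1 hcon A M
      have h1 := H k hk B
      have h2 : (M : ℝ) * δ ≤ c / 2 := by
        rw [hδ, mul_div_left_comm]
        refine mul_le_of_le_one_right (by positivity) ?_
        rw [div_le_one (by positivity)]; linarith
      linarith
    choose! ι hι using hbig
    have htend := (not_summable_iff_tendsto_nat_atTop_of_nonneg hw0).1 hw.not_summable
    obtain ⟨n, hn⟩ := (htend.eventually_ge_atTop (D / δ)).exists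
    refine ⟨k₀ + n, fun m hm => ?_⟩
    -- One large coordinate from each of `n` successive blocks yields `δ` times a partial sum of the
    -- divergent series of weights.
    suffices ∀ n, k₀ + n ≤ m → ∃ A ⊆ Finset.range (q (k₀ + n)), A.card = n ∧
        δ * ∑ j ∈ Finset.range n, w j ≤ garlingSum w p A (∑ k ∈ Finset.range m, y k) by
      obtain ⟨A, -, -, hA⟩ := this n hm
      refine ⟨A, le_trans ?_ hA⟩
      rwa [div_le_iff₀' hδ0] at hn
    intro n
    induction n with
    | zero => exact fun _ => ⟨∅, by simp, by simp, by simp⟩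
    | succ n ih =>
      intro hnm
      obtain ⟨A, hA, hAc, hAδ⟩ := ih (by lia)
      have hk := hι (k₀ + n) (by lia)
      have hmem := h.mem_of_ne_zero (k := k₀ + n) (i := ι (k₀ + n)) fun h0 => by
        rw [h0, norm_zero, Real.zero_rpow hp.ne'] at hk; exact hk.not_gt hδ0
      have hlt : ∀ a ∈ A, ∀ b ∈ ({ι (k₀ + n)} : Finset ℕ), a < b := fun a ha b hb => by
        rw [Finset.mem_singleton.1 hb]
        exact (Finset.mem_range.1 (hA ha)).trans_le hmem.1
      refine ⟨A ∪ {ι (k₀ + n)}, ?_, ?_, ?_⟩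
      · refine Finset.union_subset (fun a ha => ?_) (by simpa [add_assoc] using hmem.2)
        exact Finset.mem_range.2 ((Finset.mem_range.1 (hA ha)).trans
          (h.strictMono (by lia)))
      · rw [Finset.card_union_of_disjoint, hAc, Finset.card_singleton]
        exact Finset.disjoint_left.2 fun a ha hb => lt_irrefl a (hlt a ha a hb)
      · rw [garlingSum_union hlt, garlingSum_singleton, Finset.sum_range_succ, mul_add, hAc]
        refine add_le_add hAδ ?_
        have h1 := h.sum_apply (Finset.range m) (fun _ => 1) hmem.1 hmem.2
        simp only [one_smul, one_mul] at h1
        rw [h1, if_pos (by simp; lia), shiftWeight, zero_add]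
        exact mul_le_mul_of_nonneg_right hk.le (hw0 _)

end Blocks

/-! ### Coordinate restrictions and vanishing tails -/

namespace RGarling

variable {𝕜 : Type*} [RCLike 𝕜] {w : ℕ → ℝ} {p : ℝ} {hw : IsGarlingWeight w} {hp : 0 < p}

theorem weight_nonneg (hw : IsGarlingWeight w) (j : ℕ) : 0 ≤ w j := (hw.pos j).le

theorem weight_le_one (hw : IsGarlingWeight w) (j : ℕ) : w j ≤ 1 :=
  hw.first ▸ hw.antitone (Nat.zero_le j)

theorem exists_coord_eq_indicator (I : Set ℕ) (x : RGarling 𝕜 hw hp) :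
    ∃ z : RGarling 𝕜 hw hp, coord z = I.indicator (coord x) :=
  exists_coord_eq (c := ‖x‖ ^ max p 1) fun A =>
    (garlingSum_mono hp (weight_nonneg hw) fun _ _ => norm_indicator_le_norm_self _ _).trans
      (garlingSum_le A x)

/-- The restriction of a vector to a set of coordinates. -/
noncomputable def restrict (I : Set ℕ) (x : RGarling 𝕜 hw hp) : RGarling 𝕜 hw hp :=
  (exists_coord_eq_indicator I x).choose

@[simp]
theorem coord_restrict (I : Set ℕ) (x : RGarling 𝕜 hw hp) :
    coord (restrict I x) = I.indicator (coord x) :=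
  (exists_coord_eq_indicator I x).choose_spec

theorem norm_le_of_garlingSum_le {x y : RGarling 𝕜 hw hp}
    (h : ∀ A, garlingSum w p A (coord x) ≤ garlingSum w p A (coord y)) : ‖x‖ ≤ ‖y‖ := by
  have := norm_rpow_le (x := x) (c := ‖y‖ ^ max p 1) fun A => (h A).trans (garlingSum_le A y)
  exact (Real.rpow_le_rpow_iff (norm_nonneg _) (norm_nonneg _) (max_pos p)).1 this

theorem norm_le_of_norm_coord_le {x y : RGarling 𝕜 hw hp}
    (h : ∀ i, ‖coord x i‖ ≤ ‖coord y i‖) : ‖x‖ ≤ ‖y‖ :=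
  norm_le_of_garlingSum_le fun _ => garlingSum_mono hp (weight_nonneg hw) fun i _ => h i

theorem exists_lt_garlingSum {x : RGarling 𝕜 hw hp} {c : ℝ} (h : c < ‖x‖ ^ max p 1) :
    ∃ A, c < garlingSum w p A (coord x) := by
  by_contra! hcon
  exact (norm_rpow_le hcon).not_gt h

/-- The tails of a vector of `g(w, p)` tend to zero in norm. -/
theorem tendsto_restrict_Ici (x : RGarling 𝕜 hw hp) :
    Tendsto (fun n => ‖restrict (Set.Ici n) x‖) atTop (𝓝 0) := by
  have hanti : Antitone fun n => ‖restrict (Set.Ici n) x‖ := fun m n hmn =>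
    norm_le_of_norm_coord_le fun i => by
      rw [coord_restrict, coord_restrict]
      by_cases hi : n ≤ i
      · rw [Set.indicator_of_mem (by exact hi), Set.indicator_of_mem (by exact hmn.trans hi)]
      · rw [Set.indicator_of_notMem (by exact hi), norm_zero]; exact norm_nonneg _
  by_contra hcon
  have H : ∃ ε > 0, ∀ n, ε ≤ ‖restrict (Set.Ici n) x‖ := by
    by_contra! H
    refine hcon (Metric.tendsto_atTop.2 fun ε hε => ?_)
    obtain ⟨n, hn⟩ := H ε hε
    exact ⟨n, fun m hm => by
      rw [Real.dist_0_eq_abs, abs_of_nonneg (norm_nonneg _)]; exact (hanti hm).trans_lt hn⟩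
  obtain ⟨ε, hε, H⟩ := H
  -- If the tails do not vanish, consecutive pieces of `x` all have size bounded below. Their sums
  -- are dominated by `x`, yet `exists_le_garlingSum_sum` makes them unbounded.
  have H' : ∀ n, ∃ A : Finset ℕ, ∃ m > n, (∀ i ∈ A, i < m) ∧
      ε ^ max p 1 / 2 < garlingSum w p A (coord (restrict (Set.Ici n) x)) := by
    intro n
    obtain ⟨A, hA⟩ := exists_lt_garlingSum (x := restrict (Set.Ici n) x) (c := ε ^ max p 1 / 2)
      ((half_lt_self (by positivity)).trans_le
        (Real.rpow_le_rpow hε.le (H n) (max_pos p).le))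
    refine ⟨A, n + A.sup id + 1, by lia, fun i hi => ?_, hA⟩
    have := Finset.le_sup (f := id) hi
    simp only [id] at this; lia
  choose A g hg hA hAε using H'
  let q : ℕ → ℕ := fun k => g^[k] 0
  have hqs : ∀ k, q (k + 1) = g (q k) := fun k => Function.iterate_succ_apply' g k 0
  have hq : StrictMono q := strictMono_nat_of_lt_succ fun k => by rw [hqs]; exact hg _
  let y : ℕ → ℕ → 𝕜 := fun k => (Set.Ico (q k) (q (k + 1))).indicator (coord x)
  have hy : IsBlockSeq q y :=
    { zero := rfl
      strictMono := hq
      eq_zero_of_lt := fun k i hi => Set.indicator_of_notMem (fun h => hi.not_ge h.1) _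
      eq_zero_of_ge := fun k i hi => Set.indicator_of_notMem (fun h => hi.not_gt h.2) _ }
  obtain ⟨n, hn⟩ := hy.exists_le_garlingSum_sum hp hw (c := ε ^ max p 1 / 2) (by positivity)
    (fun k => ⟨A (q k), (hAε (q k)).le.trans (garlingSum_mono hp (weight_nonneg hw) fun i hi => by
      rw [coord_restrict]
      by_cases h1 : q k ≤ i
      · have h2 : i < q (k + 1) := by rw [hqs]; exact hA _ i hi
        rw [Set.indicator_of_mem (by exact h1)]
        simp only [y]
        rw [Set.indicator_of_mem (by exact ⟨h1, h2⟩)]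
      · rw [Set.indicator_of_notMem (by exact h1), norm_zero]; exact norm_nonneg _)⟩)
    (‖x‖ ^ max p 1 + 1)
  obtain ⟨D, hD⟩ := hn n le_rfl
  have h1 : garlingSum w p D (∑ k ∈ Finset.range n, y k) ≤ garlingSum w p D (coord x) :=
    garlingSum_mono hp (weight_nonneg hw) fun i _ => by
      obtain ⟨k, h1, h2⟩ := exists_mem_interval hy.zero hq i
      have h3 := hy.sum_apply (Finset.range n) (fun _ => 1) h1 h2
      simp only [one_smul, one_mul] at h3
      rw [h3]
      split_ifs
      · exact norm_indicator_le_norm_self _ _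
      · simp
  linarith [garlingSum_le D x]

theorem sub_restrict_Iio (n : ℕ) (x : RGarling 𝕜 hw hp) :
    x - restrict (Set.Iio n) x = restrict (Set.Ici n) x := by
  apply coord_injective
  rw [map_sub, coord_restrict, coord_restrict, sub_eq_iff_eq_add, ← Set.compl_Iio,
    Set.indicator_compl_add_self]

theorem tendsto_restrict_Iio (x : RGarling 𝕜 hw hp) :
    Tendsto (fun n => restrict (Set.Iio n) x) atTop (𝓝 x) := by
  rw [tendsto_iff_norm_sub_tendsto_zero]
  refine (tendsto_restrict_Ici x).congr fun n => ?_
  rw [← sub_restrict_Iio, norm_sub_rev]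

end RGarling

/-! ### Passing from symmetric sequences to symmetric block sequences -/

/-- Bounded scalar sequences have a coordinatewise convergent subsequence. -/
theorem exists_subseq_tendsto_coordinatewise {𝕜 : Type*} [RCLike 𝕜] (u : ℕ → ℕ → 𝕜) {R : ℝ}
    (hu : ∀ n i, ‖u n i‖ ≤ R) : ∃ φ : ℕ → ℕ, StrictMono φ ∧ ∃ f : ℕ → 𝕜,
      ∀ i, Tendsto (fun n => u (φ n) i) atTop (𝓝 (f i)) := by
  have hc : IsCompact (Set.univ.pi fun _ : ℕ => Metric.closedBall (0 : 𝕜) R) :=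
    isCompact_univ_pi fun _ => isCompact_closedBall _ _
  obtain ⟨f, -, φ, hφ, hf⟩ := hc.tendsto_subseq (x := u) fun n i _ => by simpa using hu n i
  exact ⟨φ, hφ, f, tendsto_pi_nhds.1 hf⟩

/-- A sequence dominating, and dominated by, a uniformly symmetric one is uniformly symmetric. -/
theorem IsUniformlySymmetric.of_equivalent {𝕜 E F : Type*} [RCLike 𝕜] [NormedAddCommGroup E]
    [Module 𝕜 E] [NormedAddCommGroup F] [Module 𝕜 F] {x : ℕ → E} {y : ℕ → F} {C c c' : ℝ}
    (hx : IsUniformlySymmetric 𝕜 x C) (hc : 0 < c) (hc' : 0 < c')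
    (h : ∀ (s : Finset ℕ) (a : ℕ → 𝕜), c * ‖∑ j ∈ s, a j • x j‖ ≤ ‖∑ j ∈ s, a j • y j‖ ∧
      ‖∑ j ∈ s, a j • y j‖ ≤ c' * ‖∑ j ∈ s, a j • x j‖) :
    IsUniformlySymmetric 𝕜 y (c' * C / c) where
  pos := by have := hx.pos; positivity
  ne_zero j hj := by
    have h1 := (h {j} 1).1
    simp only [Finset.sum_singleton, Pi.one_apply, one_smul, hj, norm_zero] at h1
    have := norm_pos_iff.2 (hx.ne_zero j)
    nlinarith
  relabel s a σ τ hσ hτ := by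
    have hC := hx.pos
    have key : ∀ ρ : ℕ → ℕ, Set.InjOn ρ s →
        c * ‖∑ j ∈ s, a j • x (ρ j)‖ ≤ ‖∑ j ∈ s, a j • y (ρ j)‖ ∧
          ‖∑ j ∈ s, a j • y (ρ j)‖ ≤ c' * ‖∑ j ∈ s, a j • x (ρ j)‖ := by
      intro ρ hρ
      have h1 := h (s.image ρ) fun i => a (Function.invFunOn ρ s i)
      rw [Finset.sum_image hρ, Finset.sum_image hρ] at h1
      have h2 : ∀ j ∈ s, Function.invFunOn ρ s (ρ j) = j := fun j hj =>
        hρ.leftInvOn_invFunOn hj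
      rwa [Finset.sum_congr (g := fun j => a j • x (ρ j)) rfl fun j hj => by rw [h2 j hj],
        Finset.sum_congr (g := fun j => a j • y (ρ j)) rfl fun j hj => by rw [h2 j hj]] at h1
    rw [div_mul_eq_mul_div, le_div_iff₀ hc]
    have h1 := (key σ hσ).2
    have h2 := (key τ hτ).1
    have h3 := hx.relabel s a σ τ hσ hτ
    calc ‖∑ j ∈ s, a j • y (σ j)‖ * c ≤ c' * ‖∑ j ∈ s, a j • x (σ j)‖ * c := by gcongr
      _ ≤ c' * (C * ‖∑ j ∈ s, a j • x (τ j)‖) * c := by gcongr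
      _ = c' * C * (c * ‖∑ j ∈ s, a j • x (τ j)‖) := by ring
      _ ≤ _ := by gcongr
  subsum s t a hst := by
    have hC := hx.pos
    rw [div_mul_eq_mul_div, le_div_iff₀ hc]
    have h1 := (h s a).2
    have h2 := (h t a).1
    have h3 := hx.subsum s t a hst
    calc ‖∑ j ∈ s, a j • y j‖ * c ≤ c' * ‖∑ j ∈ s, a j • x j‖ * c := by gcongr
      _ ≤ c' * (C * ‖∑ j ∈ t, a j • x j‖) * c := by gcongr
      _ = c' * C * (c * ‖∑ j ∈ t, a j • x j‖) := by ring
      _ ≤ _ := by gcongr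

/-- Differences of disjoint pairs from a uniformly symmetric sequence are equivalent to it. -/
theorem IsUniformlySymmetric.difference {𝕜 E : Type*} [RCLike 𝕜] [NormedAddCommGroup E]
    [Module 𝕜 E] {x : ℕ → E} {C : ℝ} (hx : IsUniformlySymmetric 𝕜 x C) {σ τ : ℕ → ℕ}
    (hσ : Function.Injective σ) (hτ : Function.Injective τ) (hστ : ∀ i j, σ i ≠ τ j)
    (s : Finset ℕ) (a : ℕ → 𝕜) :
    ‖∑ j ∈ s, a j • x j‖ ≤ C * C * ‖∑ j ∈ s, a j • (x (σ j) - x (τ j))‖ ∧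
      ‖∑ j ∈ s, a j • (x (σ j) - x (τ j))‖ ≤ 2 * C * ‖∑ j ∈ s, a j • x j‖ := by
  have hC := hx.pos
  have hid : Set.InjOn (fun j : ℕ => j) s := Function.injective_id.injOn
  have h1 := hx.relabel s a (fun j => j) σ hid hσ.injOn
  have h2 := hx.relabel s a σ (fun j => j) hσ.injOn hid
  have h3 := hx.relabel s a τ (fun j => j) hτ.injOn hid
  simp only [smul_sub, Finset.sum_sub_distrib]
  constructor
  · let b : ℕ → 𝕜 := Function.extend σ a (Function.extend τ (fun j => -a j) 0)
    have hbσ : ∀ j, b (σ j) = a j := fun j => hσ.extend_apply _ _ _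
    have hbτ : ∀ j, b (τ j) = -a j := fun j => by
      simp only [b]
      rw [Function.extend_apply' _ _ _ (by rintro ⟨i, hi⟩; exact hστ i j hi), hτ.extend_apply]
    have hd : Disjoint (s.image σ) (s.image τ) := by
      rw [Finset.disjoint_left]
      intro i hi hi'
      obtain ⟨k, -, rfl⟩ := Finset.mem_image.1 hi
      obtain ⟨l, -, hl⟩ := Finset.mem_image.1 hi'
      exact hστ k l hl.symm
    have h4 := hx.subsum (s.image σ) (s.image σ ∪ s.image τ) b Finset.subset_union_left
    rw [Finset.sum_union hd, Finset.sum_image hσ.injOn, Finset.sum_image hτ.injOn] at h4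
    simp only [hbσ, hbτ, neg_smul, Finset.sum_neg_distrib, ← sub_eq_add_neg] at h4
    calc _ ≤ C * ‖∑ j ∈ s, a j • x (σ j)‖ := h1
      _ ≤ _ := by rw [mul_assoc]; gcongr
  · refine (norm_sub_le _ _).trans ?_
    linarith

namespace RGarling

variable {𝕜 : Type*} [RCLike 𝕜] {w : ℕ → ℝ} {p : ℝ} {hw : IsGarlingWeight w} {hp : 0 < p}

theorem norm_restrict_Iio_rpow_le (N : ℕ) (x : RGarling 𝕜 hw hp) :
    ‖restrict (Set.Iio N) x‖ ^ max p 1 ≤ ∑ i ∈ Finset.range N, ‖coord x i‖ ^ p := by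
  refine norm_rpow_le fun A => ?_
  rw [coord_restrict]
  have h1 := garlingSum_le_of_subset (w := w) hp hw.antitone (A := A)
    (B := A.filter (· ∈ Finset.range N)) (Finset.filter_subset _ _)
    (x := (Set.Iio N).indicator (coord x)) fun i hi hi' =>
      Set.indicator_of_notMem (s := Set.Iio N)
        (fun h => hi' (Finset.mem_filter.2 ⟨hi, Finset.mem_range.2 h⟩)) _
  refine h1.trans ?_
  refine (Finset.sum_le_sum (g := fun i => ‖coord x i‖ ^ p) fun i _ => ?_).trans
    (Finset.sum_le_sum_of_subset_of_nonneg (fun i hi => (Finset.mem_filter.1 hi).2)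
      fun i _ _ => by positivity)
  refine (mul_le_of_le_one_right (by positivity) (weight_le_one hw _)).trans ?_
  exact Real.rpow_le_rpow (norm_nonneg _) (norm_indicator_le_norm_self _ _) hp.le

theorem tendsto_restrict_Iio_of_coord {u : ℕ → RGarling 𝕜 hw hp}
    (hu : ∀ i, Tendsto (fun j => coord (u j) i) atTop (𝓝 0)) (N : ℕ) :
    Tendsto (fun j => ‖restrict (Set.Iio N) (u j)‖) atTop (𝓝 0) := by
  have hP := max_pos p
  have h1 : Tendsto (fun j => ∑ i ∈ Finset.range N, ‖coord (u j) i‖ ^ p) atTop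
      (𝓝 (∑ i ∈ Finset.range N, ‖(0 : 𝕜)‖ ^ p)) :=
    tendsto_finsetSum _ fun i _ => (hu i).norm.rpow_const (Or.inr hp.le)
  rw [norm_zero, Real.zero_rpow hp.ne', Finset.sum_const_zero] at h1
  have h2 := h1.rpow_const (p := 1 / max p 1) (Or.inr (by positivity))
  rw [Real.zero_rpow (by positivity)] at h2
  refine squeeze_zero (fun j => norm_nonneg _) (fun j => ?_) h2
  have h3 := Real.rpow_le_rpow (by positivity) (norm_restrict_Iio_rpow_le N (u j))
    (by positivity : 0 ≤ 1 / max p 1)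
  rwa [← Real.rpow_mul (norm_nonneg _), mul_one_div_cancel hP.ne', Real.rpow_one] at h3

theorem norm_sub_restrict_Ico_le {m n : ℕ} (hmn : m ≤ n) (x : RGarling 𝕜 hw hp) :
    ‖x - restrict (Set.Ico m n) x‖ ≤ ‖restrict (Set.Iio m) x‖ + ‖restrict (Set.Ici n) x‖ := by
  have : x - restrict (Set.Ico m n) x = restrict (Set.Iio m) x + restrict (Set.Ici n) x := by
    apply coord_injective
    simp only [map_sub, map_add, coord_restrict]
    funext i
    simp only [Pi.sub_apply, Pi.add_apply, Set.indicator_apply, Set.mem_Ico, Set.mem_Iio,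
      Set.mem_Ici]
    rcases lt_or_ge i m with h1 | h1
    · have h2 : ¬ n ≤ i := by lia
      simp [h1, h1.not_ge, h2]
    · rcases lt_or_ge i n with h2 | h2
      · simp [h1, h2, h1.not_gt, h2.not_ge]
      · simp [h1, h2, h1.not_gt, h2.not_gt]
  rw [this]
  exact norm_add_le _ _

/-- Gliding hump: a coordinatewise null sequence has a subsequence that is close to blocks. -/
theorem exists_blocks_of_tendsto_coord {u : ℕ → RGarling 𝕜 hw hp}
    (hu : ∀ i, Tendsto (fun j => coord (u j) i) atTop (𝓝 0)) {ε : ℕ → ℝ} (hε : ∀ k, 0 < ε k)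
    (hεa : Antitone ε) : ∃ N ι : ℕ → ℕ, N 0 = 0 ∧ StrictMono N ∧
      (∀ k, ι k + 1 < ι (k + 1)) ∧
      ∀ k, ‖u (ι k) - restrict (Set.Ico (N k) (N (k + 1))) (u (ι k))‖ ≤ ε k := by
  have H : ∀ N, ∃ j ≥ N, ∃ m > N, j + 1 < m ∧ ‖u j - restrict (Set.Ico N m) (u j)‖ ≤ ε N := by
    intro N
    have h1 := (tendsto_restrict_Iio_of_coord hu N).eventually_lt_const (half_pos (hε N))
    obtain ⟨j, hj, hjN⟩ := (h1.and (eventually_ge_atTop N)).exists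
    have h2 := (tendsto_restrict_Ici (u j)).eventually_lt_const (half_pos (hε N))
    obtain ⟨m, hm, hmj⟩ := (h2.and (eventually_gt_atTop (j + 1))).exists
    refine ⟨j, hjN, m, by lia, hmj, ?_⟩
    have := norm_sub_restrict_Ico_le (m := N) (n := m) (by lia) (u j)
    linarith
  choose J hJ g hg hJg hle using H
  let N : ℕ → ℕ := fun k => g^[k] 0
  have hNs : ∀ k, N (k + 1) = g (N k) := fun k => Function.iterate_succ_apply' g k 0
  have hN : StrictMono N := strictMono_nat_of_lt_succ fun k => by rw [hNs]; exact hg _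
  refine ⟨N, fun k => J (N k), rfl, hN, fun k => ?_, fun k => ?_⟩
  · exact (hJg (N k)).trans_le (by rw [← hNs]; exact hJ _)
  · rw [hNs]
    exact (hle (N k)).trans (hεa hN.le_apply)

theorem isBlockSeq_restrict {N : ℕ → ℕ} (h0 : N 0 = 0) (hN : StrictMono N)
    (u : ℕ → RGarling 𝕜 hw hp) :
    IsBlockSeq N fun k => coord (restrict (Set.Ico (N k) (N (k + 1))) (u k)) where
  zero := h0
  strictMono := hN
  eq_zero_of_lt k i hi := by
    rw [coord_restrict]; exact Set.indicator_of_notMem (fun h => hi.not_ge h.1) _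
  eq_zero_of_ge k i hi := by
    rw [coord_restrict]; exact Set.indicator_of_notMem (fun h => hi.not_gt h.2) _

/-- A uniformly symmetric sequence is equivalent to a block sequence. -/
theorem exists_equivalent_blocks {B : ℕ → RGarling 𝕜 hw hp} {C : ℝ}
    (hB : IsUniformlySymmetric 𝕜 B C) :
    ∃ (q : ℕ → ℕ) (y : ℕ → RGarling 𝕜 hw hp) (c c' : ℝ), 0 < c ∧ 0 < c' ∧
      IsBlockSeq q (fun k => coord (y k)) ∧
      ∀ (s : Finset ℕ) (a : ℕ → 𝕜), c * ‖∑ j ∈ s, a j • B j‖ ≤ ‖∑ j ∈ s, a j • y j‖ ∧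
        ‖∑ j ∈ s, a j • y j‖ ≤ c' * ‖∑ j ∈ s, a j • B j‖ := by
  have hC := hB.pos
  have hr : 0 < min p 1 := lt_min hp one_pos
  have hB0 : 0 < ‖B 0‖ := norm_pos_iff.2 (hB.ne_zero 0)
  have hle : ∀ i j, ‖B i‖ ≤ C * ‖B j‖ := fun i j => by
    simpa using hB.relabel {0} 1 (fun _ => i) (fun _ => j) (by simp) (by simp)
  -- The coordinatewise limit `f` need not be zero; consecutive differences along the subsequence
  -- remove it.
  obtain ⟨φ, hφ, f, hf⟩ := exists_subseq_tendsto_coordinatewise (fun n => coord (B n))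
    (R := (C * ‖B 0‖) ^ (1 / min p 1)) fun n i => by
      have h1 := (norm_coord_rpow_min_le (B n) i).trans (hle n 0)
      have h2 := Real.rpow_le_rpow (by positivity) h1 (by positivity : 0 ≤ 1 / min p 1)
      rwa [← Real.rpow_mul (norm_nonneg _), mul_one_div_cancel hr.ne', Real.rpow_one] at h2
  have hu : ∀ i, Tendsto (fun j => coord (B (φ j) - B (φ (j + 1))) i) atTop (𝓝 0) := by
    intro i
    have := (hf i).sub ((hf i).comp (tendsto_add_atTop_nat 1))
    simpa using this
  -- Coefficients are bounded by `C ^ 2 / ‖B 0‖` times the norm of the sum, and the geometric series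
  -- sums to `2`. With this `δ` the perturbation is at most half of the lower bound `1 / C ^ 2` for
  -- the differences.
  set δ : ℝ := ‖B 0‖ / (4 * C ^ 4) with hδ
  have hδ0 : 0 < δ := by positivity
  obtain ⟨N, ι, hN0, hN, hι, hclose⟩ := exists_blocks_of_tendsto_coord hu
    (ε := fun k => δ * (1 / 2) ^ k) (fun k => by positivity) (fun k l hkl =>
      mul_le_mul_of_nonneg_left (pow_le_pow_of_le_one (by norm_num) (by norm_num) hkl) hδ0.le)
  have hι' : StrictMono ι := strictMono_nat_of_lt_succ fun k => by have := hι k; lia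
  -- The gap `ι k + 1 < ι (k + 1)` keeps the pairs forming the differences disjoint.
  have hne : ∀ i j, φ (ι i) ≠ φ (ι j + 1) := by
    intro i j hij
    have h1 := hφ.injective hij
    rcases le_or_gt i j with h2 | h2
    · have := hι'.monotone h2; lia
    · have := hι'.monotone (Nat.succ_le_of_lt h2)
      have := hι j; simp only [Nat.succ_eq_add_one] at *; lia
  set D : ℕ → RGarling 𝕜 hw hp := fun k => B (φ (ι k)) - B (φ (ι k + 1)) with hD
  have hdiff : ∀ (s : Finset ℕ) (a : ℕ → 𝕜),
      ‖∑ j ∈ s, a j • B j‖ ≤ C * C * ‖∑ j ∈ s, a j • D j‖ ∧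
        ‖∑ j ∈ s, a j • D j‖ ≤ 2 * C * ‖∑ j ∈ s, a j • B j‖ := fun s a =>
    hB.difference (hφ.injective.comp hι'.injective)
      (τ := fun k => φ (ι k + 1)) (fun k l hkl => hι'.injective (by
        have := hφ.injective hkl; lia)) hne s a
  refine ⟨N, fun k => restrict (Set.Ico (N k) (N (k + 1))) (D k), 1 / (2 * C ^ 2),
    2 * C + 1 / (2 * C ^ 2), by positivity, by positivity,
    isBlockSeq_restrict hN0 hN _, fun s a => ?_⟩
  set y : ℕ → RGarling 𝕜 hw hp := fun k => restrict (Set.Ico (N k) (N (k + 1))) (D k) with hy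
  obtain ⟨hd1, hd2⟩ := hdiff s a
  have hcoef : ∀ j ∈ s, ‖a j‖ ^ min p 1 ≤ C ^ 2 / ‖B 0‖ * ‖∑ j ∈ s, a j • B j‖ := by
    intro j hj
    have h1 := hB.subsum {j} s a (by simpa using hj)
    rw [Finset.sum_singleton, isHomogeneousNorm.norm_smul] at h1
    rw [div_mul_eq_mul_div, le_div_iff₀ hB0]
    calc ‖a j‖ ^ min p 1 * ‖B 0‖ ≤ ‖a j‖ ^ min p 1 * (C * ‖B j‖) := by gcongr; exact hle 0 j
      _ = C * (‖a j‖ ^ min p 1 * ‖B j‖) := by ring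
      _ ≤ C * (C * ‖∑ j ∈ s, a j • B j‖) := by gcongr
      _ = _ := by ring
  have hpert : ‖∑ j ∈ s, a j • D j - ∑ j ∈ s, a j • y j‖ ≤
      1 / (2 * C ^ 2) * ‖∑ j ∈ s, a j • B j‖ := by
    rw [← Finset.sum_sub_distrib]
    calc ‖∑ j ∈ s, (a j • D j - a j • y j)‖
        ≤ ∑ j ∈ s, C ^ 2 / ‖B 0‖ * ‖∑ j ∈ s, a j • B j‖ * (δ * (1 / 2) ^ j) := by
          refine norm_sum_le_of_le _ fun j hj => ?_
          rw [← smul_sub, isHomogeneousNorm.norm_smul]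
          exact mul_le_mul (hcoef j hj) (hclose j) (norm_nonneg _) (by positivity)
      _ = C ^ 2 / ‖B 0‖ * ‖∑ j ∈ s, a j • B j‖ * δ * ∑ j ∈ s, (1 / 2 : ℝ) ^ j := by
          rw [Finset.mul_sum]; exact Finset.sum_congr rfl fun j _ => by ring
      _ ≤ C ^ 2 / ‖B 0‖ * ‖∑ j ∈ s, a j • B j‖ * δ * 2 := by
          gcongr
          exact (summable_geometric_two.sum_le_tsum s fun j _ => by positivity).trans_eq
            tsum_geometric_two
      _ = _ := by rw [hδ]; field_simp; norm_num
  constructor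
  · have h1 := norm_sub_norm_le (∑ j ∈ s, a j • D j) (∑ j ∈ s, a j • y j)
    have h2 : 1 / C ^ 2 * ‖∑ j ∈ s, a j • B j‖ ≤ ‖∑ j ∈ s, a j • D j‖ := by
      rw [div_mul_eq_mul_div, one_mul, div_le_iff₀ (by positivity)]; linarith
    have h3 : 1 / C ^ 2 = 1 / (2 * C ^ 2) + 1 / (2 * C ^ 2) := by field_simp; norm_num
    rw [h3, add_mul] at h2
    linarith
  · have h1 := norm_sub_norm_le (∑ j ∈ s, a j • y j) (∑ j ∈ s, a j • D j)
    rw [norm_sub_rev] at h1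
    rw [add_mul]
    linarith

end RGarling

/-! ### Symmetric block sequences are equivalent to the unit vector basis of `ℓ_p` -/

namespace RGarling

variable {𝕜 : Type*} [RCLike 𝕜] {w : ℕ → ℝ} {p : ℝ} {hw : IsGarlingWeight w} {hp : 0 < p}

theorem coord_sum (G : Finset ℕ) (a : ℕ → 𝕜) (y : ℕ → RGarling 𝕜 hw hp) :
    coord (∑ k ∈ G, a k • y k) = ∑ k ∈ G, a k • coord (y k) := by
  simp only [map_sum, map_smul]

theorem norm_smul_rpow_max (c : 𝕜) (x : RGarling 𝕜 hw hp) :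
    ‖c • x‖ ^ max p 1 = ‖c‖ ^ p * ‖x‖ ^ max p 1 := by
  rw [isHomogeneousNorm.norm_smul, Real.mul_rpow (by positivity) (norm_nonneg _),
    rpow_min_rpow_max (norm_nonneg _)]

/-- Appending far to the right a vector with small coordinates adds almost all of its size. -/
theorem exists_garlingSum_append {Q Q' : ℕ} {A : Finset ℕ} {z : ℕ → 𝕜}
    {u : RGarling 𝕜 hw hp} {S c d : ℝ} (hA : A ⊆ Finset.range Q) (hQ : Q ≤ Q')
    (hz : ∀ i, Q ≤ i → z i = 0) (hu : ∀ i < Q, coord u i = 0) (hu' : ∀ i, Q' ≤ i → coord u i = 0)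
    (hS : ∀ i, ‖coord u i‖ ^ p ≤ S) (hd : d + Q * S < ‖u‖ ^ max p 1)
    (hc : c ≤ garlingSum w p A z) :
    ∃ B ⊆ Finset.range Q', c + d ≤ garlingSum w p B (z + coord u) := by
  obtain ⟨D, hD⟩ := exists_lt_garlingSum hd
  -- Giving up the first `Q` terms costs at most `Q * S` and makes room for `A`, which has at most
  -- `Q` elements.
  obtain ⟨E, -, hE⟩ := exists_garlingSum_le_shiftWeight (weight_le_one hw) hS D Q
  have hE' : d ≤ garlingSum (shiftWeight w Q) p (E.filter (· ∈ Finset.Ico Q Q')) (coord u) := by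
    refine le_trans (by linarith) (garlingSum_le_of_subset hp (shiftWeight_antitone hw.antitone Q)
      (Finset.filter_subset _ _) fun i hi hi' => ?_)
    by_contra h0
    refine hi' (Finset.mem_filter.2 ⟨hi, Finset.mem_Ico.2 ⟨?_, ?_⟩⟩)
    · by_contra! h; exact h0 (hu i h)
    · by_contra! h; exact h0 (hu' i h)
  set F := E.filter (· ∈ Finset.Ico Q Q') with hF
  have hFm : ∀ b ∈ F, Q ≤ b ∧ b < Q' := fun b hb => Finset.mem_Ico.1 (Finset.mem_filter.1 hb).2
  have hAm : ∀ a ∈ A, a < Q := fun a ha => Finset.mem_range.1 (hA ha)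
  have hcard : A.card ≤ Q := by simpa using Finset.card_le_card hA
  refine ⟨A ∪ F, Finset.union_subset (fun a ha => Finset.mem_range.2 ((hAm a ha).trans_le hQ))
    fun b hb => Finset.mem_range.2 (hFm b hb).2, ?_⟩
  rw [garlingSum_union fun a ha b hb => (hAm a ha).trans_le (hFm b hb).1]
  refine add_le_add (hc.trans (le_of_eq (garlingSum_congr fun i hi => ?_))) (hE'.trans ?_)
  · rw [Pi.add_apply, hu i (hAm i hi), add_zero]
  · rw [garlingSum_congr (x := z + coord u) (y := coord u) fun i hi => by
      rw [Pi.add_apply, hz i (hFm i hi).1, zero_add]]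
    exact garlingSum_le_of_weight_le (shiftWeight_le_shiftWeight hw.antitone hcard) _ _

/-- Prepending a vector with small coordinates to a vector that loses most of its size under a
shift of the weight. -/
theorem garlingSum_prepend_le {Q M : ℕ} {u z : ℕ → 𝕜} {S U V T : ℝ} (hw : IsGarlingWeight w)
    (hu : ∀ i, Q ≤ i → u i = 0) (hz : ∀ i < Q, z i = 0)
    (hS : ∀ i, ‖u i‖ ^ p ≤ S) (hU : ∀ A, garlingSum w p A u ≤ U)
    (hV : ∀ A, garlingSum w p A z ≤ V) (hT : ∀ A, garlingSum (shiftWeight w M) p A z ≤ T)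
    (A : Finset ℕ) : garlingSum w p A (u + z) ≤ max (M * S + V) (U + T) := by
  have hS0 : 0 ≤ S := le_trans (by positivity) (hS 0)
  have hA : A = A.filter (· < Q) ∪ A.filter (fun i => ¬ i < Q) :=
    (Finset.filter_union_filter_not_eq _ _).symm
  have h1 := garlingSum_union (w := w) (p := p) (A := A.filter (· < Q))
    (B := A.filter (fun i => ¬ i < Q)) (fun a ha b hb => by
      have := (Finset.mem_filter.1 ha).2
      have := (Finset.mem_filter.1 hb).2
      lia) (u + z)
  rw [← hA] at h1
  set A₁ := A.filter (· < Q)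
  set A₂ := A.filter (fun i => ¬ i < Q)
  rw [garlingSum_congr (A := A₁) (y := u) fun i hi => by
      rw [Pi.add_apply, hz i (Finset.mem_filter.1 hi).2, add_zero],
    garlingSum_congr (A := A₂) (y := z) fun i hi => by
      rw [Pi.add_apply, hu i (not_lt.1 (Finset.mem_filter.1 hi).2), zero_add]] at h1
  rw [h1]
  -- If `A` has at most `M` indices in the flat part, they contribute at most `M * S`; if it has at
  -- least `M`, the later part only receives weights shifted by `M`.
  rcases le_total A₁.card M with hM | hM
  · refine le_max_of_le_left (add_le_add ?_ ?_)
    · refine (garlingSum_le_card_mul (weight_le_one hw) hS).trans ?_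
      gcongr
    · refine le_trans ?_ (hV A₂)
      exact garlingSum_le_of_weight_le (fun j => hw.antitone (Nat.le_add_right j _)) _ _
  · refine le_max_of_le_right (add_le_add (hU _) ?_)
    refine le_trans ?_ (hT A₂)
    exact garlingSum_le_of_weight_le (shiftWeight_le_shiftWeight hw.antitone hM) _ _

variable {q : ℕ → ℕ} {y : ℕ → RGarling 𝕜 hw hp} {C : ℝ}

theorem norm_rpow_max_le_mul {x z : RGarling 𝕜 hw hp} (hC : 0 ≤ C) (h : ‖x‖ ≤ C * ‖z‖) :
    ‖x‖ ^ max p 1 ≤ C ^ max p 1 * ‖z‖ ^ max p 1 := by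
  rw [← Real.mul_rpow hC (norm_nonneg _)]
  exact Real.rpow_le_rpow (norm_nonneg _) h (max_pos p).le

theorem upper_estimate (hy : IsBlockSeq q fun k => coord (y k)) {S : ℝ}
    (hS : ∀ k, ‖y k‖ ^ max p 1 ≤ S) (s : Finset ℕ) (a : ℕ → 𝕜) :
    ‖∑ j ∈ s, a j • y j‖ ^ max p 1 ≤ S * ∑ j ∈ s, ‖a j‖ ^ p := by
  refine norm_rpow_le fun A => ?_
  rw [coord_sum, hy.garlingSum_sum hp A s a (fun j => j) Function.injective_id.injOn,
    Finset.mul_sum]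
  refine Finset.sum_le_sum fun j _ => ?_
  rw [mul_comm]
  exact mul_le_mul_of_nonneg_right ((garlingSum_le A _).trans (hS j)) (by positivity)

/-- Under a uniform decay of the blocks along shifts of the weight, the block sequence is not
symmetric: compare sums of rapidly growing averages in their order and in the reversed order. -/
theorem not_isUniformlySymmetric_of_shift_decay (hy : IsBlockSeq q fun k => coord (y k))
    (hdec : ∀ η > 0, ∃ M k₀ : ℕ, ∀ k ≥ k₀, ∀ A,
      garlingSum (shiftWeight w M) p A (coord (y k)) < η) : ¬ IsUniformlySymmetric 𝕜 y C := by
  intro hC'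
  have hC := hC'.pos
  have hP := max_pos p
  set P := max p 1 with hPdef
  have hy0 : ∀ k, 0 < ‖y k‖ := fun k => norm_pos_iff.2 (hC'.ne_zero k)
  have hle : ∀ i j, ‖y i‖ ≤ C * ‖y j‖ := fun i j => by
    simpa using hC'.relabel {0} 1 (fun _ => i) (fun _ => j) (by simp) (by simp)
  -- bounds for the blocks and for their sums
  set S := C ^ P * ‖y 0‖ ^ P with hS
  have hS0 : 0 < S := by have := hy0 0; positivity
  have hyS : ∀ k i, ‖coord (y k) i‖ ^ p ≤ S := fun k i =>
    (norm_coord_rpow_le _ _).trans (norm_rpow_max_le_mul hC.le (hle k 0))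
  set β : ℕ → ℝ := fun n => ‖∑ k ∈ Finset.range n, y k‖ ^ P with hβ
  have hsum1 : ∀ s : Finset ℕ, ∑ k ∈ s, (1 : ℕ → 𝕜) k • y k = ∑ k ∈ s, y k := fun s => by simp
  -- By the subsum bound `κ` is a lower bound for `β n` when `n > 0`, so the coefficients introduced
  -- below have `p`-th powers at most `κ⁻¹`.
  set κ := (‖y 0‖ / C) ^ P with hκ
  have hκ0 : 0 < κ := by have := hy0 0; positivity
  have hβκ : ∀ n, 0 < n → κ ≤ β n := by
    intro n hn
    refine Real.rpow_le_rpow (by positivity) ?_ hP.le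
    have := hC'.subsum {0} (Finset.range n) 1 (by simpa using hn)
    rw [hsum1, hsum1, Finset.sum_singleton] at this
    rwa [div_le_iff₀' hC]
  have hβ0 : ∀ n, 0 < n → 0 < β n := fun n hn => hκ0.trans_le (hβκ n hn)
  have hunb : ∀ D, ∃ n, ∀ m ≥ n, D ≤ β m := by
    intro D
    have hc : 0 < (‖y 0‖ / C) ^ P / 2 := by have := hy0 0; positivity
    obtain ⟨n, hn⟩ := hy.exists_le_garlingSum_sum hp hw hc (fun k => by
      obtain ⟨A, hA⟩ := exists_lt_garlingSum (x := y k) (c := (‖y 0‖ / C) ^ P / 2)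
        ((half_lt_self (by linarith)).trans_le (Real.rpow_le_rpow (by positivity)
          ((div_le_iff₀' hC).2 (hle 0 k)) hP.le))
      exact ⟨A, hA.le⟩) D
    refine ⟨n, fun m hm => ?_⟩
    obtain ⟨A, hA⟩ := hn m hm
    refine hA.trans ((le_of_eq ?_).trans (garlingSum_le A (∑ k ∈ Finset.range m, y k)))
    rw [map_sum]
  -- the sizes of the groups
  choose M k₀ hM using fun m : ℕ => hdec (κ / (m + 1)) (by positivity)
  set c₀ := (C ^ P)⁻¹ with hc₀
  have hc₀0 : 0 < c₀ := by positivity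
  -- As `β` is unbounded, a long enough group is as flat as required. The first condition serves the
  -- given order, where `q m` positions may already be taken; the second serves the reversed order,
  -- where `M m` terms must be negligible.
  have hsize : ∀ m, ∃ m' > m, q m * (S / β (m' - m)) ≤ c₀ / 4 ∧
      M m * (S / β (m' - m)) ≤ (1 / 2) ^ m := by
    intro m
    obtain ⟨n, hn⟩ := hunb (q m * S / (c₀ / 4) + M m * S / (1 / 2) ^ m)
    have h1 := hn (n + 1) (by lia)
    have h2 : 0 ≤ q m * S / (c₀ / 4) := by positivity
    have h3 : 0 ≤ M m * S / (1 / 2) ^ m := by positivity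
    have h4 := hβ0 (n + 1) (by lia)
    refine ⟨m + (n + 1), by lia, ?_, ?_⟩
    · rw [Nat.add_sub_cancel_left, ← mul_div_assoc, div_le_comm₀ h4 (by positivity)]; linarith
    · rw [Nat.add_sub_cancel_left, ← mul_div_assoc, div_le_comm₀ h4 (by positivity)]; linarith
  choose g hg hgq hgM using hsize
  let m : ℕ → ℕ := fun i => g^[i] 0
  have hms : ∀ i, m (i + 1) = g (m i) := fun i => Function.iterate_succ_apply' g i 0
  have hm : StrictMono m := strictMono_nat_of_lt_succ fun i => by rw [hms]; exact hg _
  set n : ℕ → ℕ := fun i => m (i + 1) - m i with hn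
  have hn0 : ∀ i, 0 < n i := fun i => Nat.sub_pos_of_lt (hm (Nat.lt_succ_self i))
  have hnq : ∀ i, q (m i) * (S / β (n i)) ≤ c₀ / 4 := fun i => by
    simp only [hn, hms]; exact hgq _
  have hnM : ∀ i, M (m i) * (S / β (n i)) ≤ (1 / 2) ^ i := fun i => by
    simp only [hn, hms]
    exact (hgM _).trans (pow_le_pow_of_le_one (by norm_num) (by norm_num) hm.le_apply)
  -- the coefficients
  choose ι hι1 hι2 using exists_mem_interval (q := m) rfl hm
  have hιeq : ∀ i, ∀ k ∈ Finset.Ico (m i) (m (i + 1)), ι k = i := fun i k hk =>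
    interval_unique hm (hι1 k) (hι2 k) (Finset.mem_Ico.1 hk).1 (Finset.mem_Ico.1 hk).2
  let c : ℕ → 𝕜 := fun i => (((β (n i))⁻¹ ^ (1 / p) : ℝ) : 𝕜)
  have hcn : ∀ i, ‖c i‖ ^ p = (β (n i))⁻¹ := fun i => by
    have := hβ0 _ (hn0 i)
    rw [RCLike.norm_ofReal, abs_of_nonneg (by positivity), ← Real.rpow_mul (by positivity),
      one_div_mul_cancel hp.ne', Real.rpow_one]
  set α : ℕ → 𝕜 := fun k => c (ι k) with hα
  have hαn : ∀ k, ‖α k‖ ^ p ≤ κ⁻¹ := fun k => by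
    rw [hα, hcn]; exact inv_anti₀ hκ0 (hβκ _ (hn0 _))
  have hgroup : ∀ (i : ℕ) (v : ℕ → RGarling 𝕜 hw hp),
      ∑ k ∈ Finset.Ico (m i) (m (i + 1)), α k • v k =
        c i • ∑ k ∈ Finset.Ico (m i) (m (i + 1)), v k := fun i v => by
    rw [Finset.smul_sum]
    exact Finset.sum_congr rfl fun k hk => by rw [hα]; simp only [hιeq i k hk]
  have hgroupn : ∀ (i : ℕ) (σ : ℕ → ℕ), Set.InjOn σ (Finset.Ico (m i) (m (i + 1))) →
      ‖∑ k ∈ Finset.Ico (m i) (m (i + 1)), y (σ k)‖ ^ P ≤ C ^ P * β (n i) ∧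
        β (n i) ≤ C ^ P * ‖∑ k ∈ Finset.Ico (m i) (m (i + 1)), y (σ k)‖ ^ P := by
    intro i σ hσ
    have h1 : ∑ k ∈ Finset.Ico (m i) (m (i + 1)), y (k - m i) =
        ∑ k ∈ Finset.range (n i), y k := by
      rw [Finset.sum_Ico_eq_sum_range]; simp [hn]
    have hτ : Set.InjOn (fun k => k - m i) (Finset.Ico (m i) (m (i + 1))) := by
      intro k hk l hl hkl
      simp only [Finset.coe_Ico, Set.mem_Ico] at hk hl hkl; lia
    have h2 := hC'.relabel _ 1 σ _ hσ hτ
    have h3 := hC'.relabel _ 1 _ σ hτ hσ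
    simp only [Pi.one_apply, one_smul, h1] at h2 h3
    exact ⟨norm_rpow_max_le_mul hC.le h2, norm_rpow_max_le_mul hC.le h3⟩
  have hgroupN : ∀ (i : ℕ) (σ : ℕ → ℕ), Set.InjOn σ (Finset.Ico (m i) (m (i + 1))) →
      ‖∑ k ∈ Finset.Ico (m i) (m (i + 1)), α k • y (σ k)‖ ^ P ≤ C ^ P ∧
        c₀ ≤ ‖∑ k ∈ Finset.Ico (m i) (m (i + 1)), α k • y (σ k)‖ ^ P := by
    intro i σ hσ
    obtain ⟨h1, h2⟩ := hgroupn i σ hσ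
    have h3 := hβ0 _ (hn0 i)
    rw [hgroup i fun k => y (σ k), norm_smul_rpow_max, hcn]
    constructor
    · rw [inv_mul_le_iff₀ h3]; linarith
    · rw [hc₀, inv_mul_eq_div, le_div_iff₀ h3, inv_mul_le_iff₀ (by positivity)]; exact h2
  have hgroupS : ∀ (i : ℕ) (σ : ℕ → ℕ), Set.InjOn σ (Finset.Ico (m i) (m (i + 1))) → ∀ j,
      ‖coord (∑ k ∈ Finset.Ico (m i) (m (i + 1)), α k • y (σ k)) j‖ ^ p ≤ S / β (n i) := by
    intro i σ hσ j
    have h3 := hβ0 _ (hn0 i)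
    rw [hgroup i fun k => y (σ k), map_smul, Pi.smul_apply, smul_eq_mul, norm_mul,
      Real.mul_rpow (norm_nonneg _) (norm_nonneg _), hcn, inv_mul_eq_div]
    gcongr
    by_cases h0 : coord (∑ k ∈ Finset.Ico (m i) (m (i + 1)), y (σ k)) j = 0
    · rw [h0, norm_zero, Real.zero_rpow hp.ne']; exact hS0.le
    rw [map_sum, Finset.sum_apply] at h0 ⊢
    obtain ⟨k, hk, hkj⟩ := Finset.exists_ne_zero_of_sum_ne_zero h0
    rw [Finset.sum_eq_single_of_mem k hk fun l hl hlk => ?_]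
    · exact hyS _ _
    · exact (hy.disjoint (k := σ k) (l := σ l) (fun e => hlk (hσ hl hk e.symm)) j).resolve_left hkj
  -- lower bound in the given order
  have hforward : ∀ K : ℕ, K * (c₀ / 2) ≤
      ‖∑ k ∈ Finset.range (m K), α k • y k‖ ^ P := by
    intro K
    suffices ∃ A ⊆ Finset.range (q (m K)), K * (c₀ / 2) ≤
        garlingSum w p A (coord (∑ k ∈ Finset.range (m K), α k • y k)) by
      obtain ⟨A, -, hA⟩ := this
      exact hA.trans (garlingSum_le A _)
    induction K with
    | zero => exact ⟨∅, by simp, by simp⟩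
    | succ K ih =>
      obtain ⟨A, hA, hAc⟩ := ih
      have hmK := hm (Nat.lt_succ_self K)
      have hid : Set.InjOn (fun k : ℕ => k) (Finset.Ico (m K) (m (K + 1))) :=
        Function.injective_id.injOn
      -- The group has size at least `c₀`, and flatness limits the cost of the positions already
      -- taken to `c₀ / 4`, so at least `c₀ / 2` is gained.
      obtain ⟨B, hB, hBc⟩ := exists_garlingSum_append (d := c₀ / 2) hA
        (hy.strictMono.monotone hmK.le)
        (u := ∑ k ∈ Finset.Ico (m K) (m (K + 1)), α k • y k)
        (fun i hi => by
          rw [coord_sum, Finset.sum_apply]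
          refine Finset.sum_eq_zero fun k hk => ?_
          rw [Pi.smul_apply, hy.eq_zero_of_ge k i ((hy.strictMono.monotone
            (Nat.succ_le_of_lt (Finset.mem_range.1 hk))).trans hi), smul_zero])
        (fun i hi => by
          rw [coord_sum, Finset.sum_apply]
          refine Finset.sum_eq_zero fun k hk => ?_
          rw [Pi.smul_apply, hy.eq_zero_of_lt k i (hi.trans_le (hy.strictMono.monotone
            (Finset.mem_Ico.1 hk).1)), smul_zero])
        (fun i hi => by
          rw [coord_sum, Finset.sum_apply]
          refine Finset.sum_eq_zero fun k hk => ?_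
          rw [Pi.smul_apply, hy.eq_zero_of_ge k i ((hy.strictMono.monotone
            (Nat.succ_le_of_lt (Finset.mem_Ico.1 hk).2)).trans hi), smul_zero])
        (hgroupS K (fun k => k) hid)
        (by linarith [hnq K, (hgroupN K (fun k => k) hid).2]) hAc
      refine ⟨B, hB, ?_⟩
      rw [← map_add, Finset.range_eq_Ico, Finset.sum_Ico_consecutive _ (Nat.zero_le _) hmK.le,
        ← Finset.range_eq_Ico] at hBc
      push_cast
      linarith
  -- upper bound in the reversed order
  have hbackward : ∀ K : ℕ, ∃ σ : ℕ → ℕ, Set.InjOn σ (Finset.range (m K)) ∧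
      ‖∑ k ∈ Finset.range (m K), α k • y (σ k)‖ ^ P ≤ C ^ P + 1 + 2 := by
    intro K
    -- The reversed copy is moved to the right by `L` so that every block used is late enough for
    -- the decay estimates of all `K` groups.
    set L := (Finset.range K).sup fun i => k₀ (m i) with hL
    have hLk : ∀ i < K, k₀ (m i) ≤ L := fun i hi =>
      Finset.le_sup (f := fun i => k₀ (m i)) (Finset.mem_range.2 hi)
    set σ : ℕ → ℕ := fun k => L + (m K - 1 - k) with hσ
    have hσinj : Set.InjOn σ (Finset.range (m K)) := by
      intro k hk l hl hkl
      simp only [Finset.coe_range, Set.mem_Iio, hσ] at hk hl hkl; lia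
    refine ⟨σ, hσinj, ?_⟩
    have key : ∀ i ≤ K, ∀ A, garlingSum w p A (coord (∑ k ∈ Finset.range (m i), α k • y (σ k))) ≤
        C ^ P + 1 + ∑ l ∈ Finset.range i, (1 / 2 : ℝ) ^ l := by
      intro i
      induction i with
      | zero =>
        intro _ A
        have : m 0 = 0 := rfl
        simp only [this, Finset.range_zero, Finset.sum_empty, map_zero]
        have h0 : garlingSum w p A (0 : ℕ → 𝕜) = 0 := by
          simp [garlingSum, Real.zero_rpow hp.ne']
        rw [h0]
        positivity
      | succ i ih =>
        intro hiK A
        have hmi := hm (Nat.lt_succ_self i)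
        have hmiK : m (i + 1) ≤ m K := hm.monotone hiK
        have hinj' : Set.InjOn σ (Finset.Ico (m i) (m (i + 1))) := hσinj.mono fun k hk => by
          simp only [Finset.coe_Ico, Set.mem_Ico, Finset.coe_range, Set.mem_Iio] at hk ⊢; lia
        -- In the reversed order the `i`-th group lies to the left of all earlier groups; it either
        -- adds at most `(1 / 2) ^ i` or reduces the earlier groups to at most `T = 1`.
        have h1 := garlingSum_prepend_le (Q := q (L + (m K - m i))) (M := M (m i)) hw
          (u := coord (∑ k ∈ Finset.Ico (m i) (m (i + 1)), α k • y (σ k)))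
          (z := coord (∑ k ∈ Finset.range (m i), α k • y (σ k))) (T := 1)
          (fun j hj => by
            rw [map_sum, Finset.sum_apply]
            refine Finset.sum_eq_zero fun k hk => ?_
            have hk' := Finset.mem_Ico.1 hk
            rw [map_smul, Pi.smul_apply, hy.eq_zero_of_ge (σ k) j ((hy.strictMono.monotone
              (by simp only [hσ]; lia)).trans hj), smul_zero])
          (fun j hj => by
            rw [map_sum, Finset.sum_apply]
            refine Finset.sum_eq_zero fun k hk => ?_
            have hk' := Finset.mem_range.1 hk
            rw [map_smul, Pi.smul_apply, hy.eq_zero_of_lt (σ k) j (hj.trans_le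
              (hy.strictMono.monotone (by simp only [hσ]; lia))), smul_zero])
          (hgroupS i σ hinj')
          (fun A => (garlingSum_le A _).trans (hgroupN i σ hinj').1)
          (ih (by lia)) (fun A => ?_) A
        · rw [← map_add, add_comm, Finset.range_eq_Ico,
            Finset.sum_Ico_consecutive _ (Nat.zero_le _) hmi.le, ← Finset.range_eq_Ico] at h1
          refine h1.trans (max_le ?_ ?_)
          · rw [Finset.sum_range_succ]; linarith [hnM i]
          · have : 0 ≤ ∑ l ∈ Finset.range (i + 1), (1 / 2 : ℝ) ^ l :=
              Finset.sum_nonneg fun _ _ => by positivity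
            linarith
        · simp only [map_sum, map_smul]
          rw [hy.garlingSum_sum hp A _ α σ (hσinj.mono fun k hk => by
            simp only [Finset.coe_range, Set.mem_Iio] at hk ⊢; lia)]
          -- The tolerance `κ / (m + 1)` in the choice of the shifts is used here: `m i` blocks with
          -- coefficients at most `κ⁻¹` total at most one.
          have h2 : ∀ k ∈ Finset.range (m i), ‖α k‖ ^ p *
              garlingSum (shiftWeight w (M (m i))) p A (coord (y (σ k))) ≤
                κ⁻¹ * (κ / (m i + 1)) := fun k hk =>
            mul_le_mul (hαn k) (hM (m i) (σ k) ((hLk i (by lia)).trans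
              (Nat.le_add_right _ _)) A).le
              (garlingSum_nonneg (shiftWeight_nonneg (weight_nonneg hw) _) _ _) (by positivity)
          refine (Finset.sum_le_sum h2).trans ?_
          rw [Finset.sum_const, Finset.card_range, nsmul_eq_mul, inv_mul_eq_div, div_right_comm,
            div_self hκ0.ne', mul_one_div, div_le_one (by positivity)]
          linarith
    refine norm_rpow_le fun A => (key K le_rfl A).trans ?_
    gcongr
    exact (summable_geometric_two.sum_le_tsum _ fun j _ => by positivity).trans_eq
      tsum_geometric_two
  -- For large `K` the linear growth in the given order exceeds `C ^ P` times the bound in the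
  -- reversed order.
  obtain ⟨K, hK⟩ := exists_nat_gt (C ^ P * (C ^ P + 1 + 2) / (c₀ / 2))
  obtain ⟨σ, hσ, hle'⟩ := hbackward K
  have h1 := norm_rpow_max_le_mul hC.le (hC'.relabel (Finset.range (m K)) α (fun k => k) σ
    Function.injective_id.injOn hσ)
  have h2 := hforward K
  rw [div_lt_iff₀ (by positivity)] at hK
  have h3 : C ^ P * ‖∑ k ∈ Finset.range (m K), α k • y (σ k)‖ ^ P ≤
      C ^ P * (C ^ P + 1 + 2) := by gcongr
  linarith

/-- The finite linear combinations of `x` have the size of their coefficients in `ℓ_p`. -/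
def HasLpEstimate (x : ℕ → RGarling 𝕜 hw hp) (c c' : ℝ) : Prop :=
  ∀ (s : Finset ℕ) (a : ℕ → 𝕜), c * ∑ j ∈ s, ‖a j‖ ^ p ≤ ‖∑ j ∈ s, a j • x j‖ ^ max p 1 ∧
    ‖∑ j ∈ s, a j • x j‖ ^ max p 1 ≤ c' * ∑ j ∈ s, ‖a j‖ ^ p

theorem lower_estimate_of_range {x : ℕ → RGarling 𝕜 hw hp} {c : ℝ} (hp : 0 < p)
    (h : ∀ (a : ℕ → 𝕜) (n : ℕ), c * ∑ j ∈ Finset.range n, ‖a j‖ ^ p ≤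
      ‖∑ j ∈ Finset.range n, a j • x j‖ ^ max p 1) (s : Finset ℕ) (a : ℕ → 𝕜) :
    c * ∑ j ∈ s, ‖a j‖ ^ p ≤ ‖∑ j ∈ s, a j • x j‖ ^ max p 1 := by
  have h1 := h (fun j => if j ∈ s then a j else 0) (s.sup id + 1)
  have hs : s ⊆ Finset.range (s.sup id + 1) := fun j hj =>
    Finset.mem_range.2 (Nat.lt_succ_of_le (Finset.le_sup (f := id) hj))
  rw [← Finset.sum_subset hs fun j _ hj => by simp [hj, Real.zero_rpow hp.ne'],
    ← Finset.sum_subset hs fun j _ hj => by simp [hj]] at h1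
  rwa [Finset.sum_congr (g := fun j => ‖a j‖ ^ p) rfl fun j hj => by rw [if_pos hj],
    Finset.sum_congr (g := fun j => a j • x j) rfl fun j hj => by rw [if_pos hj]] at h1

/-- The upper estimate is automatic. For the lower one, blocks that resist shifts have a good
subsequence, which symmetry transfers to the whole sequence; blocks that do not resist them cannot
be symmetric. -/
theorem hasLpEstimate_of_blocks (hy : IsBlockSeq q fun k => coord (y k))
    (hC' : IsUniformlySymmetric 𝕜 y C) : ∃ c c', 0 < c ∧ HasLpEstimate y c c' := by
  have hC := hC'.pos
  have hup := upper_estimate hy (S := C ^ max p 1 * ‖y 0‖ ^ max p 1) fun k =>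
    norm_rpow_max_le_mul hC.le (by
      simpa using hC'.relabel {0} 1 (fun _ => k) (fun _ => 0) (by simp) (by simp))
  by_cases H : ∃ η > 0, ∀ M k₀ : ℕ, ∃ k ≥ k₀, ∃ A,
      η ≤ garlingSum (shiftWeight w M) p A (coord (y k))
  · obtain ⟨η, hη, H⟩ := H
    obtain ⟨s, hs, hsη⟩ := hy.exists_lower_estimate hp hw.antitone H
    refine ⟨η / C ^ max p 1, _, by positivity, fun t a =>
      ⟨lower_estimate_of_range hp (fun a n => ?_) t a, hup t a⟩⟩
    obtain ⟨A, hA⟩ := hsη a n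
    have h1 : garlingSum w p A (∑ i ∈ Finset.range n, a i • coord (y (s i))) ≤
        ‖∑ i ∈ Finset.range n, a i • y (s i)‖ ^ max p 1 := by
      rw [← coord_sum _ _ fun i => y (s i)]; exact garlingSum_le A _
    have h2 := norm_rpow_max_le_mul hC.le (hC'.relabel (Finset.range n) a s (fun k => k)
      hs.injective.injOn Function.injective_id.injOn)
    rw [div_mul_eq_mul_div, div_le_iff₀' (by positivity)]
    linarith
  · push Not at H
    exact absurd hC' (not_isUniformlySymmetric_of_shift_decay hy H)

/-- Uniformly symmetric sequences in `g(w, p)` are equivalent to the unit vectors of `ℓ_p`. -/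
theorem _root_.IsUniformlySymmetric.hasLpEstimate {B : ℕ → RGarling 𝕜 hw hp}
    (hB : IsUniformlySymmetric 𝕜 B C) : ∃ c c', 0 < c ∧ HasLpEstimate B c c' := by
  obtain ⟨q, y, d, d', hd, hd', hy, hyB⟩ := exists_equivalent_blocks hB
  obtain ⟨c, c', hc, hyc⟩ := hasLpEstimate_of_blocks hy (hB.of_equivalent hd hd' hyB)
  refine ⟨c / d' ^ max p 1, (1 / d) ^ max p 1 * c', by positivity, fun s a => ?_⟩
  obtain ⟨h1, h2⟩ := hyc s a
  have h3 := norm_rpow_max_le_mul hd'.le (hyB s a).2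
  have h4 := norm_rpow_max_le_mul (C := 1 / d) (by positivity) (x := ∑ j ∈ s, a j • B j)
    (z := ∑ j ∈ s, a j • y j) (by
      rw [div_mul_eq_mul_div, one_mul, le_div_iff₀' hd]; exact (hyB s a).1)
  constructor
  · rw [div_mul_eq_mul_div, div_le_iff₀' (by positivity)]; linarith
  · rw [mul_assoc]
    exact h4.trans (mul_le_mul_of_nonneg_left h2 (by positivity))

end RGarling

/-! ### Consequences of the equivalence with the unit vector basis of `ℓ_p` -/

/-- A series along the unit vector basis of `ℓ_p` converges iff its coefficients are in `ℓ_p`. -/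
theorem seriesConverges_lpUnitVectorBasis_iff {𝕜 : Type*} [RCLike 𝕜] {p : ℝ} (hp : 0 < p)
    (a : ℕ → 𝕜) :
    SeriesConverges a (lpUnitVectorBasis 𝕜 p) ↔ Summable fun j => ‖a j‖ ^ p := by
  have hpr : (ENNReal.ofReal p).toReal = p := ENNReal.toReal_ofReal hp.le
  have hpr0 : 0 < (ENNReal.ofReal p).toReal := by rwa [hpr]
  have hp0 : ENNReal.ofReal p ≠ 0 := by simpa using hp
  have hsm : ∀ j, a j • lpUnitVectorBasis 𝕜 p j =
      lp.single (E := fun _ => 𝕜) (ENNReal.ofReal p) j (a j) := fun j => by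
    rw [lpUnitVectorBasis, ← lp.single_smul, smul_eq_mul, mul_one]
  constructor
  · rintro ⟨s, hs⟩
    have hsa : ∀ i, s i = a i := by
      intro i
      have h1 : Tendsto (fun _ : ℕ => ‖s i - a i‖) atTop (𝓝 0) := by
        refine squeeze_zero' (Eventually.of_forall fun _ => norm_nonneg _) ?_ hs
        filter_upwards [eventually_gt_atTop i] with n hn
        have h2 := lp.norm_apply_le_norm hp0
          (s - ∑ j ∈ Finset.range n, a j • lpUnitVectorBasis 𝕜 p j) i
        refine le_trans (le_of_eq ?_) h2
        congr 1
        simp only [hsm]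
        rw [lp.coeFn_sub, Pi.sub_apply, lp.coeFn_sum, Finset.sum_apply,
          Finset.sum_eq_single_of_mem i (Finset.mem_range.2 hn) fun j _ hj =>
            lp.single_apply_ne _ _ _ hj.symm, lp.single_apply_self]
      have h2 := tendsto_nhds_unique h1 tendsto_const_nhds
      exact sub_eq_zero.1 (norm_eq_zero.1 h2.symm)
    have h1 := (lp.memℓp s).summable hpr0
    simpa only [hsa, hpr] using h1
  · intro h
    have hmem : Memℓp (E := fun _ : ℕ => 𝕜) a (ENNReal.ofReal p) :=
      memℓp_gen (by simpa only [hpr] using h)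
    let s : lp (fun _ : ℕ => 𝕜) (ENNReal.ofReal p) := ⟨a, hmem⟩
    refine ⟨s, ?_⟩
    have h1 := (lp.hasSum_norm hpr0 s).tendsto_sum_nat
    have h2 : Tendsto (fun n => ‖s - ∑ j ∈ Finset.range n,
        a j • lpUnitVectorBasis 𝕜 p j‖ ^ p) atTop (𝓝 0) := by
      have h3 := (tendsto_const_nhds (x := ‖s‖ ^ (ENNReal.ofReal p).toReal)).sub h1
      rw [sub_self] at h3
      refine h3.congr fun n => ?_
      rw [← lp.norm_compl_sum_single hpr0 s, hpr]
      simp only [hsm, s]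
    have h3 := h2.rpow_const (p := 1 / p) (Or.inr (by positivity))
    rw [Real.zero_rpow (by positivity)] at h3
    refine h3.congr fun n => ?_
    rw [← Real.rpow_mul (lp.norm_nonneg' _), mul_one_div_cancel hp.ne', Real.rpow_one]

/-! ### Existence of a symmetric basic sequence and absence of a symmetric basis -/

namespace RGarling

variable {𝕜 : Type*} [RCLike 𝕜] {w : ℕ → ℝ} {p : ℝ} {hw : IsGarlingWeight w} {hp : 0 < p}

theorem HasLpEstimate.comp_perm {x : ℕ → RGarling 𝕜 hw hp} {c c' : ℝ} (h : HasLpEstimate x c c')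
    (π : Equiv.Perm ℕ) : HasLpEstimate (fun j => x (π j)) c c' := by
  intro s a
  have h1 := h (s.map π.toEmbedding) fun i => a (π.symm i)
  simpa [Finset.sum_map] using h1

/-- The lower estimate bounds the sums of coefficients by the bounded partial sums; the upper one
gives the Cauchy criterion for unconditional summability. -/
theorem HasLpEstimate.seriesConverges_iff {x : ℕ → RGarling 𝕜 hw hp} {c c' : ℝ}
    (h : HasLpEstimate x c c') (hc : 0 < c) (a : ℕ → 𝕜) :
    SeriesConverges a x ↔ Summable fun j => ‖a j‖ ^ p := by
  have hP := max_pos p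
  have hc' : 0 < c' := by
    have h1 := h {0} 1
    simp only [Finset.sum_singleton, Pi.one_apply, norm_one, Real.one_rpow, mul_one] at h1
    linarith
  constructor
  · rintro ⟨s, hs⟩
    have h1 := ((seriesTendsto_iff.1 hs).norm.rpow_const (p := max p 1) (Or.inr hP.le))
    obtain ⟨R, hR⟩ := h1.bddAbove_range
    refine summable_of_sum_range_le (c := R / c) (fun j => by positivity) fun n => ?_
    rw [le_div_iff₀' hc]
    exact (h (Finset.range n) a).1.trans (hR ⟨n, rfl⟩)
  · intro hs
    have h1 : Summable fun j => a j • x j := by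
      rw [summable_iff_vanishing_norm] at hs ⊢
      intro ε hε
      obtain ⟨s, hs⟩ := hs (ε ^ max p 1 / c') (by positivity)
      refine ⟨s, fun t ht => ?_⟩
      have h2 := hs t ht
      rw [Real.norm_of_nonneg (Finset.sum_nonneg fun _ _ => by positivity),
        lt_div_iff₀' hc'] at h2
      exact (Real.rpow_lt_rpow_iff (norm_nonneg _) hε.le hP).1 ((h t a).2.trans_lt h2)
    exact ⟨_, seriesTendsto_iff.2 h1.hasSum.tendsto_sum_nat⟩

/-- Block sequences of nonzero vectors are basic. -/
theorem isBasicSeq_of_isBlockSeq {q : ℕ → ℕ} {y : ℕ → RGarling 𝕜 hw hp}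
    (hy : IsBlockSeq q fun k => coord (y k)) (hy0 : ∀ k, y k ≠ 0) : IsBasicSeq 𝕜 y := by
  have hne : ∀ k, ∃ i, coord (y k) i ≠ 0 := by
    intro k
    by_contra! h
    exact hy0 k (coord_injective (by rw [map_zero]; exact funext h))
  choose ι hι using hne
  have hιm := fun k => hy.mem_of_ne_zero (hι k)
  intro t ht
  -- Being proportional to `y k` on the `k`-th interval is a linear condition preserved by
  -- coordinatewise limits, so it passes from the span to its closure.
  have hprop : ∀ k i, q k ≤ i → i < q (k + 1) →
      coord t i * coord (y k) (ι k) = coord t (ι k) * coord (y k) i := by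
    intro k i h1 h2
    rw [closedSpan_eq_closure, mem_closure_iff_seq_limit] at ht
    obtain ⟨z, hz, hzt⟩ := ht
    refine tendsto_nhds_unique ((tendsto_coord hzt i).mul_const _)
      (((tendsto_coord hzt (ι k)).mul_const _).congr fun n => ?_)
    have hzn := hz n
    refine Submodule.span_induction (p := fun z _ =>
      coord z (ι k) * coord (y k) i = coord z i * coord (y k) (ι k)) ?_ ?_ ?_ ?_ hzn
    · rintro _ ⟨l, rfl⟩
      rcases eq_or_ne l k with rfl | hl
      · exact mul_comm _ _
      · rw [hy.eq_zero_of_ne (hιm k).1 (hιm k).2 hl, hy.eq_zero_of_ne h1 h2 hl]; simp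
    · simp
    · intro u v _ _ hu hv
      simp only [map_add, Pi.add_apply, add_mul, hu, hv]
    · intro c u _ hu
      simp only [map_smul, Pi.smul_apply, smul_eq_mul, mul_assoc, hu]
  refine ⟨fun k => coord t (ι k) / coord (y k) (ι k), ?_, fun b hb => funext fun k => ?_⟩
  · simp only
    rw [seriesTendsto_iff]
    -- The partial sums are the restrictions of `t` to the initial segments below `q n`, so they
    -- converge because tails vanish.
    refine ((tendsto_restrict_Iio t).comp hy.strictMono.tendsto_atTop).congr fun n => ?_
    apply coord_injective
    funext i
    obtain ⟨k, h1, h2⟩ := exists_mem_interval hy.zero hy.strictMono i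
    rw [Function.comp_apply, coord_restrict, coord_sum, hy.sum_apply _ _ h1 h2]
    by_cases hk : k < n
    · rw [Set.indicator_of_mem (s := Set.Iio (q n))
        (h2.trans_le (hy.strictMono.monotone (Nat.succ_le_of_lt hk))),
        if_pos (Finset.mem_range.2 hk), div_mul_eq_mul_div, eq_div_iff (hι k), hprop k i h1 h2]
    · rw [Set.indicator_of_notMem (s := Set.Iio (q n)) (fun h => ?_),
        if_neg (by simpa using hk)]
      exact absurd ((hy.strictMono.monotone (not_lt.1 hk)).trans h1) (not_le.2 h)
  · rw [eq_div_iff (hι k)]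
    refine tendsto_nhds_unique (tendsto_atTop_of_eventually_const (i₀ := k + 1) fun n hn => ?_)
      (tendsto_coord (seriesTendsto_iff.1 hb) (ι k))
    rw [coord_sum, hy.sum_apply _ _ (hιm k).1 (hιm k).2, if_pos (Finset.mem_range.2 hn)]

theorem garlingSum_single_le (hw : IsGarlingWeight w) (hp : 0 < p) (A : Finset ℕ) (i : ℕ) :
    garlingSum w p A (Pi.single i (1 : 𝕜)) ≤ 1 := by
  have h := garlingSum_le_of_subset hp hw.antitone (A := A) (B := A.filter (· = i))
    (Finset.filter_subset _ _) (x := Pi.single i (1 : 𝕜)) fun j hj hj' =>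
      Pi.single_eq_of_ne (fun e => hj' (Finset.mem_filter.2 ⟨hj, e⟩)) _
  refine h.trans ?_
  rw [Finset.filter_eq']
  split_ifs
  · simp [hw.first]
  · simp

/-- The unit vectors of `g(w, p)`. -/
noncomputable def unit (hw : IsGarlingWeight w) (hp : 0 < p) (i : ℕ) : RGarling 𝕜 hw hp :=
  (exists_coord_eq fun A => garlingSum_single_le hw hp A i).choose

@[simp]
theorem coord_unit (i : ℕ) :
    coord (unit hw hp i : RGarling 𝕜 hw hp) = Pi.single i (1 : 𝕜) :=
  (exists_coord_eq fun A => garlingSum_single_le hw hp A i).choose_spec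

theorem norm_unit_rpow_le (i : ℕ) : ‖(unit hw hp i : RGarling 𝕜 hw hp)‖ ^ max p 1 ≤ 1 :=
  norm_rpow_le fun A => by rw [coord_unit]; exact garlingSum_single_le hw hp A i

theorem isBlockSeq_unit : IsBlockSeq id fun k => coord (unit hw hp k : RGarling 𝕜 hw hp) where
  zero := rfl
  strictMono := strictMono_id
  eq_zero_of_lt k i hi := by rw [coord_unit]; exact Pi.single_eq_of_ne (ne_of_lt hi) _
  eq_zero_of_ge k i hi := by
    rw [coord_unit]; exact Pi.single_eq_of_ne (by simp only [id] at hi; lia) _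

theorem coord_sum_unit (G : Finset ℕ) (i : ℕ) :
    coord (∑ k ∈ G, (unit hw hp k : RGarling 𝕜 hw hp)) i = if i ∈ G then 1 else 0 := by
  have h := isBlockSeq_unit (𝕜 := 𝕜) (hw := hw) (hp := hp).sum_apply G (fun _ => 1)
    (k := i) (i := i) le_rfl (Nat.lt_succ_self i)
  simpa only [map_sum, one_smul, one_mul, Pi.single_eq_same, coord_unit] using h

theorem exists_le_norm_sum_unit (m : ℕ) (D : ℝ) : ∃ n > m,
    D ≤ ‖∑ k ∈ Finset.Ico m n, (unit hw hp k : RGarling 𝕜 hw hp)‖ ^ max p 1 := by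
  obtain ⟨n, hn⟩ := (isBlockSeq_unit (𝕜 := 𝕜) (hw := hw) (hp := hp)).exists_le_garlingSum_sum hp hw
    one_pos (fun k => ⟨{k}, by simp [hw.first]⟩)
    (D + ‖∑ k ∈ Finset.range m, (unit hw hp k : RGarling 𝕜 hw hp)‖ ^ max p 1)
  obtain ⟨A, hA⟩ := hn (max n (m + 1)) (le_max_left _ _)
  refine ⟨max n (m + 1), by lia, ?_⟩
  rw [← map_sum, ← Finset.sum_range_add_sum_Ico _ (le_max_of_le_right (Nat.le_succ m)),
    map_add, garlingSum_add_of_disjoint hp] at hA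
  · linarith [garlingSum_le A (∑ k ∈ Finset.range m, (unit hw hp k : RGarling 𝕜 hw hp)),
      garlingSum_le A (∑ k ∈ Finset.Ico m (max n (m + 1)), (unit hw hp k : RGarling 𝕜 hw hp))]
  · intro i
    rw [coord_sum_unit, coord_sum_unit]
    by_cases hi : i < m
    · right; rw [if_neg]; simp; lia
    · left; rw [if_neg]; simp; lia

/-- The gap after a selected block is absorbed into its interval, and the first interval is extended
down to `0`. -/
theorem _root_.IsBlockSeq.subseq {q : ℕ → ℕ} {y : ℕ → ℕ → 𝕜} (hy : IsBlockSeq q y) {s : ℕ → ℕ}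
    (hs : StrictMono s) :
    IsBlockSeq (fun k => if k = 0 then 0 else q (s k)) fun k => y (s k) where
  zero := if_pos rfl
  strictMono := by
    intro k l hkl
    have hl : l ≠ 0 := by lia
    simp only [if_neg hl]
    split_ifs
    · rw [← hy.zero]; exact hy.strictMono ((Nat.zero_le _).trans_lt (hs hkl))
    · exact hy.strictMono (hs hkl)
  eq_zero_of_lt k i hi := by
    split_ifs at hi with hk
    · lia
    · exact hy.eq_zero_of_lt _ _ hi
  eq_zero_of_ge k i hi := by
    simp only [Nat.succ_ne_zero, if_false] at hi
    exact hy.eq_zero_of_ge _ _ ((hy.strictMono.monotone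
      (Nat.succ_le_of_lt (hs (Nat.lt_succ_self k)))).trans hi)

/-- Normalized blocks of constant coefficients have a subsequence equivalent to the unit vector
basis of `ℓ_p`. -/
theorem exists_isBasicSeq_hasLpEstimate (𝕜 : Type*) [RCLike 𝕜] (hw : IsGarlingWeight w)
    (hp : 0 < p) : ∃ (B : ℕ → RGarling 𝕜 hw hp) (c c' : ℝ), IsBasicSeq 𝕜 B ∧ 0 < c ∧
      HasLpEstimate B c c' := by
  have hP := max_pos p
  -- The growing lower bound makes the blocks flat after normalization: coordinates of the `k`-th
  -- one have `p`-th power at most `1 / (k + 1)`.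
  choose g hg hgD using fun m : ℕ =>
    exists_le_norm_sum_unit (𝕜 := 𝕜) (hw := hw) (hp := hp) m (m + 1)
  let q : ℕ → ℕ := fun k => g^[k] 0
  have hqs : ∀ k, q (k + 1) = g (q k) := fun k => Function.iterate_succ_apply' g k 0
  have hq : StrictMono q := strictMono_nat_of_lt_succ fun k => by rw [hqs]; exact hg _
  let f : ℕ → RGarling 𝕜 hw hp := fun k => ∑ i ∈ Finset.Ico (q k) (q (k + 1)), unit hw hp i
  have hf : ∀ k : ℕ, (k + 1 : ℝ) ≤ ‖f k‖ ^ max p 1 := fun k => by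
    simp only [f, hqs]
    refine le_trans ?_ (hgD (q k))
    have : k ≤ q k := hq.le_apply
    gcongr
  have hf0 : ∀ k, 0 < ‖f k‖ ^ max p 1 := fun k => lt_of_lt_of_le (by positivity) (hf k)
  let d : ℕ → 𝕜 := fun k => ((((‖f k‖ ^ max p 1)⁻¹ ^ (1 / p) : ℝ)) : 𝕜)
  have hd : ∀ k, ‖d k‖ ^ p = (‖f k‖ ^ max p 1)⁻¹ := fun k => by
    have := hf0 k
    rw [RCLike.norm_ofReal, abs_of_nonneg (by positivity), ← Real.rpow_mul (by positivity),
      one_div_mul_cancel hp.ne', Real.rpow_one]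
  let y : ℕ → RGarling 𝕜 hw hp := fun k => d k • f k
  have hy1 : ∀ k, ‖y k‖ ^ max p 1 = 1 := fun k => by
    simp only [y]
    rw [norm_smul_rpow_max, hd, inv_mul_cancel₀ (hf0 k).ne']
  have hycoord : ∀ k i, coord (y k) i =
      if i ∈ Finset.Ico (q k) (q (k + 1)) then d k else 0 := fun k i => by
    simp only [y, f]
    rw [map_smul, Pi.smul_apply, coord_sum_unit, smul_eq_mul, mul_ite, mul_one, mul_zero]
  have hy : IsBlockSeq q fun k => coord (y k) :=
    { zero := rfl
      strictMono := hq
      eq_zero_of_lt := fun k i hi => by rw [hycoord, if_neg]; simp; lia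
      eq_zero_of_ge := fun k i hi => by rw [hycoord, if_neg]; simp; lia }
  have hyS : ∀ k i, ‖coord (y k) i‖ ^ p ≤ 1 / (k + 1 : ℝ) := by
    intro k i
    rw [hycoord]
    split_ifs
    · rw [hd, one_div]; exact inv_anti₀ (by positivity) (hf k)
    · rw [norm_zero, Real.zero_rpow hp.ne']; positivity
  -- At index `k₀ + 4 * M` dropping `M` terms costs at most `1 / 4`, which leaves `1 / 2` of the `3
  -- / 4` secured first.
  obtain ⟨s, hs, hsη⟩ := hy.exists_lower_estimate hp hw.antitone (η := 1 / 2) fun M k₀ => by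
    obtain ⟨A, hA⟩ := exists_lt_garlingSum (x := y (k₀ + 4 * M)) (c := 3 / 4)
      (by rw [hy1]; norm_num)
    obtain ⟨E, -, hE⟩ := exists_garlingSum_le_shiftWeight (weight_le_one hw)
      (hyS (k₀ + 4 * M)) A M
    refine ⟨k₀ + 4 * M, by lia, E, ?_⟩
    have : (M : ℝ) * (1 / (↑(k₀ + 4 * M) + 1)) ≤ 1 / 4 := by
      rw [mul_one_div, div_le_div_iff₀ (by positivity) (by positivity)]
      push_cast
      have : (0 : ℝ) ≤ k₀ := Nat.cast_nonneg _
      linarith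
    linarith
  have hys : IsBlockSeq _ fun k => coord (y (s k)) := hy.subseq hs
  refine ⟨fun k => y (s k), 1 / 2, 1, isBasicSeq_of_isBlockSeq hys fun k h0 => ?_, by norm_num,
    fun t a => ⟨lower_estimate_of_range hp (fun a n => ?_) t a,
      upper_estimate hys (fun k => (hy1 _).le) t a⟩⟩
  · have := hy1 (s k)
    rw [h0, norm_zero, Real.zero_rpow hP.ne'] at this
    exact zero_ne_one this
  · obtain ⟨A, hA⟩ := hsη a n
    refine hA.trans ?_
    rw [← coord_sum _ _ fun i => y (s i)]
    exact garlingSum_le A _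

theorem HasLpEstimate.isSymmetricBasicSeq {x : ℕ → RGarling 𝕜 hw hp} {c c' : ℝ}
    (h : HasLpEstimate x c c') (hc : 0 < c) (hx : IsBasicSeq 𝕜 x) : IsSymmetricBasicSeq 𝕜 x :=
  ⟨hx, fun π a => ((h.comp_perm π).seriesConverges_iff hc a).trans
    (h.seriesConverges_iff hc a).symm⟩

/-- Sums of `n` distinct unit vectors have size `o(n)`. -/
theorem norm_sum_unit_rpow_le {τ : ℕ → ℕ} (hτ : Function.Injective τ) (M n : ℕ) :
    ‖∑ i ∈ Finset.range n, (unit hw hp (τ i) : RGarling 𝕜 hw hp)‖ ^ max p 1 ≤ M + n * w M := by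
  refine norm_rpow_le fun A => ?_
  rw [← Finset.sum_image (s := Finset.range n) (g := τ)
    (f := fun k => (unit hw hp k : RGarling 𝕜 hw hp)) hτ.injOn]
  set F := (Finset.range n).image τ with hF
  have hle : ∀ i, ‖coord (∑ k ∈ F, (unit hw hp k : RGarling 𝕜 hw hp)) i‖ ^ p ≤ 1 := fun i => by
    rw [coord_sum_unit]
    split_ifs
    · simp
    · rw [norm_zero, Real.zero_rpow hp.ne']; exact zero_le_one
  have h1 := garlingSum_le_of_subset hp hw.antitone (A := A) (B := A.filter (· ∈ F))
    (x := coord (∑ k ∈ F, (unit hw hp k : RGarling 𝕜 hw hp)))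
    (Finset.filter_subset _ _) fun i hi hi' => by
      rw [coord_sum_unit, if_neg fun h => hi' (Finset.mem_filter.2 ⟨hi, h⟩)]
  obtain ⟨B, hB, hB'⟩ := exists_garlingSum_le_shiftWeight (weight_le_one hw) hle
    (A.filter (· ∈ F)) M
  have h2 : garlingSum (shiftWeight w M) p B
      (coord (∑ k ∈ F, (unit hw hp k : RGarling 𝕜 hw hp))) ≤ B.card * w M := by
    rw [garlingSum, ← nsmul_eq_mul]
    refine Finset.sum_le_card_nsmul _ _ _ fun i _ => ?_
    exact (mul_le_of_le_one_left (weight_nonneg hw _) (hle i)).trans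
      (hw.antitone (Nat.le_add_left _ _))
  have h3 : B.card ≤ n := by
    refine (Finset.card_le_card (hB.trans fun i hi => (Finset.mem_filter.1 hi).2)).trans ?_
    exact Finset.card_image_le.trans_eq (Finset.card_range n)
  have h4 : (B.card : ℝ) * w M ≤ n * w M :=
    mul_le_mul_of_nonneg_right (by exact_mod_cast h3) (weight_nonneg hw M)
  linarith

/-- Gliding hump for expansions: a sequence of vectors whose coefficients along `B` tend to zero
has a subsequence that is close to blocks of `B`. -/
theorem exists_blocks_of_expansions {E : Type*} [NormedAddCommGroup E] [Module 𝕜 E] {r : ℝ}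
    (h : IsHomogeneousNorm 𝕜 E r) {B u : ℕ → E} {δ : ℕ → ℕ → 𝕜}
    (hδ : ∀ j, SeriesTendsto (δ j) B (u j)) (hδ0 : ∀ k, Tendsto (fun j => δ j k) atTop (𝓝 0))
    {ε : ℕ → ℝ} (hε : ∀ k, 0 < ε k) (hεa : Antitone ε) :
    ∃ N ι : ℕ → ℕ, N 0 = 0 ∧ StrictMono N ∧ StrictMono ι ∧
      ∀ k, ‖u (ι k) - ∑ i ∈ Finset.Ico (N k) (N (k + 1)), δ (ι k) i • B i‖ ≤ ε k := by
  have H : ∀ N, ∃ j ≥ N, ∃ m > N, j < m ∧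
      ‖u j - ∑ i ∈ Finset.Ico N m, δ j i • B i‖ ≤ ε N := by
    intro N
    have h0 : Tendsto (fun j => ‖∑ i ∈ Finset.range N, δ j i • B i‖) atTop (𝓝 0) := by
      have : Tendsto (fun j => ∑ i ∈ Finset.range N, δ j i • B i) atTop
          (𝓝 (∑ i ∈ Finset.range N, (0 : 𝕜) • B i)) :=
        tendsto_finsetSum _ fun i _ => ((h.continuous_smul_left (B i)).tendsto 0).comp (hδ0 i)
      simpa using this.norm
    obtain ⟨j, hj, hjN⟩ := ((h0.eventually_lt_const (half_pos (hε N))).and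
      (eventually_ge_atTop N)).exists
    obtain ⟨m, hm, hmj⟩ := (((hδ j).eventually_lt_const (half_pos (hε N))).and
      (eventually_gt_atTop j)).exists
    refine ⟨j, hjN, m, by lia, hmj, ?_⟩
    have h1 : u j - ∑ i ∈ Finset.Ico N m, δ j i • B i =
        (u j - ∑ i ∈ Finset.range m, δ j i • B i) + ∑ i ∈ Finset.range N, δ j i • B i := by
      rw [Finset.sum_Ico_eq_sub _ (by lia)]; abel
    rw [h1]
    exact (norm_add_le _ _).trans (by linarith)
  choose J hJ g hg hJg hle using H
  let N : ℕ → ℕ := fun k => g^[k] 0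
  have hNs : ∀ k, N (k + 1) = g (N k) := fun k => Function.iterate_succ_apply' g k 0
  have hN : StrictMono N := strictMono_nat_of_lt_succ fun k => by rw [hNs]; exact hg _
  refine ⟨N, fun k => J (N k), rfl, hN, strictMono_nat_of_lt_succ fun k => ?_, fun k => ?_⟩
  · exact (hJg (N k)).trans_le (by rw [← hNs]; exact hJ _)
  · rw [hNs]
    exact (hle (N k)).trans (hεa hN.le_apply)

theorem sum_range_eq_sum_blocks {F : Type*} [AddCommMonoid F] {N : ℕ → ℕ} (hN0 : N 0 = 0)
    (hN : StrictMono N) (v : ℕ → F) (n : ℕ) : ∑ i ∈ Finset.range (N n), v i =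
      ∑ k ∈ Finset.range n, ∑ i ∈ Finset.Ico (N k) (N (k + 1)), v i := by
  induction n with
  | zero => simp [hN0]
  | succ n ih =>
    rw [Finset.sum_range_succ, ← ih,
      Finset.sum_range_add_sum_Ico _ (hN (Nat.lt_succ_self n)).le]

/-- Sequences equivalent to the unit vector basis of `ℓ_p` do not span `g(w, p)`. -/
theorem HasLpEstimate.exists_not_seriesTendsto {B : ℕ → RGarling 𝕜 hw hp} {c c' : ℝ}
    (h : HasLpEstimate B c c') (hc : 0 < c) :
    ∃ x : RGarling 𝕜 hw hp, ∀ a : ℕ → 𝕜, ¬ SeriesTendsto a B x := by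
  by_contra! hcon
  have hP := max_pos p
  have hc' : 0 < c' := by
    have h1 := h {0} 1
    simp only [Finset.sum_singleton, Pi.one_apply, norm_one, Real.one_rpow, mul_one] at h1
    linarith
  choose b hb using fun m => hcon (unit hw hp m)
  have hbound : ∀ m j, ‖b m j‖ ≤ (1 / c) ^ (1 / p) := by
    intro m j
    have h1 : c * ‖b m j‖ ^ p ≤ 1 := by
      have h2 := (seriesTendsto_iff.1 (hb m)).norm.rpow_const (p := max p 1) (Or.inr hP.le)
      refine (ge_of_tendsto h2 ?_).trans (norm_unit_rpow_le m)
      filter_upwards [eventually_gt_atTop j] with n hn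
      refine le_trans ?_ (h (Finset.range n) (b m)).1
      refine mul_le_mul_of_nonneg_left ?_ hc.le
      exact Finset.single_le_sum (f := fun j => ‖b m j‖ ^ p) (fun _ _ => by positivity)
        (Finset.mem_range.2 hn)
    have h2 := Real.rpow_le_rpow (by positivity) ((le_div_iff₀' hc).2 h1)
      (by positivity : 0 ≤ 1 / p)
    rwa [← Real.rpow_mul (norm_nonneg _), mul_one_div_cancel hp.ne', Real.rpow_one] at h2
  obtain ⟨φ, hφ, f, hf⟩ := exists_subseq_tendsto_coordinatewise b hbound
  -- Differences are taken so that the coefficients along `B` tend to zero, while the coordinate at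
  -- `φ j` keeps the norm at least one.
  set u : ℕ → RGarling 𝕜 hw hp := fun j => unit hw hp (φ j) - unit hw hp (φ (j + 1)) with hu
  have hu1 : ∀ j, 1 ≤ ‖u j‖ := by
    intro j
    have h1 := norm_coord_rpow_min_le (u j) (φ j)
    have h2 : φ j ≠ φ (j + 1) := (hφ (Nat.lt_succ_self j)).ne
    rw [hu] at h1
    simpa [h2] using h1
  obtain ⟨N, ι, hN0, hN, hι, hclose⟩ := exists_blocks_of_expansions
    (isHomogeneousNorm (𝕜 := 𝕜) (hw := hw) (hp := hp)) (B := B) (u := u)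
    (δ := fun j k => b (φ j) k - b (φ (j + 1)) k)
    (fun j => by
      rw [seriesTendsto_iff]
      simpa only [sub_smul, Finset.sum_sub_distrib] using
        (seriesTendsto_iff.1 (hb (φ j))).sub (seriesTendsto_iff.1 (hb (φ (j + 1)))))
    (fun k => by simpa using (hf k).sub ((hf k).comp (tendsto_add_atTop_nat 1)))
    (ε := fun k => 1 / 4 * (1 / 2) ^ k) (fun k => by positivity) (fun k l hkl =>
      mul_le_mul_of_nonneg_left (pow_le_pow_of_le_one (by norm_num) (by norm_num) hkl)
        (by norm_num))
  -- the coefficients of the blocks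
  choose κ hκ1 hκ2 using exists_mem_interval hN0 hN
  have hκeq : ∀ k, ∀ i ∈ Finset.Ico (N k) (N (k + 1)), κ i = k := fun k i hi =>
    interval_unique hN (hκ1 i) (hκ2 i) (Finset.mem_Ico.1 hi).1 (Finset.mem_Ico.1 hi).2
  set α : ℕ → 𝕜 := fun i => b (φ (ι (κ i))) i - b (φ (ι (κ i) + 1)) i with hα
  set z : ℕ → RGarling 𝕜 hw hp := fun k =>
    ∑ i ∈ Finset.Ico (N k) (N (k + 1)), α i • B i with hz
  have hzu : ∀ k, ‖u (ι k) - z k‖ ≤ 1 / 4 * (1 / 2) ^ k := by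
    intro k
    refine le_trans (le_of_eq ?_) (hclose k)
    rw [hz]
    simp only [hα]
    rw [Finset.sum_congr rfl fun i hi => by rw [hκeq k i hi]]
  have hz1 : ∀ k, 1 / 2 ≤ ‖z k‖ := by
    intro k
    have h1 := norm_sub_norm_le (u (ι k)) (z k)
    have h2 : 1 / 4 * (1 / 2 : ℝ) ^ k ≤ 1 / 4 * 1 := by
      gcongr; exact pow_le_one₀ (by norm_num) (by norm_num)
    linarith [hu1 (ι k), hzu k]
  -- Each `z k` has norm at least `1 / 2`, so by the upper estimate its coefficients have `ℓ_p` mass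
  -- at least `(1 / 2) ^ max p 1 / c'`; the lower estimate adds these masses up.
  set γ := c / c' * (1 / 2) ^ max p 1 with hγ
  have hγ0 : 0 < γ := by positivity
  have hlow : ∀ n : ℕ, n * γ ≤ ‖∑ k ∈ Finset.range n, z k‖ ^ max p 1 := by
    intro n
    rw [hz, ← sum_range_eq_sum_blocks hN0 hN fun i => α i • B i]
    refine le_trans ?_ (h (Finset.range (N n)) α).1
    rw [sum_range_eq_sum_blocks hN0 hN fun i => ‖α i‖ ^ p, Finset.mul_sum, ← nsmul_eq_mul]
    refine (le_of_eq (by rw [Finset.card_range])).trans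
      (Finset.card_nsmul_le_sum (Finset.range n) _ γ fun k _ => ?_)
    have h1 := (h (Finset.Ico (N k) (N (k + 1))) α).2
    have h2 := Real.rpow_le_rpow (by norm_num) (hz1 k) hP.le
    rw [hγ, div_mul_eq_mul_div, div_le_iff₀ hc', mul_assoc]
    refine mul_le_mul_of_nonneg_left ?_ hc.le
    rw [mul_comm _ c']
    exact h2.trans h1
  have hdist : ∀ n, ‖∑ k ∈ Finset.range n, z k‖ ≤
      ‖∑ k ∈ Finset.range n, u (ι k)‖ + 1 := by
    intro n
    have h1 := norm_sub_norm_le (∑ k ∈ Finset.range n, z k) (∑ k ∈ Finset.range n, u (ι k))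
    rw [norm_sub_rev, ← Finset.sum_sub_distrib] at h1
    have h2 : ‖∑ k ∈ Finset.range n, (u (ι k) - z k)‖ ≤ 1 := by
      refine (norm_sum_le_of_le _ fun k _ => hzu k).trans ?_
      rw [← Finset.mul_sum]
      have := (summable_geometric_two.sum_le_tsum (Finset.range n) fun j _ => by
        positivity).trans_eq tsum_geometric_two
      linarith
    linarith
  -- The vectors `u (ι k)` sum to a difference of two sums of `n` distinct unit vectors. The factor
  -- `3` comes from these two sums and the perturbation, each at most `T`.
  have hup : ∀ M n : ℕ, ‖∑ k ∈ Finset.range n, z k‖ ^ max p 1 ≤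
      3 ^ max p 1 * (M + n * w M + 1) := by
    intro M n
    have hw0 := weight_nonneg hw M
    set T := (M + n * w M + 1 : ℝ) ^ (1 / max p 1) with hT
    have hTP : T ^ max p 1 = M + n * w M + 1 := by
      rw [hT, ← Real.rpow_mul (by positivity), one_div_mul_cancel hP.ne', Real.rpow_one]
    have hT1 : 1 ≤ T := Real.one_le_rpow (by
      have : 0 ≤ (M : ℝ) + n * w M := by positivity
      linarith) (by positivity)
    have key : ∀ τ : ℕ → ℕ, Function.Injective τ →
        ‖∑ i ∈ Finset.range n, (unit hw hp (τ i) : RGarling 𝕜 hw hp)‖ ≤ T := by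
      intro τ hτ
      refine (Real.rpow_le_rpow_iff (norm_nonneg _) (by positivity) hP).1 ?_
      rw [hTP]
      linarith [norm_sum_unit_rpow_le (𝕜 := 𝕜) (hw := hw) (hp := hp) hτ M n]
    have h1 : ‖∑ k ∈ Finset.range n, u (ι k)‖ ≤ T + T := by
      simp only [hu, Finset.sum_sub_distrib]
      exact (norm_sub_le _ _).trans (add_le_add
        (key (fun k => φ (ι k)) (hφ.injective.comp hι.injective))
        (key (fun k => φ (ι k + 1)) fun k l hkl => hι.injective (by
          have := hφ.injective hkl; lia)))
    rw [← hTP, ← Real.mul_rpow (by norm_num) (by positivity)]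
    exact Real.rpow_le_rpow (norm_nonneg _) (by linarith [hdist n]) hP.le
  -- First `M` is fixed so that the term with `w M` is at most half of `n * γ` for every `n`; then
  -- `n` is taken so large that the remaining constant is below the other half.
  obtain ⟨M, hM⟩ := (hw.tendsto_zero.eventually_lt_const
    (show 0 < γ / (2 * 3 ^ max p 1) by positivity)).exists
  rw [lt_div_iff₀ (by positivity)] at hM
  obtain ⟨n, hn⟩ := exists_nat_gt (2 * (3 ^ max p 1 * (M + 1)) / γ)
  rw [div_lt_iff₀ hγ0] at hn
  have h1 := (hlow n).trans (hup M n)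
  have h2 : (n : ℝ) * (w M * (2 * 3 ^ max p 1)) ≤ n * γ := by gcongr
  linarith

end RGarling

/-! ### Transfer to the quasi-normed space -/

namespace RGarling

variable {𝕜 : Type*} [RCLike 𝕜] {w : ℕ → ℝ} {p : ℝ} {hw : IsGarlingWeight w} {hp : 0 < p}

theorem _root_.IsSymmetricBasicSeq.hasLpEstimate {B : ℕ → RGarling 𝕜 hw hp}
    (hB : IsSymmetricBasicSeq 𝕜 (fun j => toGarling (B j))) :
    ∃ c c', 0 < c ∧ HasLpEstimate B c c' := by
  obtain ⟨C, hC⟩ := (isHomogeneousNorm (𝕜 := 𝕜) (hw := hw) (hp := hp)).exists_isUniformlySymmetric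
    (isSymmetricBasicSeq_toGarling_iff.1 hB)
  exact hC.hasLpEstimate

theorem HasLpEstimate.basicSeqEquiv {B : ℕ → RGarling 𝕜 hw hp} {c c' : ℝ}
    (h : HasLpEstimate B c c') (hc : 0 < c) :
    BasicSeqEquiv 𝕜 (fun j => toGarling (B j)) (lpUnitVectorBasis 𝕜 p) := fun a => by
  rw [seriesConverges_toGarling_iff, h.seriesConverges_iff hc,
    seriesConverges_lpUnitVectorBasis_iff hp]

end RGarling

theorem mainTheorem3 (𝕜 : Type*) [RCLike 𝕜] (p : ℝ) (hp : 0 < p) (w : ℕ → ℝ)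
    (hw : IsGarlingWeight w) :
    -- every symmetric basic sequence is equivalent to the unit vector basis of `ℓ_p`
    (∀ B : ℕ → GarlingSpace 𝕜 w p hp, IsSymmetricBasicSeq 𝕜 B →
      BasicSeqEquiv 𝕜 B (lpUnitVectorBasis 𝕜 p)) ∧
    -- there is, up to equivalence, a unique symmetric basic sequence
    (∃ B₀ : ℕ → GarlingSpace 𝕜 w p hp, IsSymmetricBasicSeq 𝕜 B₀ ∧
      ∀ B : ℕ → GarlingSpace 𝕜 w p hp, IsSymmetricBasicSeq 𝕜 B → BasicSeqEquiv 𝕜 B B₀) ∧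
    -- there is no symmetric basis of the whole space
    (¬ ∃ B : ℕ → GarlingSpace 𝕜 w p hp, IsSchauderBasis 𝕜 B ∧ IsSymmetricBasicSeq 𝕜 B) := by
  have h1 : ∀ B : ℕ → GarlingSpace 𝕜 w p hp, IsSymmetricBasicSeq 𝕜 B →
      BasicSeqEquiv 𝕜 B (lpUnitVectorBasis 𝕜 p) := by
    intro B hB
    obtain ⟨c, c', hc, h⟩ := IsSymmetricBasicSeq.hasLpEstimate (hw := hw) (B := B) hB
    exact h.basicSeqEquiv hc
  refine ⟨h1, ?_, ?_⟩
  · obtain ⟨B₀, c, c', hB₀, hc, h⟩ := RGarling.exists_isBasicSeq_hasLpEstimate 𝕜 hw hp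
    exact ⟨fun j => RGarling.toGarling (B₀ j),
      RGarling.isSymmetricBasicSeq_toGarling_iff.2 (h.isSymmetricBasicSeq hc hB₀),
      fun B hB a => (h1 B hB a).trans (h.basicSeqEquiv hc a).symm⟩
  · rintro ⟨B, hbasis, hB⟩
    obtain ⟨c, c', hc, h⟩ := IsSymmetricBasicSeq.hasLpEstimate (hw := hw) (B := B) hB
    obtain ⟨x, hx⟩ := h.exists_not_seriesTendsto hc
    obtain ⟨a, ha, -⟩ := hbasis (RGarling.toGarling x)
    exact hx a (RGarling.seriesTendsto_toGarling_iff.1 ha)
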